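/- **Setting.** Let $\ell(y\mid\cdot):\mathbb R^n\to(0,\infty)$ be the likelihood of a fixed observation $y$, put $g=-\log\ell(y\mid\cdot)$, let $p:\mathbb R^n\to(0,\infty)$ be a probability density (the prior) such that $\ell(y\mid\cdot)\,p$ is integrable, and let $\pi\propto \ell(y\mid\cdot)\,p$ be the posterior distribution. For $\sigma>0$ let $p_\sigma(x)=\int p(z)\phi_\sigma(x-z)\,dz$, where $\phi_\sigma$ is the density of $\mathcal N(0,\sigma^2I)$, and let $\mathcal S_\theta(\cdot,\sigma):\mathbb R^n\to\mathbb R^n$ be a score network. Fix $\sigma>0$, a step size $\gamma>0$ and a number of iterations $N\ge 1$. **Assumptions.** There are constants $L_g,L_p,L_\sigma,R_g>0$ and $C,\varepsilon_\sigma\in\mathbb R$ such that, for all $x,x_1,x_2\in\mathbb R^n$ (with Euclidean norms): 1. $\log\ell(y\mid\cdot)$ is differentiable and $\|\nabla g(x_1)-\nabla g(x_2)\|\le L_g\|x_1-x_2\|$; 2. $\log p$ is differentiable and $\|\nabla\log p(x_1)-\nabla\log p(x_2)\|\le L_p\|x_1-x_2\|$; 3. $\|\mathcal S_\theta(x_1,\sigma)-\mathcal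 S_\theta(x_2,\sigma)\|\le L_\sigma\|x_1-x_2\|$ and $\|\mathcal S_\theta(x,\sigma)-\nabla\log p_\sigma(x)\|\le\varepsilon_\sigma$; 4. $\|\nabla\log p_\sigma(x)-\nabla\log p(x)\|\le\sigma C$; 5. $\|\nabla g(x)\|\le R_g$. **Algorithm.** Let $\mathcal P(x)=\nabla g(x)-\mathcal S_\theta(x-\gamma\nabla g(x),\sigma)$. Let $(B_t)_{t\ge0}$ be a standard Brownian motion in $\mathbb R^n$ and $x_0$ a random vector independent of it. The PMC-PnP iterates are $x_{(k+1)\gamma}=x_{k\gamma}-\gamma\mathcal P(x_{k\gamma})+\sqrt{2\gamma}\,Z_k$ with $Z_k=\gamma^{-1/2}(B_{(k+1)\gamma}-B_{k\gamma})\sim\mathcal N(0,I)$, where $x_{k\gamma}$ denotes the $k$-th iterate, and their continuous interpolation is $$x_t=x_{k\gamma}-(t-k\gamma)\,\mathcal P(x_{k\gamma})+\sqrt2\,(B_t-B_{k\gamma}),\qquad t\in[k\gamma,(k+1)\gamma].$$ Let $\nu_t$ be the law of $x_t$. **Theorem (PMC-PnP).** Let $L=L_g+\max\{L_\sigma+\gamma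 L_gL_\sigma,\;L_p\}$. If $\gamma L\le 1/\sqrt{32}$, then $$\frac1{N\gamma}\int_0^{N\gamma}\mathrm{FI}(\nu_t\,\|\,\pi)\,dt\;\le\;\frac{4\,\mathrm{KL}(\nu_0\,\|\,\pi)}{N\gamma}+\left(24nL^2+7L_\sigma R_g^2\right)\gamma+36C^2\sigma^2+36\,\varepsilon_\sigma^2,$$ where $\mathrm{KL}(\nu\|\pi)=\int\log\frac{d\nu}{d\pi}\,d\nu$ is the Kullback-Leibler divergence ($\infty$ if $\nu\not\ll\pi$) and $\mathrm{FI}(\nu\|\pi)=\int\big\|\nabla\log\frac{d\nu}{d\pi}\big\|^2d\nu$ is the relative Fisher information ($\infty$ if $d\nu/d\pi$ does not exist or is not weakly differentiable). -/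

import Mathlib

open MeasureTheory ProbabilityTheory
open scoped ENNReal NNReal

noncomputable section

namespace PMC

/-- `ℝⁿ` with its Euclidean norm. -/
abbrev Vec (n : ℕ) : Type := EuclideanSpace ℝ (Fin n)

/-! ### The posterior and the scores -/

/-- The score `∇ log q` of a positive function `q`. -/
def score {n : ℕ} (q : Vec n → ℝ) : Vec n → Vec n :=
  gradient (fun x => Real.log (q x))

/-- The data-fidelity term `g = - log ℓ(y | ·)` of the likelihood `ℓ(y | ·)`. -/
def dataFidelity {n : ℕ} (ℓ : Vec n → ℝ) : Vec n → ℝ :=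
  fun x => - Real.log (ℓ x)

/-- The posterior distribution `π ∝ ℓ(y | ·) p`, as a measure. -/
def posterior {n : ℕ} (ℓ p : Vec n → ℝ) : Measure (Vec n) :=
  volume.withDensity (fun x => ENNReal.ofReal (ℓ x * p x / ∫ z, ℓ z * p z))

/-- The density `φ_σ` of the normal distribution `N(0, σ² I)` on `ℝⁿ`. -/
def gaussianDensity {n : ℕ} (σ : ℝ) (x : Vec n) : ℝ :=
  (2 * Real.pi * σ ^ 2) ^ (-(n : ℝ) / 2) * Real.exp (-‖x‖ ^ 2 / (2 * σ ^ 2))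

/-- The smoothed prior `p_σ(x) = ∫ p(z) φ_σ(x - z) dz`. -/
def smoothedPrior {n : ℕ} (p : Vec n → ℝ) (σ : ℝ) (x : Vec n) : ℝ :=
  ∫ z, p z * gaussianDensity σ (x - z)

/-! ### The relative Fisher information -/

/-- `G` is the weak (distributional) gradient of `h` on `ℝⁿ`. -/
def IsWeakGradient {n : ℕ} (h : Vec n → ℝ) (G : Vec n → Vec n) : Prop :=
  LocallyIntegrable h volume ∧ LocallyIntegrable G volume ∧
    ∀ φ : Vec n → ℝ, ContDiff ℝ ((⊤ : ℕ∞) : WithTop ℕ∞) φ → HasCompactSupport φ →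
      ∫ x, h x • gradient φ x = - ∫ x, φ x • G x

/-- `s` is `∇ log (dν/dπ)`: `ν` is absolutely continuous with respect to `π`, and its density
`h = dν/dπ` has the weak gradient `∇ h = h • s`. This determines `s` up to `ν`-null sets. For `h`
positive and continuously differentiable, `s` is the classical gradient of `log h`.
(Here `π` is a measure with the same null sets as Lebesgue measure.) -/
def IsRelativeScore {n : ℕ} (ν π : Measure (Vec n)) (s : Vec n → Vec n) : Prop :=
  ν ≪ π ∧ IsWeakGradient (fun x => (ν.rnDeriv π x).toReal)
    (fun x => (ν.rnDeriv π x).toReal • s x)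

/-- The relative Fisher information `FI(ν ‖ π) = ∫ ‖∇ log (dν/dπ)‖² dν`. The infimum runs over
the versions of `∇ log (dν/dπ)`, which all give the same value, and it is `∞` if there is none,
that is, if `ν` has no weakly differentiable density with respect to `π`. -/
def relFisherInfo {n : ℕ} (ν π : Measure (Vec n)) : ℝ≥0∞ :=
  ⨅ (s : Vec n → Vec n) (_ : IsRelativeScore ν π s), ∫⁻ x, ‖s x‖ₑ ^ 2 ∂ν

/-! ### The algorithm and its continuous interpolation -/

/-- Standard Brownian motion in `ℝⁿ`: the coordinates are independent real Brownian motions. -/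
structure IsBrownianMotion {n : ℕ} {Ω : Type*} [MeasurableSpace Ω]
    (B : ℝ≥0 → Ω → Vec n) (P : Measure Ω) : Prop where
  measurable : ∀ t, Measurable (B t)
  isBrownianReal : ∀ i, IsBrownianReal (fun t ω => B t ω i) P
  iIndepFun : iIndepFun (fun (i : Fin n) (ω : Ω) (t : ℝ≥0) => B t ω i) P

/-- The PnP drift `𝒫(x) = ∇g(x) - S(x - γ ∇g(x))`. -/
def pnpDrift {n : ℕ} (γ : ℝ) (g : Vec n → ℝ) (S : Vec n → Vec n) (x : Vec n) : Vec n :=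
  gradient g x - S (x - γ • gradient g x)

/-- The normalized increments `Z_k = (B_{(k+1)γ} - B_{kγ}) / √γ`, which are i.i.d. `N(0, I)`. -/
def noise {n : ℕ} {Ω : Type*} (γ : ℝ) (B : ℝ≥0 → Ω → Vec n) (k : ℕ) (ω : Ω) : Vec n :=
  (√γ)⁻¹ • (B ((k + 1) * γ).toNNReal ω - B (k * γ).toNNReal ω)

/-- The PMC-PnP iterates `x_{k+1} = x_k - γ 𝒫(x_k) + √(2γ) Z_k`. -/
def pmcPnP {n : ℕ} {Ω : Type*} (γ : ℝ) (g : Vec n → ℝ) (S : Vec n → Vec n)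
    (x₀ : Ω → Vec n) (B : ℝ≥0 → Ω → Vec n) : ℕ → Ω → Vec n
  | 0, ω => x₀ ω
  | k + 1, ω => pmcPnP γ g S x₀ B k ω - γ • pnpDrift γ g S (pmcPnP γ g S x₀ B k ω)
      + √(2 * γ) • noise γ B k ω

/-- The continuous interpolation of the iterates: for `t ∈ [kγ, (k+1)γ]`,
`x_t = x_{kγ} - (t - kγ) 𝒫(x_{kγ}) + √2 (B_t - B_{kγ})`, where `x_{kγ}` is the `k`-th iterate.
(The formulas on two neighbouring intervals agree at the common end point.) -/
def interpolation {n : ℕ} {Ω : Type*} (γ : ℝ) (g : Vec n → ℝ) (S : Vec n → Vec n)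
    (x₀ : Ω → Vec n) (B : ℝ≥0 → Ω → Vec n) (t : ℝ) (ω : Ω) : Vec n :=
  pmcPnP γ g S x₀ B ⌊t / γ⌋₊ ω
    - (t - ⌊t / γ⌋₊ * γ) • pnpDrift γ g S (pmcPnP γ g S x₀ B ⌊t / γ⌋₊ ω)
    + √2 • (B t.toNNReal ω - B (⌊t / γ⌋₊ * γ).toNNReal ω)

/-- The law `ν_t` of the interpolation at time `t`. -/
def interpolationLaw {n : ℕ} {Ω : Type*} [MeasurableSpace Ω] (P : Measure Ω) (γ : ℝ)
    (g : Vec n → ℝ) (S : Vec n → Vec n) (x₀ : Ω → Vec n) (B : ℝ≥0 → Ω → Vec n) (t : ℝ) :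
    Measure (Vec n) :=
  P.map (interpolation γ g S x₀ B t)

end PMC

end

/-! Entropy dissipation, step by step. Write `π = exp (-V)` with `v = ∇V`, and let `b` be the PnP
drift. Within one step the interpolation is `x_t = x - t b(x) + √(2t) Z` with `Z` standard normal
and independent of `x`, so for `t > 0` its law is a Gaussian mixture with a smooth positive density.
Its score is `-(2t)^(-1/2) E[Z | x_t]`. Formally, with `w = ∇ log (dν_t/dπ)`, `d/dt KL(ν_t ‖ π) =
-E‖w(x_t)‖² + E⟪w(x_t), v(x_t) - b(x)⟫ ≤ -(3/4) FI + E‖v(x_t) - b(x)‖²`.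

The last term, `driftGap`, is controlled by the Fisher information itself (`driftGap_le`). The drift
differs from `v` by at most a constant `e`, made of the inner gradient step, the network error and
the smoothing bias (`norm_pnpDrift_sub_le`); the displacement `x_t - x` costs `t² E‖b(x)‖² + 2tn`;
and `E‖v(x_t)‖² ≤ FI + 2nL` by a Gaussian integration by parts (`integral_grad_sq_le`). Since `γ L`
is small, the terms containing the gap are absorbed and `driftGap ≤ FI / 7 + 7nL²γ + (16/7) e²`.
Summing over the steps leaves `(3/4 - 1/7) ∫ FI = (17/28) ∫ FI` on the left, which is stronger than
the constants of the theorem.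

The analytic work is to justify the dissipation formula when only `KL(ν_0 ‖ π) < ∞` is known. The
entropy is replaced by `localEnt`: a convex entropy with bounded derivative `truncLog δ`, multiplied
by a spatial cutoff `χ`. Its time derivative comes from a convexity squeeze
(`hasDerivAt_of_sub_le`), so that only expectations of fixed test functions along `x_t` are
differentiated, never the density in time. The cutoff adds an error of order `‖∇χ‖∞ · |log δ|`
(`entRate_le`). `L¹` continuity at time zero (`tendsto_localEnt`) lets the localized entropies
telescope over all the steps with `χ` and `δ` fixed; only then is the cutoff removed, by Fatou's
lemma (`sum_lintegral_fisher_le`). Finite entropy also supplies the second moment of the drift,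
because `‖v‖` has Gaussian tails under `π`. -/

noncomputable section

namespace PMC

open MeasureTheory ProbabilityTheory Filter Topology Set
open scoped ENNReal NNReal RealInnerProductSpace

section

variable {n : ℕ}

/-! ### The heat kernel -/

/-- The density of `N(0, 2t I)` on `ℝⁿ`. -/
def heatKernel (t : ℝ) (w : Vec n) : ℝ :=
  ((4 * Real.pi * t) ^ ((n : ℝ) / 2))⁻¹ * Real.exp (-‖w‖ ^ 2 / (4 * t))

lemma heatKernel_pos {t : ℝ} (ht : 0 < t) (w : Vec n) : 0 < heatKernel t w := by
  unfold heatKernel; positivity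

lemma heatKernel_le {t : ℝ} (ht : 0 < t) (w : Vec n) :
    heatKernel t w ≤ ((4 * Real.pi * t) ^ ((n : ℝ) / 2))⁻¹ := by
  unfold heatKernel
  have h : 0 ≤ ((4 * Real.pi * t) ^ ((n : ℝ) / 2))⁻¹ := by positivity
  refine mul_le_of_le_one_right h (Real.exp_le_one_iff.2 ?_)
  rw [neg_div]
  exact neg_nonpos.2 (by positivity)

lemma continuous_heatKernel {t : ℝ} : Continuous (heatKernel t : Vec n → ℝ) := by
  unfold heatKernel; fun_prop

lemma continuousOn_heatKernel :
    ContinuousOn (fun q : ℝ × Vec n => heatKernel q.1 q.2) (Ioi 0 ×ˢ univ) := by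
  unfold heatKernel
  have h1 : ContinuousOn (fun q : ℝ × Vec n => 4 * Real.pi * q.1) (Ioi 0 ×ˢ univ) := by fun_prop
  refine ContinuousOn.mul (ContinuousOn.inv₀ (h1.rpow_const ?_) ?_) ?_
  · intro q hq; right; positivity
  · rintro q ⟨hq : 0 < q.1, -⟩; positivity
  · refine Real.continuous_exp.comp_continuousOn (ContinuousOn.div (by fun_prop) (by fun_prop) ?_)
    rintro q ⟨hq : 0 < q.1, -⟩; positivity

lemma hasGradientAt_heatKernel (t : ℝ) (w : Vec n) :
    HasGradientAt (heatKernel t) (-(heatKernel t w / (2 * t)) • w) w := by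
  rw [hasGradientAt_iff_hasFDerivAt]
  unfold heatKernel
  have h1 : HasFDerivAt (fun w : Vec n => ‖w‖ ^ 2) (2 • innerSL ℝ w) w :=
    (hasStrictFDerivAt_norm_sq w).hasFDerivAt
  have h2 := ((h1.neg.mul_const (4 * t)⁻¹).exp).const_mul ((4 * Real.pi * t) ^ ((n : ℝ) / 2))⁻¹
  simp only [div_eq_mul_inv] at h2 ⊢
  refine h2.congr_fderiv ?_
  ext v
  simp only [InnerProductSpace.toDual_apply_apply, smul_apply, inner_smul_left,
    innerSL_apply_apply, neg_apply, smul_eq_mul, nsmul_eq_mul]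
  simp
  ring

lemma lintegral_heatKernel {t : ℝ} (ht : 0 < t) :
    ∫⁻ w : Vec n, ENNReal.ofReal (heatKernel t w) = 1 := by
  have h := GaussianFourier.integral_rexp_neg_mul_sq_norm (V := Vec n) (b := (4 * t)⁻¹)
    (by positivity)
  have h2 : ∫ w : Vec n, heatKernel t w = 1 := by
    unfold heatKernel
    rw [integral_const_mul]
    have : ∀ v : Vec n, -‖v‖ ^ 2 / (4 * t) = -(4 * t)⁻¹ * ‖v‖ ^ 2 := fun v => by ring
    simp_rw [this, h, finrank_euclideanSpace, Fintype.card_fin]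
    have : Real.pi / (4 * t)⁻¹ = 4 * Real.pi * t := by field_simp
    rw [this]
    exact inv_mul_cancel₀ (by positivity)
  have hi : Integrable (heatKernel t : Vec n → ℝ) := by
    by_contra hc
    rw [integral_undef hc] at h2
    exact zero_ne_one h2
  rw [← ofReal_integral_eq_lintegral_ofReal hi (ae_of_all _ fun w => (heatKernel_pos ht w).le), h2,
    ENNReal.ofReal_one]

/-- The law of `√(2t) Z`, for a standard normal vector `Z`, has the heat kernel as its density. -/
lemma map_smul_stdGaussian {t : ℝ} (ht : 0 < t) :
    (stdGaussian (Vec n)).map (fun z => √(2 * t) • z)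
      = volume.withDensity (fun w => ENNReal.ofReal (heatKernel t w)) := by
  have hm : Measurable fun w : Vec n => ENNReal.ofReal (heatKernel t w) :=
    continuous_heatKernel.measurable.ennreal_ofReal
  have : IsProbabilityMeasure
      (volume.withDensity (fun w : Vec n => ENNReal.ofReal (heatKernel t w))) :=
    ⟨by rw [withDensity_apply _ MeasurableSet.univ, Measure.restrict_univ, lintegral_heatKernel ht]⟩
  have : IsProbabilityMeasure ((stdGaussian (Vec n)).map (fun z => √(2 * t) • z)) :=
    Measure.isProbabilityMeasure_map (by fun_prop)
  -- Both characteristic functions equal `exp (-t ‖ξ‖²)`; for the density this is the Gaussian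
  -- Fourier integral with parameter `1 / (4t)`.
  apply Measure.ext_of_charFun
  ext ξ
  rw [charFun_map_smul, charFun_stdGaussian, charFun_apply,
    integral_withDensity_eq_integral_toReal_smul hm (by simp)]
  have h := GaussianFourier.integral_cexp_neg_mul_sq_norm_add (V := Vec n) (b := ((4 * t)⁻¹ : ℝ))
    (by rw [Complex.ofReal_re]; positivity) Complex.I ξ
  have e : ∀ v : Vec n, (ENNReal.ofReal (heatKernel t v)).toReal •
      Complex.exp (⟪v, ξ⟫ * Complex.I) = ((((4 * Real.pi * t) ^ ((n : ℝ) / 2))⁻¹ : ℝ) : ℂ) *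
      Complex.exp (-(((4 * t)⁻¹ : ℝ) : ℂ) * ‖v‖ ^ 2 + Complex.I * ⟪ξ, v⟫) := by
    intro v
    rw [ENNReal.toReal_ofReal (heatKernel_pos ht v).le, Complex.real_smul, heatKernel,
      Complex.ofReal_mul, mul_assoc, Complex.ofReal_exp, ← Complex.exp_add, real_inner_comm]
    congr 2
    push_cast
    ring
  simp_rw [e]
  rw [integral_const_mul, h, finrank_euclideanSpace, Fintype.card_fin]
  have hc : ((Real.pi : ℂ) / (((4 * t)⁻¹ : ℝ) : ℂ)) ^ ((n : ℂ) / 2)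
      = (((4 * Real.pi * t) ^ ((n : ℝ) / 2) : ℝ) : ℂ) := by
    have e1 : (Real.pi : ℂ) / (((4 * t)⁻¹ : ℝ) : ℂ) = ((4 * Real.pi * t : ℝ) : ℂ) := by
      rw [← Complex.ofReal_div]; congr 1; field_simp
    rw [e1, Complex.ofReal_cpow (by positivity)]
    push_cast; rfl
  rw [hc, ← mul_assoc, ← Complex.ofReal_mul, inv_mul_cancel₀ (by positivity), Complex.ofReal_one,
    one_mul, norm_smul, ← Complex.ofReal_pow, mul_pow, Real.norm_of_nonneg (by positivity),
    Real.sq_sqrt (by positivity)]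
  congr 1
  push_cast
  have : (t : ℂ) ≠ 0 := by exact_mod_cast ht.ne'
  field_simp
  rw [Complex.I_sq]
  ring

/-- Expectations of functions of `m + √(2t) Z`. -/
lemma lintegral_stdGaussian_affine {t : ℝ} (ht : 0 < t) (m : Vec n) {f : Vec n → ℝ≥0∞}
    (hf : Measurable f) :
    ∫⁻ z, f (m + √(2 * t) • z) ∂(stdGaussian (Vec n))
      = ∫⁻ y, ENNReal.ofReal (heatKernel t (y - m)) * f y := by
  have hm : Measurable fun w : Vec n => ENNReal.ofReal (heatKernel t w) :=
    continuous_heatKernel.measurable.ennreal_ofReal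
  have h1 : ∫⁻ z, f (m + √(2 * t) • z) ∂(stdGaussian (Vec n))
      = ∫⁻ w, f (m + w) ∂((stdGaussian (Vec n)).map (fun z => √(2 * t) • z)) := by
    rw [lintegral_map (by fun_prop) (by fun_prop)]
  rw [h1, map_smul_stdGaussian ht, lintegral_withDensity_eq_lintegral_mul _ hm (by fun_prop),
    ← lintegral_sub_right_eq_self _ m]
  simp [Pi.mul_apply]

lemma integrable_norm_sq_stdGaussian :
    Integrable (fun z : Vec n => ‖z‖ ^ 2) (stdGaussian (Vec n)) :=
  (IsGaussian.memLp_id (stdGaussian (Vec n)) 2 (by simp)).integrable_norm_pow (by simp)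

lemma integrable_norm_stdGaussian :
    Integrable (fun z : Vec n => ‖z‖) (stdGaussian (Vec n)) :=
  (IsGaussian.integrable_id (μ := stdGaussian (Vec n))).norm

lemma integral_norm_sq_stdGaussian :
    ∫ z : Vec n, ‖z‖ ^ 2 ∂(stdGaussian (Vec n)) = n := by
  have hi : ∀ i : Fin n, MemLp (fun z : Vec n => z i) 2 (stdGaussian (Vec n)) := fun i =>
    (EuclideanSpace.proj (𝕜 := ℝ) i).comp_memLp' (IsGaussian.memLp_id (stdGaussian (Vec n)) 2 (by simp))
  simp_rw [EuclideanSpace.norm_sq_eq, Real.norm_eq_abs, sq_abs]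
  rw [integral_finsetSum _ fun i _ => (hi i).integrable_sq]
  have h : ∀ i : Fin n, ∫ z : Vec n, z i ^ 2 ∂(stdGaussian (Vec n)) = 1 := by
    intro i
    have h1 := variance_dual_stdGaussian (E := Vec n) (innerSL ℝ (EuclideanSpace.single i 1))
    have h2 := integral_strongDual_stdGaussian (E := Vec n) (innerSL ℝ (EuclideanSpace.single i 1))
    have e : ∀ z : Vec n, innerSL ℝ (EuclideanSpace.single i (1 : ℝ)) z = z i := by
      intro z; rw [innerSL_apply_apply, EuclideanSpace.inner_single_left]; simp
    rw [variance_of_integral_eq_zero (Continuous.aemeasurable (by fun_prop)) h2] at h1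
    simpa [e] using h1
  simp [h]

end

section

variable {n : ℕ}

/-! ### Gaussian mixtures -/

/-- This is `u * exp (-u) ≤ 1` at `u = ‖w‖² / (4t)`. Bounds uniform in `w` allow differentiation
under the mixture integral without any moment of `μ`. -/
lemma heatKernel_mul_norm_sq_le {t : ℝ} (ht : 0 < t) (w : Vec n) :
    heatKernel t w * ‖w‖ ^ 2 ≤ ((4 * Real.pi * t) ^ ((n : ℝ) / 2))⁻¹ * (4 * t) := by
  unfold heatKernel
  rw [mul_assoc]
  refine mul_le_mul_of_nonneg_left ?_ (by positivity)
  have h1 : ‖w‖ ^ 2 / (4 * t) + 1 ≤ Real.exp (‖w‖ ^ 2 / (4 * t)) := Real.add_one_le_exp _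
  rw [neg_div, Real.exp_neg, inv_mul_le_iff₀ (Real.exp_pos _)]
  have h2 : ‖w‖ ^ 2 = ‖w‖ ^ 2 / (4 * t) * (4 * t) := by field_simp
  nlinarith [Real.exp_pos (‖w‖ ^ 2 / (4 * t))]

lemma norm_gradient_heatKernel_le {t : ℝ} (ht : 0 < t) (w : Vec n) :
    ‖-(heatKernel t w / (2 * t)) • w‖
      ≤ ((4 * Real.pi * t) ^ ((n : ℝ) / 2))⁻¹ * (1 + 4 * t) / (2 * t) := by
  have h0 := heatKernel_pos ht w
  rw [norm_smul, norm_neg, Real.norm_of_nonneg (by positivity), div_mul_eq_mul_div]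
  refine div_le_div_of_nonneg_right ?_ (by positivity)
  have h1 := heatKernel_le ht w
  have h2 := heatKernel_mul_norm_sq_le ht w
  -- The bound `‖w‖ ≤ 1 + ‖w‖²` reduces the claim to the two bounds above.
  nlinarith [sq_nonneg (‖w‖ - 1), mul_nonneg h0.le (sq_nonneg (‖w‖ - 1)),
    mul_nonneg h0.le (norm_nonneg w)]

/-- The density of the law of `x - t b(x) + √(2t) Z`, for `x` with law `μ`. -/
def mixDens (b : Vec n → Vec n) (μ : Measure (Vec n)) (t : ℝ) (y : Vec n) : ℝ :=
  ∫ x, heatKernel t (y - (x - t • b x)) ∂μ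

/-- The gradient of `mixDens`. -/
def mixGrad (b : Vec n → Vec n) (μ : Measure (Vec n)) (t : ℝ) (y : Vec n) : Vec n :=
  ∫ x, -(heatKernel t (y - (x - t • b x)) / (2 * t)) • (y - (x - t • b x)) ∂μ

/-- The score of `mixDens`. -/
def mixScore (b : Vec n → Vec n) (μ : Measure (Vec n)) (t : ℝ) (y : Vec n) : Vec n :=
  (mixDens b μ t y)⁻¹ • mixGrad b μ t y

/-- One step of the noisy iteration, `(x, z) ↦ x - t b(x) + √(2t) z`. -/
def step (b : Vec n → Vec n) (t : ℝ) (q : Vec n × Vec n) : Vec n :=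
  q.1 - t • b q.1 + √(2 * t) • q.2

/-- The law of a step from a random point of law `μ`. -/
def stepLaw (b : Vec n → Vec n) (μ : Measure (Vec n)) (t : ℝ) : Measure (Vec n) :=
  (μ.prod (stdGaussian (Vec n))).map (step b t)

variable {b : Vec n → Vec n} {μ : Measure (Vec n)} [IsProbabilityMeasure μ]

lemma continuous_step (hb : Continuous b) (t : ℝ) : Continuous (step b t) := by
  unfold step; fun_prop

lemma isProbabilityMeasure_stepLaw (hb : Continuous b) (t : ℝ) :
    IsProbabilityMeasure (stepLaw b μ t) :=
  Measure.isProbabilityMeasure_map (continuous_step hb t).measurable.aemeasurable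

lemma continuous_kernel (hb : Continuous b) (t : ℝ) :
    Continuous fun p : Vec n × Vec n => heatKernel t (p.2 - (p.1 - t • b p.1)) :=
  continuous_heatKernel.comp (by fun_prop)

lemma integrable_kernel (hb : Continuous b) {t : ℝ} (ht : 0 < t) (y : Vec n) :
    Integrable (fun x => heatKernel t (y - (x - t • b x))) μ := by
  refine Integrable.of_bound (C := ((4 * Real.pi * t) ^ ((n : ℝ) / 2))⁻¹)
    (continuous_heatKernel.comp (by fun_prop)).aestronglyMeasurable (ae_of_all _ fun x => ?_)
  rw [Real.norm_of_nonneg (heatKernel_pos ht _).le]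
  exact heatKernel_le ht _

lemma integrable_kernel_grad (hb : Continuous b) {t : ℝ} (ht : 0 < t) (y : Vec n) :
    Integrable (fun x => -(heatKernel t (y - (x - t • b x)) / (2 * t)) • (y - (x - t • b x))) μ := by
  refine Integrable.of_bound (C := ((4 * Real.pi * t) ^ ((n : ℝ) / 2))⁻¹ * (1 + 4 * t) / (2 * t))
    (Continuous.aestronglyMeasurable ?_) (ae_of_all _ fun x => norm_gradient_heatKernel_le ht _)
  have : Continuous fun x => heatKernel t (y - (x - t • b x)) :=
    continuous_heatKernel.comp (by fun_prop)
  fun_prop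

lemma integrable_kernel_sq (hb : Continuous b) {t : ℝ} (ht : 0 < t) (y : Vec n) :
    Integrable (fun x => heatKernel t (y - (x - t • b x)) * ‖y - (x - t • b x)‖ ^ 2) μ := by
  refine Integrable.of_bound (C := ((4 * Real.pi * t) ^ ((n : ℝ) / 2))⁻¹ * (4 * t))
    (Continuous.aestronglyMeasurable ?_) (ae_of_all _ fun x => ?_)
  · have : Continuous fun x => heatKernel t (y - (x - t • b x)) :=
      continuous_heatKernel.comp (by fun_prop)
    fun_prop
  · rw [Real.norm_of_nonneg (mul_nonneg (heatKernel_pos ht _).le (by positivity))]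
    exact heatKernel_mul_norm_sq_le ht _

lemma mixDens_pos (hb : Continuous b) {t : ℝ} (ht : 0 < t) (y : Vec n) : 0 < mixDens b μ t y := by
  refine (integral_pos_iff_support_of_nonneg (fun x => (heatKernel_pos ht _).le)
    (integrable_kernel hb ht y)).2 ?_
  have : Function.support (fun x => heatKernel t (y - (x - t • b x))) = univ :=
    eq_univ_of_forall fun x => (heatKernel_pos ht _).ne'
  rw [this]
  simp

lemma hasGradientAt_mixDens (hb : Continuous b) {t : ℝ} (ht : 0 < t) (y : Vec n) :
    HasGradientAt (mixDens b μ t) (mixGrad b μ t y) y := by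
  rw [hasGradientAt_iff_hasFDerivAt]
  have h := hasFDerivAt_integral_of_dominated_of_fderiv_le (μ := μ) (s := univ) (x₀ := y)
    (F := fun y x => heatKernel t (y - (x - t • b x)))
    (F' := fun y x => InnerProductSpace.toDual ℝ (Vec n)
      (-(heatKernel t (y - (x - t • b x)) / (2 * t)) • (y - (x - t • b x))))
    (bound := fun _ => ((4 * Real.pi * t) ^ ((n : ℝ) / 2))⁻¹ * (1 + 4 * t) / (2 * t))
    univ_mem (Eventually.of_forall fun y => (integrable_kernel hb ht y).1) (integrable_kernel hb ht y)
    ((InnerProductSpace.toDual ℝ (Vec n)).continuous.comp_aestronglyMeasurable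
      (integrable_kernel_grad hb ht y).1)
    (ae_of_all _ fun x y _ => by
      rw [LinearIsometryEquiv.norm_map]; exact norm_gradient_heatKernel_le ht _)
    (integrable_const _)
    (ae_of_all _ fun x y _ => by
      have := (hasGradientAt_heatKernel t (y - (x - t • b x))).hasFDerivAt
      exact (hasFDerivAt_comp_sub _).2 this)
  have hi : Integrable (fun x => InnerProductSpace.toDual ℝ (Vec n)
      (-(heatKernel t (y - (x - t • b x)) / (2 * t)) • (y - (x - t • b x)))) μ :=
    ((integrable_kernel_grad hb ht y).norm).mono'
      ((InnerProductSpace.toDual ℝ (Vec n)).continuous.comp_aestronglyMeasurable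
        (integrable_kernel_grad hb ht y).1)
      (ae_of_all _ fun x => (LinearIsometryEquiv.norm_map _ _).le)
  refine h.congr_fderiv ?_
  ext v
  rw [ContinuousLinearMap.integral_apply hi]
  simp only [InnerProductSpace.toDual_apply_apply]
  simp_rw [real_inner_comm v]
  exact integral_inner (integrable_kernel_grad hb ht y) v

lemma inv_rpow_le {a t : ℝ} (ha : 0 < a) (h : a ≤ t) :
    ((4 * Real.pi * t) ^ ((n : ℝ) / 2))⁻¹ ≤ ((4 * Real.pi * a) ^ ((n : ℝ) / 2))⁻¹ := by
  have := ha.trans_le h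
  gcongr

/-- The dominating constants below blow up as `t → 0`, so joint continuity is proved on strips
bounded away from time zero. -/
lemma continuousOn_of_Icc {X : Type*} [TopologicalSpace X] {f : ℝ × Vec n → X}
    (h : ∀ a c : ℝ, 0 < a → ContinuousOn f (Icc a c ×ˢ univ)) : ContinuousOn f (Ioi 0 ×ˢ univ) := by
  rintro q ⟨hq : 0 < q.1, -⟩
  refine ((h (q.1 / 2) (q.1 + 1) (by positivity)).continuousAt ?_).continuousWithinAt
  exact prod_mem_nhds (Icc_mem_nhds (by linarith) (by linarith)) univ_mem

lemma continuousOn_mixDens (hb : Continuous b) :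
    ContinuousOn (fun q : ℝ × Vec n => mixDens b μ q.1 q.2) (Ioi 0 ×ˢ univ) := by
  refine continuousOn_of_Icc fun a c ha => ?_
  refine continuousOn_of_dominated (bound := fun _ => ((4 * Real.pi * a) ^ ((n : ℝ) / 2))⁻¹)
    (fun q hq => (integrable_kernel hb (ha.trans_le hq.1.1) q.2).1)
    (fun q hq => ae_of_all _ fun x => ?_) (integrable_const _) (ae_of_all _ fun x => ?_)
  · have ht := ha.trans_le hq.1.1
    rw [Real.norm_of_nonneg (heatKernel_pos ht _).le]
    exact (heatKernel_le ht _).trans (inv_rpow_le ha hq.1.1)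
  · exact continuousOn_heatKernel.comp (f := fun q : ℝ × Vec n => (q.1, q.2 - (x - q.1 • b x)))
      (by fun_prop) fun q hq => ⟨ha.trans_le hq.1.1, mem_univ _⟩

lemma continuousOn_mixGrad (hb : Continuous b) :
    ContinuousOn (fun q : ℝ × Vec n => mixGrad b μ q.1 q.2) (Ioi 0 ×ˢ univ) := by
  refine continuousOn_of_Icc fun a c ha => ?_
  refine continuousOn_of_dominated
    (bound := fun _ => ((4 * Real.pi * a) ^ ((n : ℝ) / 2))⁻¹ * (1 + 4 * c) / (2 * a))
    (fun q hq => (integrable_kernel_grad hb (ha.trans_le hq.1.1) q.2).1)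
    (fun q hq => ae_of_all _ fun x => ?_) (integrable_const _) (ae_of_all _ fun x => ?_)
  · have ht := ha.trans_le hq.1.1
    refine (norm_gradient_heatKernel_le ht _).trans ?_
    have h1 := inv_rpow_le (n := n) ha hq.1.1
    have h2 := hq.1.1
    have h3 := hq.1.2
    have h4 : 0 < c := ha.trans_le (h2.trans h3)
    gcongr
  · have h := continuousOn_heatKernel.comp (f := fun q : ℝ × Vec n => (q.1, q.2 - (x - q.1 • b x)))
      (s := Icc a c ×ˢ univ) (by fun_prop) fun q hq => ⟨ha.trans_le hq.1.1, mem_univ _⟩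
    refine ContinuousOn.smul (ContinuousOn.neg (ContinuousOn.div h (by fun_prop) fun q hq => ?_))
      (by fun_prop)
    have := ha.trans_le hq.1.1
    positivity

lemma continuousOn_mixScore (hb : Continuous b) :
    ContinuousOn (fun q : ℝ × Vec n => mixScore b μ q.1 q.2) (Ioi 0 ×ˢ univ) :=
  ((continuousOn_mixDens hb).inv₀ fun q hq => (mixDens_pos hb hq.1 q.2).ne').smul
    (continuousOn_mixGrad hb)

lemma continuous_slice {X : Type*} [TopologicalSpace X] {f : ℝ → Vec n → X}
    (h : ContinuousOn (fun q : ℝ × Vec n => f q.1 q.2) (Ioi 0 ×ˢ univ)) {t : ℝ} (ht : 0 < t) :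
    Continuous (f t) :=
  h.comp_continuous (f := fun y => (t, y)) (by fun_prop) fun _ => ⟨ht, mem_univ _⟩

omit [IsProbabilityMeasure μ] in
/-- The joint law of the starting point and the end point of a step. -/
lemma map_start_step (hb : Continuous b) {t : ℝ} (ht : 0 < t) :
    (μ.prod (stdGaussian (Vec n))).map (fun q => (q.1, step b t q))
      = (μ.prod volume).withDensity
          (fun p => ENNReal.ofReal (heatKernel t (p.2 - (p.1 - t • b p.1)))) := by
  have hk : Measurable fun p : Vec n × Vec n =>
      ENNReal.ofReal (heatKernel t (p.2 - (p.1 - t • b p.1))) :=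
    (continuous_kernel hb t).measurable.ennreal_ofReal
  have hs := (continuous_step hb t).measurable
  refine Measure.ext_of_lintegral _ fun f hf => ?_
  rw [lintegral_map hf (by fun_prop), lintegral_withDensity_eq_lintegral_mul _ hk hf,
    lintegral_prod _ (by fun_prop), lintegral_prod _ (by fun_prop)]
  refine lintegral_congr fun x => ?_
  exact lintegral_stdGaussian_affine ht (x - t • b x) (f := fun y => f (x, y)) (by fun_prop)

lemma lintegral_start_step (hb : Continuous b) {t : ℝ} (ht : 0 < t) {f : Vec n × Vec n → ℝ≥0∞}
    (hf : Measurable f) :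
    ∫⁻ q, f (q.1, step b t q) ∂(μ.prod (stdGaussian (Vec n)))
      = ∫⁻ y, ∫⁻ x, ENNReal.ofReal (heatKernel t (y - (x - t • b x))) * f (x, y) ∂μ := by
  have hk : Measurable fun p : Vec n × Vec n =>
      ENNReal.ofReal (heatKernel t (p.2 - (p.1 - t • b p.1))) :=
    (continuous_kernel hb t).measurable.ennreal_ofReal
  have hs := (continuous_step hb t).measurable
  rw [← lintegral_map (f := f) (g := fun q => (q.1, step b t q)) hf (by fun_prop),
    map_start_step hb ht, lintegral_withDensity_eq_lintegral_mul _ hk hf,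
    lintegral_prod_symm _ (by fun_prop)]
  rfl

lemma ofReal_mixDens (hb : Continuous b) {t : ℝ} (ht : 0 < t) (y : Vec n) :
    ENNReal.ofReal (mixDens b μ t y)
      = ∫⁻ x, ENNReal.ofReal (heatKernel t (y - (x - t • b x))) ∂μ :=
  ofReal_integral_eq_lintegral_ofReal (integrable_kernel hb ht y)
    (ae_of_all _ fun _ => (heatKernel_pos ht _).le)

lemma lintegral_step (hb : Continuous b) {t : ℝ} (ht : 0 < t) {f : Vec n → ℝ≥0∞}
    (hf : Measurable f) :
    ∫⁻ q, f (step b t q) ∂(μ.prod (stdGaussian (Vec n)))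
      = ∫⁻ y, ENNReal.ofReal (mixDens b μ t y) * f y := by
  rw [lintegral_start_step hb ht (f := fun p => f p.2) (by fun_prop)]
  refine lintegral_congr fun y => ?_
  have hk : Measurable fun x : Vec n => ENNReal.ofReal (heatKernel t (y - (x - t • b x))) :=
    ((continuous_kernel hb t).comp (Continuous.prodMk continuous_id
      continuous_const)).measurable.ennreal_ofReal
  rw [ofReal_mixDens hb ht, ← lintegral_mul_const _ hk]

lemma stepLaw_eq_withDensity (hb : Continuous b) {t : ℝ} (ht : 0 < t) :
    stepLaw b μ t = volume.withDensity (fun y => ENNReal.ofReal (mixDens b μ t y)) := by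
  refine Measure.ext_of_lintegral _ fun f hf => ?_
  rw [stepLaw, lintegral_map hf (continuous_step hb t).measurable, lintegral_step hb ht hf,
    lintegral_withDensity_eq_lintegral_mul _
      (continuous_slice (continuousOn_mixDens hb) ht).measurable.ennreal_ofReal hf]
  rfl

lemma integral_step (hb : Continuous b) {t : ℝ} (ht : 0 < t) {f : Vec n → ℝ} (hf : Continuous f) :
    ∫ q, f (step b t q) ∂(μ.prod (stdGaussian (Vec n))) = ∫ y, mixDens b μ t y * f y := by
  rw [← integral_map (f := f) (φ := step b t) (continuous_step hb t).measurable.aemeasurable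
    hf.aestronglyMeasurable]
  change ∫ y, f y ∂(stepLaw b μ t) = _
  rw [stepLaw_eq_withDensity hb ht, integral_withDensity_eq_integral_toReal_smul
    (continuous_slice (continuousOn_mixDens hb) ht).measurable.ennreal_ofReal (by simp)]
  simp_rw [ENNReal.toReal_ofReal (mixDens_pos hb ht _).le, smul_eq_mul]

/-- The score of the mixture at the end point is, up to a factor, the conditional expectation of
the noise given the end point. -/
lemma integral_inner_noise (hb : Continuous b) {t : ℝ} (ht : 0 < t) {a : Vec n → Vec n}
    (ha : Continuous a)
    (hi : Integrable (fun q => ⟪a (step b t q), q.2⟫) (μ.prod (stdGaussian (Vec n)))) :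
    ∫ q, ⟪a (step b t q), q.2⟫ ∂(μ.prod (stdGaussian (Vec n)))
      = -√(2 * t) * ∫ q, ⟪a (step b t q), mixScore b μ t (step b t q)⟫
          ∂(μ.prod (stdGaussian (Vec n))) := by
  have hs := (continuous_step hb t).measurable
  have hk : Measurable fun p : Vec n × Vec n =>
      ENNReal.ofReal (heatKernel t (p.2 - (p.1 - t • b p.1))) :=
    (continuous_kernel hb t).measurable.ennreal_ofReal
  have hsq : 0 < √(2 * t) := by positivity
  -- The noise is a function of the start `x` and the end `y`: it is `(2t)^(-1/2) (y - (x - t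
  -- b(x)))`. The expectation can then be taken under the joint law of start and end, whose density
  -- is the heat kernel, and integrated over `x` first.
  set G : Vec n × Vec n → ℝ := fun p => (√(2 * t))⁻¹ * ⟪a p.2, p.2 - (p.1 - t • b p.1)⟫ with hG
  have hGc : Continuous G := by fun_prop
  have e1 : ∀ q : Vec n × Vec n, ⟪a (step b t q), q.2⟫ = G (q.1, step b t q) := by
    intro q
    simp only [hG, step, add_sub_cancel_left, inner_smul_right]
    field_simp
  have hi' : Integrable G ((μ.prod volume).withDensity
      (fun p => ENNReal.ofReal (heatKernel t (p.2 - (p.1 - t • b p.1))))) := by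
    rw [← map_start_step hb ht, integrable_map_measure hGc.aestronglyMeasurable
      (Measurable.aemeasurable (by fun_prop))]
    simpa [e1, Function.comp_def] using hi
  have hi2 := (integrable_withDensity_iff_integrable_smul' hk (by simp)).1 hi'
  simp_rw [e1]
  rw [← integral_map (f := G) (φ := fun q => (q.1, step b t q))
    (Measurable.aemeasurable (by fun_prop)) hGc.aestronglyMeasurable, map_start_step hb ht,
    integral_withDensity_eq_integral_toReal_smul hk (by simp), integral_prod_symm _ hi2,
    integral_step hb ht (f := fun y => ⟪a y, mixScore b μ t y⟫)
      (ha.inner (continuous_slice (continuousOn_mixScore hb) ht)), ← integral_const_mul]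
  refine integral_congr_ae (ae_of_all _ fun y => ?_)
  have hd := (mixDens_pos (μ := μ) hb ht y).ne'
  simp only [mixScore, inner_smul_right, smul_eq_mul]
  rw [mul_inv_cancel_left₀ hd, mixGrad,
    ← integral_inner (integrable_kernel_grad hb ht y), ← integral_const_mul]
  refine integral_congr_ae (ae_of_all _ fun x => ?_)
  simp only [hG, inner_smul_right]
  rw [ENNReal.toReal_ofReal (heatKernel_pos ht _).le]
  have : √(2 * t) * √(2 * t) = 2 * t := Real.mul_self_sqrt (by positivity)
  field_simp
  rw [show √(2 * t) ^ 2 = 2 * t from Real.sq_sqrt (by positivity)]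
  ring

/-- Jensen's inequality: the score at `y` is the average of `-(2t)⁻¹ (y - (x - t b(x)))` over the
conditional law of the start given the end `y`. -/
lemma mixDens_mul_norm_mixScore_sq_le (hb : Continuous b) {t : ℝ} (ht : 0 < t) (y : Vec n) :
    mixDens b μ t y * ‖mixScore b μ t y‖ ^ 2
      ≤ ∫ x, heatKernel t (y - (x - t • b x)) * ‖(2 * t)⁻¹ • (y - (x - t • b x))‖ ^ 2 ∂μ := by
  set s := mixScore b μ t y with hs
  have hd := mixDens_pos (μ := μ) hb ht y
  have h1 : ⟪s, mixGrad b μ t y⟫ = mixDens b μ t y * ‖s‖ ^ 2 := by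
    have : mixGrad b μ t y = mixDens b μ t y • s := by
      rw [hs, mixScore, smul_smul, mul_inv_cancel₀ hd.ne', one_smul]
    rw [this, inner_smul_right, real_inner_self_eq_norm_sq]
  have i1 := integrable_kernel (μ := μ) hb ht y
  have i2 := integrable_kernel_grad (μ := μ) hb ht y
  have i3 : Integrable (fun x => heatKernel t (y - (x - t • b x)) *
      ‖(2 * t)⁻¹ • (y - (x - t • b x))‖ ^ 2) μ := by
    refine ((integrable_kernel_sq (μ := μ) hb ht y).const_mul (((2 * t)⁻¹) ^ 2)).congr
      (ae_of_all _ fun x => ?_)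
    simp only [norm_smul, mul_pow, Real.norm_eq_abs, sq_abs]
    ring
  -- The conditional variance, up to the factor `mixDens`; expanding the square gives the claim.
  have h2 : 0 ≤ ∫ x, heatKernel t (y - (x - t • b x)) *
      ‖(2 * t)⁻¹ • (y - (x - t • b x)) + s‖ ^ 2 ∂μ :=
    integral_nonneg fun x => mul_nonneg (heatKernel_pos ht _).le (by positivity)
  have h3 : ∀ x, heatKernel t (y - (x - t • b x)) * ‖(2 * t)⁻¹ • (y - (x - t • b x)) + s‖ ^ 2
      = heatKernel t (y - (x - t • b x)) * ‖(2 * t)⁻¹ • (y - (x - t • b x))‖ ^ 2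
        - 2 * ⟪s, -(heatKernel t (y - (x - t • b x)) / (2 * t)) • (y - (x - t • b x))⟫
        + heatKernel t (y - (x - t • b x)) * ‖s‖ ^ 2 := by
    intro x
    rw [norm_add_sq_real, inner_smul_right, inner_smul_left, real_inner_comm]
    simp
    field_simp
  simp_rw [h3] at h2
  have i4 := (i2.const_inner (𝕜 := ℝ) s).const_mul (2 : ℝ)
  have i5 := i1.mul_const (‖s‖ ^ 2)
  rw [integral_add (by exact i3.sub i4) i5, integral_sub i3 i4, integral_const_mul,
    integral_inner i2, integral_mul_const] at h2
  change 0 ≤ _ - 2 * ⟪s, mixGrad b μ t y⟫ + mixDens b μ t y * ‖s‖ ^ 2 at h2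
  linarith

/-- The conditional bound averages to `E‖Z‖² / (2t)`. The score is thus square integrable at
positive times whatever the starting law is. -/
lemma lintegral_norm_mixScore_sq_le (hb : Continuous b) {t : ℝ} (ht : 0 < t) :
    ∫⁻ q, ENNReal.ofReal (‖mixScore b μ t (step b t q)‖ ^ 2) ∂(μ.prod (stdGaussian (Vec n)))
      ≤ ENNReal.ofReal (n / (2 * t)) := by
  have hc : Continuous (mixScore b μ t) := continuous_slice (continuousOn_mixScore hb) ht
  rw [lintegral_step hb ht (f := fun y => ENNReal.ofReal (‖mixScore b μ t y‖ ^ 2)) (by fun_prop)]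
  have h1 : ∀ y, ENNReal.ofReal (mixDens b μ t y) * ENNReal.ofReal (‖mixScore b μ t y‖ ^ 2)
      ≤ ∫⁻ x, ENNReal.ofReal (heatKernel t (y - (x - t • b x))) *
        ENNReal.ofReal (‖(2 * t)⁻¹ • (y - (x - t • b x))‖ ^ 2) ∂μ := by
    intro y
    have i3 : Integrable (fun x => heatKernel t (y - (x - t • b x)) *
        ‖(2 * t)⁻¹ • (y - (x - t • b x))‖ ^ 2) μ := by
      refine ((integrable_kernel_sq (μ := μ) hb ht y).const_mul (((2 * t)⁻¹) ^ 2)).congr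
        (ae_of_all _ fun x => ?_)
      simp only [norm_smul, mul_pow, Real.norm_eq_abs, sq_abs]
      ring
    rw [← ENNReal.ofReal_mul (mixDens_pos hb ht y).le]
    refine (ENNReal.ofReal_le_ofReal (mixDens_mul_norm_mixScore_sq_le hb ht y)).trans ?_
    rw [ofReal_integral_eq_lintegral_ofReal i3
      (ae_of_all _ fun x => mul_nonneg (heatKernel_pos ht _).le (by positivity))]
    refine lintegral_mono fun x => ?_
    rw [ENNReal.ofReal_mul (heatKernel_pos ht _).le]
  refine (lintegral_mono h1).trans ?_
  rw [← lintegral_start_step hb ht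
    (f := fun p => ENNReal.ofReal (‖(2 * t)⁻¹ • (p.2 - (p.1 - t • b p.1))‖ ^ 2)) (by fun_prop)]
  have h2 : ∀ q : Vec n × Vec n, ‖(2 * t)⁻¹ • (step b t q - (q.1 - t • b q.1))‖ ^ 2
      = (2 * t)⁻¹ * ‖q.2‖ ^ 2 := by
    intro q
    rw [step, add_sub_cancel_left, smul_smul, norm_smul, mul_pow, Real.norm_eq_abs, sq_abs, mul_pow,
      Real.sq_sqrt (by positivity)]
    field_simp
  simp_rw [h2]
  rw [lintegral_prod _ (by fun_prop)]
  simp only []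
  rw [lintegral_const, measure_univ, mul_one,
    ← ofReal_integral_eq_lintegral_ofReal (integrable_norm_sq_stdGaussian.const_mul _)
      (ae_of_all _ fun z => by positivity), integral_const_mul, integral_norm_sq_stdGaussian]
  apply le_of_eq; congr 1; field_simp

end

section

/-! ### Truncated entropies -/

/-- A bounded increasing function which tends to `log` as `δ → 0`. -/
def truncLog (δ h : ℝ) : ℝ := Real.log (h + δ) - Real.log (1 + δ * h)

/-- The convex function with `truncEnt δ 1 = 0` and derivative `truncLog δ`. -/
def truncEnt (δ h : ℝ) : ℝ :=
  ((h + δ) * Real.log (h + δ) - (h + δ))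
    - ((1 + δ * h) * Real.log (1 + δ * h) - (1 + δ * h)) / δ
    - (((1 + δ) * Real.log (1 + δ) - (1 + δ)) - ((1 + δ) * Real.log (1 + δ) - (1 + δ)) / δ)

/-- The function `h ↦ h * (truncLog δ)' h`. -/
def truncWeight (δ h : ℝ) : ℝ := h * ((1 - δ ^ 2) / ((h + δ) * (1 + δ * h)))

section

variable {δ : ℝ} (hδ : 0 < δ) (hδ1 : δ < 1)
include hδ

lemma hasDerivAt_truncLog {h : ℝ} (hh : 0 ≤ h) :
    HasDerivAt (truncLog δ) ((1 - δ ^ 2) / ((h + δ) * (1 + δ * h))) h := by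
  have h1 : 0 < h + δ := by positivity
  have h2 : 0 < 1 + δ * h := by positivity
  have d1 := ((hasDerivAt_id h).add_const δ).log h1.ne'
  have d2 := (((hasDerivAt_id h).const_mul δ).const_add 1).log h2.ne'
  refine (d1.sub d2).congr_deriv ?_
  simp only [id]
  field_simp
  ring

lemma hasDerivAt_truncEnt {h : ℝ} (hh : 0 ≤ h) :
    HasDerivAt (truncEnt δ) (truncLog δ h) h := by
  have h1 : 0 < h + δ := by positivity
  have h2 : 0 < 1 + δ * h := by positivity
  have d1 := (hasDerivAt_id h).add_const δ
  have d2 := ((hasDerivAt_id h).const_mul δ).const_add 1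
  have e1 := (d1.mul (d1.log h1.ne')).sub d1
  have e2 := ((d2.mul (d2.log h2.ne')).sub d2).div_const δ
  refine ((e1.sub e2).sub_const
    (((1 + δ) * Real.log (1 + δ) - (1 + δ)) - ((1 + δ) * Real.log (1 + δ) - (1 + δ)) / δ)).congr_deriv
    ?_
  simp only [id, truncLog]
  field_simp
  ring

omit hδ in
lemma truncEnt_one : truncEnt δ 1 = 0 := by
  simp [truncEnt]

omit hδ in
lemma truncLog_one : truncLog δ 1 = 0 := by
  simp [truncLog, add_comm]

include hδ1

lemma truncLog_mono {a c : ℝ} (ha : 0 ≤ a) (hac : a ≤ c) : truncLog δ a ≤ truncLog δ c := by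
  have hc := ha.trans hac
  unfold truncLog
  rw [← Real.log_div (by positivity) (by positivity), ← Real.log_div (by positivity) (by positivity)]
  refine Real.log_le_log (by positivity) ?_
  rw [div_le_div_iff₀ (by positivity) (by positivity)]
  nlinarith [mul_nonneg (sub_nonneg.2 hac) (mul_nonneg (sub_nonneg.2 hδ1.le) (by linarith : 0 ≤ 1 + δ))]

/-- The quotient `(h + δ) / (1 + δ h)` increases from `δ` to `1 / δ` on `[0, ∞)`. -/
lemma abs_truncLog_le {h : ℝ} (hh : 0 ≤ h) : |truncLog δ h| ≤ -Real.log δ := by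
  have h1 : 0 < h + δ := by positivity
  have h2 : 0 < 1 + δ * h := by positivity
  have h3 : Real.log δ + Real.log (1 + δ * h) ≤ Real.log (h + δ) := by
    rw [← Real.log_mul hδ.ne' h2.ne']
    exact Real.log_le_log (by positivity) (by nlinarith [mul_nonneg hh (sub_nonneg.2 hδ1.le)])
  have h4 : Real.log δ + Real.log (h + δ) ≤ Real.log (1 + δ * h) := by
    rw [← Real.log_mul hδ.ne' h1.ne']
    exact Real.log_le_log (by positivity) (by nlinarith)
  unfold truncLog
  rw [abs_le]; constructor <;> linarith

lemma truncWeight_nonneg {h : ℝ} (hh : 0 ≤ h) : 0 ≤ truncWeight δ h := by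
  have : 0 ≤ 1 - δ ^ 2 := by nlinarith
  unfold truncWeight; positivity

omit hδ1 in
lemma truncWeight_le_one {h : ℝ} (hh : 0 ≤ h) : truncWeight δ h ≤ 1 := by
  unfold truncWeight
  rw [← mul_div_assoc, div_le_one (by positivity)]
  nlinarith [mul_nonneg hh (sq_nonneg δ), mul_nonneg hδ.le (sq_nonneg h)]

lemma convexOn_truncEnt : ConvexOn ℝ (Ici 0) (truncEnt δ) := by
  refine MonotoneOn.convexOn_of_deriv (convex_Ici 0)
    (fun h hh => (hasDerivAt_truncEnt hδ hh).continuousAt.continuousWithinAt) ?_ ?_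
  · intro h hh
    rw [interior_Ici] at hh
    exact (hasDerivAt_truncEnt hδ (le_of_lt hh)).differentiableAt.differentiableWithinAt
  · intro a ha c hc hac
    rw [interior_Ici] at ha hc
    rw [(hasDerivAt_truncEnt hδ (le_of_lt ha)).deriv, (hasDerivAt_truncEnt hδ (le_of_lt hc)).deriv]
    exact truncLog_mono hδ hδ1 (le_of_lt ha) hac

/-- The tangent line at `a` lies below the convex function. This inequality drives the convexity
squeeze in time, the nonnegativity and the Lipschitz bound. -/
lemma truncEnt_sub_le {a c : ℝ} (ha : 0 ≤ a) (hc : 0 ≤ c) :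
    truncEnt δ a - truncEnt δ c ≤ truncLog δ a * (a - c) := by
  have hconv := convexOn_truncEnt hδ hδ1
  have hd := hasDerivAt_truncEnt hδ ha
  rcases lt_trichotomy a c with h | h | h
  · have := hconv.le_slope_of_hasDerivAt ha hc h hd
    rw [slope_def_field, le_div_iff₀ (by linarith)] at this
    linarith
  · simp [h]
  · have := hconv.slope_le_of_hasDerivAt hc ha h hd
    rw [slope_def_field, div_le_iff₀ (by linarith)] at this
    linarith

lemma truncEnt_nonneg {h : ℝ} (hh : 0 ≤ h) : 0 ≤ truncEnt δ h := by
  have := truncEnt_sub_le hδ hδ1 zero_le_one hh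
  rw [truncEnt_one, truncLog_one] at this
  linarith

lemma abs_truncEnt_sub_le {a c : ℝ} (ha : 0 ≤ a) (hc : 0 ≤ c) :
    |truncEnt δ a - truncEnt δ c| ≤ -Real.log δ * |a - c| := by
  have h1 := truncEnt_sub_le hδ hδ1 ha hc
  have h2 := truncEnt_sub_le hδ hδ1 hc ha
  have h3 := abs_truncLog_le hδ hδ1 ha
  have h4 := abs_truncLog_le hδ hδ1 hc
  have h5 : |truncLog δ a * (a - c)| ≤ -Real.log δ * |a - c| := by rw [abs_mul]; gcongr
  have h6 : |truncLog δ c * (c - a)| ≤ -Real.log δ * |a - c| := by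
    rw [abs_mul, abs_sub_comm c a]; gcongr
  rw [abs_le] at *
  constructor <;> linarith [h5.1, h5.2, h6.1, h6.2]

/-- The difference vanishes at `1`, and its derivative `log h - truncLog δ h` has the sign of `h -
1`, because `(h + δ) / (1 + δ h)` is at most `h` for `h ≥ 1` and at least `h` for `h ≤ 1`. -/
lemma truncEnt_le_klFun {h : ℝ} (hh : 0 ≤ h) : truncEnt δ h ≤ InformationTheory.klFun h := by
  set D : ℝ → ℝ := fun h => InformationTheory.klFun h - truncEnt δ h with hD
  have hc : ContinuousOn D (Ici 0) := InformationTheory.continuous_klFun.continuousOn.sub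
    fun h hh => (hasDerivAt_truncEnt hδ hh).continuousAt.continuousWithinAt
  have hd : ∀ h, 0 < h → HasDerivAt D (Real.log h - truncLog δ h) h := fun h hh =>
    (InformationTheory.hasDerivAt_klFun hh.ne').sub (hasDerivAt_truncEnt hδ hh.le)
  have h1 : D 1 = 0 := by simp [hD, InformationTheory.klFun_one, truncEnt_one]
  have key : ∀ h, 0 < h → truncLog δ h = Real.log ((h + δ) / (1 + δ * h)) := fun h hh => by
    rw [Real.log_div (by positivity) (by positivity), truncLog]
  suffices 0 ≤ D h by simp only [hD] at this; linarith
  rcases le_total 1 h with h1h | h1h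
  · have hm : MonotoneOn D (Ici 1) := by
      refine monotoneOn_of_deriv_nonneg (convex_Ici 1) (hc.mono (Ici_subset_Ici.2 zero_le_one)) ?_ ?_
      · intro x hx
        rw [interior_Ici] at hx
        exact (hd x (zero_lt_one.trans hx)).differentiableAt.differentiableWithinAt
      · intro x hx
        rw [interior_Ici] at hx
        have hx0 : 0 < x := zero_lt_one.trans hx
        have hx1 : 1 < x := hx
        rw [(hd x hx0).deriv, sub_nonneg, key x hx0]
        refine Real.log_le_log (by positivity) ?_
        rw [div_le_iff₀ (by positivity)]
        nlinarith [mul_pos hδ (mul_pos (sub_pos.2 hx1) (by linarith : 0 < x + 1))]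
    simpa [h1] using hm (self_mem_Ici) h1h h1h
  · have hm : AntitoneOn D (Icc 0 1) := by
      refine antitoneOn_of_deriv_nonpos (convex_Icc 0 1) (hc.mono Icc_subset_Ici_self) ?_ ?_
      · intro x hx
        rw [interior_Icc] at hx
        exact (hd x hx.1).differentiableAt.differentiableWithinAt
      · intro x hx
        rw [interior_Icc] at hx
        rw [(hd x hx.1).deriv, sub_nonpos, key x hx.1]
        refine Real.log_le_log hx.1 ?_
        have := hx.1
        rw [le_div_iff₀ (by positivity)]
        nlinarith [hx.2, mul_pos hδ hx.1, mul_nonneg hδ.le (mul_nonneg hx.1.le hx.1.le)]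
    simpa [h1] using hm ⟨hh, h1h⟩ ⟨zero_le_one, le_rfl⟩ h1h

end

lemma tendsto_truncWeight {h : ℝ} (hh : 0 < h) :
    Tendsto (fun δ => truncWeight δ h) (𝓝 0) (𝓝 1) := by
  have : ContinuousAt (fun δ => truncWeight δ h) 0 := by
    unfold truncWeight
    refine ContinuousAt.mul continuousAt_const (ContinuousAt.div (by fun_prop) (by fun_prop) ?_)
    simp [hh.ne']
  have h2 := this.tendsto
  simpa [truncWeight, hh.ne'] using h2

lemma continuousOn_truncLog {δ : ℝ} (hδ : 0 < δ) : ContinuousOn (truncLog δ) (Ioi 0) :=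
  fun _ hh => (hasDerivAt_truncLog hδ (le_of_lt hh)).continuousAt.continuousWithinAt

lemma continuousOn_truncEnt {δ : ℝ} (hδ : 0 < δ) : ContinuousOn (truncEnt δ) (Ici 0) :=
  fun _ hh => (hasDerivAt_truncEnt hδ hh).continuousAt.continuousWithinAt

lemma continuousOn_truncWeight {δ : ℝ} (hδ : 0 < δ) : ContinuousOn (truncWeight δ) (Ioi 0) := by
  unfold truncWeight
  refine continuousOn_id.mul (ContinuousOn.div (by fun_prop) (by fun_prop) ?_)
  intro h (hh : 0 < h)
  positivity

/-! ### Differentiation in time -/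

/-- A function squeezed by convexity is differentiable: if `K t - K s ≤ E t t - E t s` and `E t` has
the derivative `H t`, with `H` jointly continuous, then `K` has the derivative `H t t`. -/
lemma hasDerivAt_of_sub_le {K : ℝ → ℝ} {E H : ℝ → ℝ → ℝ}
    (hK : ∀ t s, 0 < t → 0 < s → K t - K s ≤ E t t - E t s)
    (hE : ∀ t s, 0 < t → 0 < s → HasDerivAt (E t) (H t s) s)
    (hH : ContinuousOn (fun q : ℝ × ℝ => H q.1 q.2) (Ioi 0 ×ˢ Ioi 0)) {t : ℝ} (ht : 0 < t) :
    HasDerivAt K (H t t) t := by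
  rw [hasDerivAt_iff_isLittleO, Asymptotics.isLittleO_iff]
  intro ε hε
  have hc : ContinuousAt (fun q : ℝ × ℝ => H q.1 q.2) (t, t) :=
    hH.continuousAt (prod_mem_nhds (Ioi_mem_nhds ht) (Ioi_mem_nhds ht))
  obtain ⟨r, hr, hrb⟩ := Metric.eventually_nhds_iff.1
    ((Metric.tendsto_nhds.1 hc ε hε).and (prod_mem_nhds (Ioi_mem_nhds ht) (Ioi_mem_nhds ht)))
  have hb : ∀ u s, dist u t < r → dist s t < r → 0 < u ∧ 0 < s ∧ ‖H u s - H t t‖ ≤ ε := by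
    intro u s hu hs
    have h1 := hrb (y := (u, s)) (by rw [Prod.dist_eq]; exact max_lt hu hs)
    exact ⟨h1.2.1, h1.2.2, by simpa [Real.dist_eq] using h1.1.le⟩
  -- The mean value bound is uniform in the first argument `u`. This matters because one of the two
  -- squeezing inequalities uses `E s`, whose index moves with `s`.
  have hmv : ∀ u s, dist u t < r → dist s t < r →
      ‖E u s - E u t - (s - t) * H t t‖ ≤ ε * ‖s - t‖ := by
    intro u s hu hs
    have := (convex_ball t r).norm_image_sub_le_of_norm_hasDerivWithin_le
      (f := fun s => E u s - s * H t t) (f' := fun s => H u s - H t t) (C := ε) (x := t) (y := s)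
      (fun x hx => ((hE u x (hb u x hu hx).1 (hb u x hu hx).2.1).sub
        (by simpa using (hasDerivAt_id x).mul_const (H t t))).hasDerivWithinAt)
      (fun x hx => (hb u x hu hx).2.2) (Metric.mem_ball_self hr) hs
    calc ‖E u s - E u t - (s - t) * H t t‖ = ‖(E u s - s * H t t) - (E u t - t * H t t)‖ := by
          congr 1; ring
      _ ≤ _ := this
  filter_upwards [Metric.ball_mem_nhds t hr] with s hs
  have hs' : dist s t < r := hs
  have ht' : dist t t < r := by simpa using hr
  have h0 : 0 < s := (hb t s ht' hs').2.1
  -- The hypothesis with `t` and `s` in both orders bounds `K s - K t` below by `E t s - E t t` and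
  -- above by `E s s - E s t`; both are `(s - t) * H t t` up to `ε * |s - t|`.
  have k1 := hK t s ht h0
  have k2 := hK s t h0 ht
  have m1 := hmv t s ht' hs'
  have m2 := hmv s s hs' hs'
  rw [Real.norm_eq_abs, abs_le] at m1 m2
  rw [smul_eq_mul, Real.norm_eq_abs, abs_le]
  constructor <;> linarith [m1.1, m1.2, m2.1, m2.2]

variable {n : ℕ} {b : Vec n → Vec n} {μ : Measure (Vec n)} [IsProbabilityMeasure μ]

/-- The time derivative of `step b t q`. -/
def stepVel (b : Vec n → Vec n) (t : ℝ) (q : Vec n × Vec n) : Vec n :=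
  -b q.1 + (√(2 * t))⁻¹ • q.2

lemma hasDerivAt_step (q : Vec n × Vec n) {t : ℝ} (ht : 0 < t) :
    HasDerivAt (fun t => step b t q) (stepVel b t q) t := by
  unfold step stepVel
  have h1 : HasDerivAt (fun t : ℝ => √(2 * t)) ((√(2 * t))⁻¹) t := by
    refine (((hasDerivAt_id t).const_mul 2).sqrt (by simpa using ht.ne')).congr_deriv ?_
    simp only [id]; field_simp
  have h2 := (((hasDerivAt_id t).smul_const (b q.1)).const_sub q.1).add (h1.smul_const q.2)
  exact h2.congr_deriv (by simp)

lemma continuousOn_stepVel (q : Vec n × Vec n) :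
    ContinuousOn (fun t => stepVel b t q) (Ioi 0) := by
  unfold stepVel
  have h : ContinuousOn (fun t : ℝ => (√(2 * t))⁻¹) (Ioi 0) := by
    refine ContinuousOn.inv₀ (by fun_prop) fun t (ht : 0 < t) => ?_
    positivity
  exact continuousOn_const.add (h.smul continuousOn_const)

lemma continuous_stepVel (hb : Continuous b) (t : ℝ) : Continuous (stepVel b t) := by
  unfold stepVel; fun_prop

lemma integrable_velocity_bound (hbi : Integrable (fun x => ‖b x‖) μ) (c : ℝ) :
    Integrable (fun q : Vec n × Vec n => ‖b q.1‖ + c * ‖q.2‖) (μ.prod (stdGaussian (Vec n))) :=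
  (hbi.comp_fst (stdGaussian (Vec n))).add
    ((integrable_norm_stdGaussian.comp_snd μ).const_mul c)

lemma norm_stepVel_le {a t : ℝ} (ha : 0 < a) (h : a ≤ t) (q : Vec n × Vec n) :
    ‖stepVel b t q‖ ≤ ‖b q.1‖ + (√(2 * a))⁻¹ * ‖q.2‖ := by
  unfold stepVel
  refine (norm_add_le _ _).trans ?_
  rw [norm_neg, norm_smul, Real.norm_of_nonneg (by positivity)]
  gcongr

/-- The evolution of the expectation of a function of a step. -/
lemma hasDerivAt_integral_step (hb : Continuous b) (hbi : Integrable (fun x => ‖b x‖) μ)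
    {F : Vec n → ℝ} {G : Vec n → Vec n} (hF : ∀ y, HasGradientAt F (G y) y) (hG : Continuous G)
    {C C' : ℝ} (hGC : ∀ y, ‖G y‖ ≤ C) (hFC : ∀ y, ‖F y‖ ≤ C') {t : ℝ} (ht : 0 < t) :
    HasDerivAt (fun s => ∫ q, F (step b s q) ∂(μ.prod (stdGaussian (Vec n))))
      (∫ q, ⟪G (step b t q), stepVel b t q⟫ ∂(μ.prod (stdGaussian (Vec n)))) t := by
  have hFc : Continuous F := continuous_iff_continuousAt.2 fun y =>
    (hF y).hasFDerivAt.continuousAt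
  have hC : 0 ≤ C := (norm_nonneg _).trans (hGC 0)
  -- On `s > t / 2` the singular factor `(√(2s))⁻¹` of the velocity stays bounded.
  refine (hasDerivAt_integral_of_dominated_loc_of_deriv_le (s := Ioi (t / 2))
    (F := fun s q => F (step b s q))
    (F' := fun s q => ⟪G (step b s q), stepVel b s q⟫)
    (bound := fun q => C * (‖b q.1‖ + (√(2 * (t / 2)))⁻¹ * ‖q.2‖)) (Ioi_mem_nhds (by linarith))
    (Eventually.of_forall fun s =>
      (hFc.comp (continuous_step hb s)).aestronglyMeasurable)
    (Integrable.of_bound (hFc.comp (continuous_step hb t)).aestronglyMeasurable C'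
      (ae_of_all _ fun q => hFC _)) ?_ ?_ ((integrable_velocity_bound hbi _).const_mul C) ?_).2
  · exact ((hG.comp (continuous_step hb t)).inner (continuous_stepVel hb t)).aestronglyMeasurable
  · refine ae_of_all _ fun q s hs => ?_
    refine (norm_inner_le_norm _ _).trans ?_
    have := norm_stepVel_le (b := b) (by positivity) (le_of_lt hs) q
    exact mul_le_mul (hGC _) this (norm_nonneg _) hC
  · refine ae_of_all _ fun q s hs => ?_
    have hs0 : 0 < s := (half_pos ht).trans hs
    have h1 := (hF (step b s q)).hasFDerivAt.comp_hasDerivAt s (hasDerivAt_step (b := b) q hs0)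
    exact h1.congr_deriv (by simp)

/-- The two times are decoupled, one for the test function and one for the step, as the joint
continuity in `hasDerivAt_of_sub_le` requires. -/
lemma continuousOn_integral_inner_stepVel (hb : Continuous b)
    (hbi : Integrable (fun x => ‖b x‖) μ) {G : ℝ → Vec n → Vec n}
    (hG : ContinuousOn (fun q : ℝ × Vec n => G q.1 q.2) (Ioi 0 ×ˢ univ))
    (hGC : ∀ a c : ℝ, 0 < a → ∃ C, ∀ t ∈ Icc a c, ∀ y, ‖G t y‖ ≤ C) :
    ContinuousOn (fun r : ℝ × ℝ => ∫ q, ⟪G r.1 (step b r.2 q), stepVel b r.2 q⟫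
      ∂(μ.prod (stdGaussian (Vec n)))) (Ioi 0 ×ˢ Ioi 0) := by
  have main : ∀ a c : ℝ, 0 < a → ContinuousOn (fun r : ℝ × ℝ => ∫ q,
      ⟪G r.1 (step b r.2 q), stepVel b r.2 q⟫ ∂(μ.prod (stdGaussian (Vec n))))
      (Icc a c ×ˢ Icc a c) := by
    intro a c ha
    obtain ⟨C, hC⟩ := hGC a c ha
    have hbd : Integrable (fun q : Vec n × Vec n => C * (‖b q.1‖ + (√(2 * a))⁻¹ * ‖q.2‖))
        (μ.prod (stdGaussian (Vec n))) := (integrable_velocity_bound hbi _).const_mul C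
    refine continuousOn_of_dominated (X := ℝ × ℝ) (s := Icc a c ×ˢ Icc a c)
      (F := fun r q => ⟪G r.1 (step b r.2 q), stepVel b r.2 q⟫)
      (μ := μ.prod (stdGaussian (Vec n))) (bound := fun q => C * (‖b q.1‖ + (√(2 * a))⁻¹ * ‖q.2‖)) (fun r hr => ?_)
      (fun r hr => ae_of_all _ fun q => ?_) hbd
      (ae_of_all _ fun q => ?_)
    · have hr1 : 0 < r.1 := ha.trans_le (mem_prod.1 hr).1.1
      have h1 : Continuous (G r.1) := continuous_slice (f := G) (t := r.1) hG hr1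
      have h2 := continuous_step hb r.2
      have h3 := continuous_stepVel hb r.2
      have h4 : Continuous fun q => ⟪G r.1 (step b r.2 q), stepVel b r.2 q⟫ :=
        (h1.comp h2).inner h3
      exact h4.aestronglyMeasurable
    · refine (norm_inner_le_norm _ _).trans ?_
      have h1 := hC r.1 (mem_prod.1 hr).1 (step b r.2 q)
      exact mul_le_mul h1 (norm_stepVel_le ha (mem_prod.1 hr).2.1 q) (norm_nonneg _) ((norm_nonneg _).trans h1)
    · refine ContinuousOn.inner (𝕜 := ℝ) (E := Vec n) ?_ ?_
      · refine hG.comp (f := fun r : ℝ × ℝ => (r.1, step b r.2 q)) ?_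
          fun r hr => ⟨ha.trans_le (mem_prod.1 hr).1.1, mem_univ _⟩
        unfold step; fun_prop
      · exact (continuousOn_stepVel q).comp (f := fun r : ℝ × ℝ => r.2) (by fun_prop)
          fun r hr => ha.trans_le (mem_prod.1 hr).2.1
  rintro r ⟨h1 : 0 < r.1, h2 : 0 < r.2⟩
  have hm : 0 < min r.1 r.2 := lt_min h1 h2
  refine ((main (min r.1 r.2 / 2) (max r.1 r.2 + 1) (by positivity)).continuousAt
    (prod_mem_nhds (Icc_mem_nhds ?_ ?_) (Icc_mem_nhds ?_ ?_))).continuousWithinAt <;>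
  linarith [min_le_left r.1 r.2, min_le_right r.1 r.2, le_max_left r.1 r.2, le_max_right r.1 r.2]

end

section

/-! ### Dissipation of the truncated entropy -/

/-- `v` is the gradient of `V`, and it is `L`-Lipschitz. -/
structure IsPotential {n : ℕ} (V : Vec n → ℝ) (v : Vec n → Vec n) (L : ℝ) : Prop where
  grad : ∀ y, HasGradientAt V (v y) y
  lip : ∀ x y, ‖v x - v y‖ ≤ L * ‖x - y‖
  nonneg : 0 ≤ L

/-- `χ` is a compactly supported function with values in `[0, 1]` and with the continuous
gradient `g`, which is bounded by `c`. -/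
structure IsCutoff {n : ℕ} (χ : Vec n → ℝ) (g : Vec n → Vec n) (c : ℝ) : Prop where
  grad : ∀ y, HasGradientAt χ (g y) y
  cont : Continuous g
  supp : HasCompactSupport χ
  nonneg : ∀ y, 0 ≤ χ y
  le_one : ∀ y, χ y ≤ 1
  bound : ∀ y, ‖g y‖ ≤ c

variable {n : ℕ} {b : Vec n → Vec n} {μ : Measure (Vec n)} [IsProbabilityMeasure μ]
  {V : Vec n → ℝ} {v : Vec n → Vec n} {L : ℝ} {χ : Vec n → ℝ} {g : Vec n → Vec n} {c δ : ℝ}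

lemma IsPotential.continuous_grad (hV : IsPotential V v L) : Continuous v :=
  (LipschitzWith.of_dist_le_mul (K := ⟨L, hV.nonneg⟩) fun x y => by
    rw [dist_eq_norm, dist_eq_norm]; exact hV.lip x y).continuous

lemma IsPotential.continuous (hV : IsPotential V v L) : Continuous V :=
  continuous_iff_continuousAt.2 fun y => (hV.grad y).hasFDerivAt.continuousAt

lemma IsCutoff.continuous (hχ : IsCutoff χ g c) : Continuous χ :=
  continuous_iff_continuousAt.2 fun y => (hχ.grad y).hasFDerivAt.continuousAt

lemma IsCutoff.eq_zero (hχ : IsCutoff χ g c) {y : Vec n} (hy : y ∉ tsupport χ) : g y = 0 := by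
  have h1 : χ =ᶠ[𝓝 y] fun _ => 0 := notMem_tsupport_iff_eventuallyEq.1 hy
  have h2 := (hχ.grad y).congr_of_eventuallyEq h1.symm
  exact h2.unique (hasGradientAt_const y 0)

/-- The density of the mixture relative to `exp (-V)`. -/
def relDens (b : Vec n → Vec n) (μ : Measure (Vec n)) (V : Vec n → ℝ) (t : ℝ) (y : Vec n) : ℝ :=
  mixDens b μ t y * Real.exp (V y)

/-- The gradient of the logarithm of `relDens`. -/
def relScore (b : Vec n → Vec n) (μ : Measure (Vec n)) (v : Vec n → Vec n) (t : ℝ) (y : Vec n) :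
    Vec n :=
  mixScore b μ t y + v y

lemma relDens_pos (hb : Continuous b) {t : ℝ} (ht : 0 < t) (y : Vec n) : 0 < relDens b μ V t y :=
  mul_pos (mixDens_pos hb ht y) (Real.exp_pos _)

lemma continuousOn_relDens (hb : Continuous b) (hV : IsPotential V v L) :
    ContinuousOn (fun q : ℝ × Vec n => relDens b μ V q.1 q.2) (Ioi 0 ×ˢ univ) := by
  have := hV.continuous
  exact (continuousOn_mixDens hb).mul (by fun_prop)

lemma continuousOn_relScore (hb : Continuous b) (hV : IsPotential V v L) :
    ContinuousOn (fun q : ℝ × Vec n => relScore b μ v q.1 q.2) (Ioi 0 ×ˢ univ) := by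
  have := hV.continuous_grad
  exact (continuousOn_mixScore hb).add (by fun_prop)

lemma hasGradientAt_relDens (hb : Continuous b) (hV : IsPotential V v L) {t : ℝ} (ht : 0 < t)
    (y : Vec n) :
    HasGradientAt (relDens b μ V t) (relDens b μ V t y • relScore b μ v t y) y := by
  have h1 := (hasGradientAt_mixDens (μ := μ) hb ht y).hasFDerivAt
  have h2 := (hV.grad y).hasFDerivAt.exp
  rw [hasGradientAt_iff_hasFDerivAt]
  refine (h1.mul h2).congr_fderiv ?_
  have hd := (mixDens_pos (μ := μ) hb ht y).ne'
  ext w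
  simp only [add_apply, smul_apply, InnerProductSpace.toDual_apply_apply, smul_eq_mul, relScore,
    relDens, mixScore, inner_smul_left, inner_add_left]
  simp
  field_simp
  ring

/-- The truncated relative entropy, localized by `χ`, of the density `r`. -/
def localEnt (χ V : Vec n → ℝ) (δ : ℝ) (r : Vec n → ℝ) : ℝ :=
  ∫ y, χ y * truncEnt δ (r y * Real.exp (V y)) * Real.exp (-V y)

lemma localEnt_nonneg (hχ : IsCutoff χ g c) (hδ : 0 < δ) (hδ1 : δ < 1) {r : Vec n → ℝ}
    (hr : ∀ y, 0 ≤ r y) : 0 ≤ localEnt χ V δ r :=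
  integral_nonneg fun y => mul_nonneg (mul_nonneg (hχ.nonneg y)
    (truncEnt_nonneg hδ hδ1 (mul_nonneg (hr y) (Real.exp_pos _).le))) (Real.exp_pos _).le

/-- The test function `χ * truncLog δ h` for the relative density `h`. -/
def testFun (b : Vec n → Vec n) (μ : Measure (Vec n)) (V χ : Vec n → ℝ) (δ t : ℝ) (y : Vec n) : ℝ :=
  χ y * truncLog δ (relDens b μ V t y)

/-- The gradient of `testFun`. -/
def testGrad (b : Vec n → Vec n) (μ : Measure (Vec n)) (V : Vec n → ℝ) (v : Vec n → Vec n)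
    (χ : Vec n → ℝ) (g : Vec n → Vec n) (δ t : ℝ) (y : Vec n) : Vec n :=
  truncLog δ (relDens b μ V t y) • g y
    + (χ y * truncWeight δ (relDens b μ V t y)) • relScore b μ v t y

lemma hasGradientAt_testFun (hb : Continuous b) (hV : IsPotential V v L) (hχ : IsCutoff χ g c)
    (hδ : 0 < δ) {t : ℝ} (ht : 0 < t) (y : Vec n) :
    HasGradientAt (testFun b μ V χ δ t) (testGrad b μ V v χ g δ t y) y := by
  have h1 := (hasGradientAt_relDens (μ := μ) hb hV ht y).hasFDerivAt
  have h2 := (hasDerivAt_truncLog hδ (relDens_pos (μ := μ) (V := V) hb ht y).le).comp_hasFDerivAt y h1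
  have h3 := (hχ.grad y).hasFDerivAt.mul h2
  rw [hasGradientAt_iff_hasFDerivAt]
  refine h3.congr_fderiv ?_
  ext w
  simp only [add_apply, smul_apply, InnerProductSpace.toDual_apply_apply, smul_eq_mul, testGrad,
    truncWeight, inner_smul_left, inner_add_left, Function.comp_apply]
  simp
  ring

lemma continuousOn_truncLog_relDens (hb : Continuous b) (hV : IsPotential V v L) (hδ : 0 < δ) :
    ContinuousOn (fun q : ℝ × Vec n => truncLog δ (relDens b μ V q.1 q.2)) (Ioi 0 ×ˢ univ) :=
  (continuousOn_truncLog hδ).comp (continuousOn_relDens hb hV) fun q hq =>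
    relDens_pos hb (mem_prod.1 hq).1 q.2

lemma continuousOn_truncWeight_relDens (hb : Continuous b) (hV : IsPotential V v L) (hδ : 0 < δ) :
    ContinuousOn (fun q : ℝ × Vec n => truncWeight δ (relDens b μ V q.1 q.2)) (Ioi 0 ×ˢ univ) :=
  (continuousOn_truncWeight hδ).comp (continuousOn_relDens hb hV) fun q hq =>
    relDens_pos hb (mem_prod.1 hq).1 q.2

lemma continuousOn_testGrad (hb : Continuous b) (hV : IsPotential V v L) (hχ : IsCutoff χ g c)
    (hδ : 0 < δ) :
    ContinuousOn (fun q : ℝ × Vec n => testGrad b μ V v χ g δ q.1 q.2) (Ioi 0 ×ˢ univ) := by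
  have h1 := hχ.continuous
  have h2 := hχ.cont
  refine ContinuousOn.add ((continuousOn_truncLog_relDens hb hV hδ).smul (by fun_prop)) ?_
  exact (ContinuousOn.mul (by fun_prop) (continuousOn_truncWeight_relDens hb hV hδ)).smul
    (continuousOn_relScore hb hV)

/-- A continuous function on `(0, ∞) × ℝⁿ` with support in a fixed compact set is bounded, locally
uniformly in time. -/
lemma exists_bound_of_support {E : Type*} [NormedAddCommGroup E] {G : ℝ → Vec n → E}
    (hG : ContinuousOn (fun q : ℝ × Vec n => G q.1 q.2) (Ioi 0 ×ˢ univ)) {S : Set (Vec n)}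
    (hS : IsCompact S) (h0 : ∀ t y, y ∉ S → G t y = 0) (a c : ℝ) (ha : 0 < a) :
    ∃ C, ∀ t ∈ Icc a c, ∀ y, ‖G t y‖ ≤ C := by
  obtain ⟨C, hC⟩ := (isCompact_Icc (a := a) (b := c)).prod hS |>.exists_bound_of_continuousOn
    (hG.mono fun q hq => ⟨ha.trans_le (mem_prod.1 hq).1.1, mem_univ _⟩)
  refine ⟨max C 0, fun t ht y => ?_⟩
  by_cases hy : y ∈ S
  · exact (hC (t, y) ⟨ht, hy⟩).trans (le_max_left _ _)
  · simp [h0 t y hy]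

omit [IsProbabilityMeasure μ] in
lemma testGrad_eq_zero (hχ : IsCutoff χ g c) (t : ℝ) {y : Vec n} (hy : y ∉ tsupport χ) :
    testGrad b μ V v χ g δ t y = 0 := by
  simp [testGrad, hχ.eq_zero hy, image_eq_zero_of_notMem_tsupport hy]

lemma continuous_testFun (hb : Continuous b) (hV : IsPotential V v L) (hχ : IsCutoff χ g c)
    (hδ : 0 < δ) {t : ℝ} (ht : 0 < t) : Continuous (testFun b μ V χ δ t) :=
  hχ.continuous.mul (continuous_slice
    (f := fun t y => truncLog δ (relDens b μ V t y)) (continuousOn_truncLog_relDens hb hV hδ) ht)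

lemma continuous_relDens (hb : Continuous b) (hV : IsPotential V v L) {t : ℝ} (ht : 0 < t) :
    Continuous (relDens b μ V t) := continuous_slice (continuousOn_relDens hb hV) ht

lemma integrable_localEnt_integrand (hb : Continuous b) (hV : IsPotential V v L)
    (hχ : IsCutoff χ g c) (hδ : 0 < δ) {t : ℝ} (ht : 0 < t) :
    Integrable fun y => χ y * truncEnt δ (mixDens b μ t y * Real.exp (V y)) * Real.exp (-V y) := by
  have h1 := hV.continuous
  have h2 : Continuous fun y => truncEnt δ (relDens b μ V t y) :=
    (continuousOn_truncEnt hδ).comp_continuous (continuous_relDens hb hV ht)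
      fun y => (relDens_pos hb ht y).le
  refine Continuous.integrable_of_hasCompactSupport
    ((hχ.continuous.mul h2).mul (by fun_prop)) ?_
  exact (hχ.supp.mul_right).mul_right

/-- The tangent inequality, applied pointwise to the relative densities. The factors `exp (V y)` and
`exp (-V y)` cancel, and what remains is the difference of the expectations at times `t` and `s` of
one test function, frozen at time `t`. -/
lemma localEnt_sub_le (hb : Continuous b) (hV : IsPotential V v L) (hχ : IsCutoff χ g c)
    (hδ : 0 < δ) (hδ1 : δ < 1) {t s : ℝ} (ht : 0 < t) (hs : 0 < s) :
    localEnt χ V δ (mixDens b μ t) - localEnt χ V δ (mixDens b μ s)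
      ≤ ∫ q, testFun b μ V χ δ t (step b t q) ∂(μ.prod (stdGaussian (Vec n)))
        - ∫ q, testFun b μ V χ δ t (step b s q) ∂(μ.prod (stdGaussian (Vec n))) := by
  have hF := continuous_testFun (μ := μ) hb hV hχ hδ ht
  have hFs : HasCompactSupport (testFun b μ V χ δ t) := hχ.supp.mul_right
  have hi : ∀ r, 0 < r → Integrable fun y => mixDens b μ r y * testFun b μ V χ δ t y := fun r hr =>
    Continuous.integrable_of_hasCompactSupport
      ((continuous_slice (continuousOn_mixDens hb) hr).mul hF) hFs.mul_left
  rw [integral_step hb ht hF, integral_step hb hs hF, localEnt, localEnt,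
    ← integral_sub (integrable_localEnt_integrand hb hV hχ hδ ht)
      (integrable_localEnt_integrand hb hV hχ hδ hs), ← integral_sub (hi t ht) (hi s hs)]
  refine integral_mono ((integrable_localEnt_integrand hb hV hχ hδ ht).sub
      (integrable_localEnt_integrand hb hV hχ hδ hs)) ((hi t ht).sub (hi s hs)) fun y => ?_
  have h1 := truncEnt_sub_le hδ hδ1 (relDens_pos (μ := μ) (V := V) hb ht y).le
    (relDens_pos (μ := μ) (V := V) hb hs y).le
  have h2 := mul_le_mul_of_nonneg_left h1 (mul_nonneg (hχ.nonneg y) (Real.exp_pos (-V y)).le)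
  have h3 : Real.exp (V y) * Real.exp (-V y) = 1 := by rw [← Real.exp_add]; simp
  simp only [testFun, relDens] at *
  calc _ = χ y * Real.exp (-V y) * (truncEnt δ (mixDens b μ t y * Real.exp (V y))
        - truncEnt δ (mixDens b μ s y * Real.exp (V y))) := by ring
    _ ≤ _ := h2
    _ = (mixDens b μ t y - mixDens b μ s y) * (χ y * truncLog δ (mixDens b μ t y * Real.exp (V y)))
        * (Real.exp (V y) * Real.exp (-V y)) := by ring
    _ = _ := by rw [h3]; ring

/-- The rate of change of the localized entropy. -/
def entRate (b : Vec n → Vec n) (μ : Measure (Vec n)) (V : Vec n → ℝ) (v : Vec n → Vec n)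
    (χ : Vec n → ℝ) (g : Vec n → Vec n) (δ t : ℝ) : ℝ :=
  ∫ q, ⟪testGrad b μ V v χ g δ t (step b t q), stepVel b t q⟫ ∂(μ.prod (stdGaussian (Vec n)))

lemma exists_bound_testGrad (hb : Continuous b) (hV : IsPotential V v L) (hχ : IsCutoff χ g c)
    (hδ : 0 < δ) (a d : ℝ) (ha : 0 < a) :
    ∃ C, ∀ t ∈ Icc a d, ∀ y, ‖testGrad b μ V v χ g δ t y‖ ≤ C :=
  exists_bound_of_support (continuousOn_testGrad hb hV hχ hδ) hχ.supp
    (fun t _ hy => testGrad_eq_zero hχ t hy) a d ha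

/-- The squeeze replaces the Fokker-Planck equation: only the spatial gradient of the test function
and the velocity of the sample paths enter. -/
lemma hasDerivAt_localEnt (hb : Continuous b) (hbi : Integrable (fun x => ‖b x‖) μ)
    (hV : IsPotential V v L) (hχ : IsCutoff χ g c) (hδ : 0 < δ) (hδ1 : δ < 1) {t : ℝ} (ht : 0 < t) :
    HasDerivAt (fun t => localEnt χ V δ (mixDens b μ t)) (entRate b μ V v χ g δ t) t := by
  refine hasDerivAt_of_sub_le
    (E := fun t s => ∫ q, testFun b μ V χ δ t (step b s q) ∂(μ.prod (stdGaussian (Vec n))))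
    (H := fun t s => ∫ q, ⟪testGrad b μ V v χ g δ t (step b s q), stepVel b s q⟫
      ∂(μ.prod (stdGaussian (Vec n))))
    (fun t s ht hs => localEnt_sub_le hb hV hχ hδ hδ1 ht hs) (fun t s ht hs => ?_)
    (continuousOn_integral_inner_stepVel hb hbi (continuousOn_testGrad hb hV hχ hδ)
      (exists_bound_testGrad hb hV hχ hδ)) ht
  obtain ⟨C, hC⟩ := exists_bound_testGrad (μ := μ) hb hV hχ hδ t t ht
  refine hasDerivAt_integral_step hb hbi (C := C) (C' := -Real.log δ)
    (fun y => hasGradientAt_testFun hb hV hχ hδ ht y)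
    (continuous_slice (continuousOn_testGrad hb hV hχ hδ) ht) (hC t ⟨le_rfl, le_rfl⟩)
    (fun y => ?_) hs
  rw [testFun, norm_mul, Real.norm_of_nonneg (hχ.nonneg y), Real.norm_eq_abs]
  have h1 := abs_truncLog_le hδ hδ1 (relDens_pos (μ := μ) (V := V) hb ht y).le
  calc _ ≤ 1 * |truncLog δ (relDens b μ V t y)| :=
        mul_le_mul_of_nonneg_right (hχ.le_one y) (abs_nonneg _)
    _ ≤ _ := by rwa [one_mul]

lemma continuousOn_entRate (hb : Continuous b) (hbi : Integrable (fun x => ‖b x‖) μ)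
    (hV : IsPotential V v L) (hχ : IsCutoff χ g c) (hδ : 0 < δ) :
    ContinuousOn (entRate b μ V v χ g δ) (Ioi 0) :=
  (continuousOn_integral_inner_stepVel hb hbi (continuousOn_testGrad hb hV hχ hδ)
    (exists_bound_testGrad hb hV hχ hδ)).comp (f := fun t : ℝ => (t, t)) (by fun_prop)
    fun t ht => ⟨ht, ht⟩

/-- The weighted Fisher information at time `t`. -/
def localFisher (b : Vec n → Vec n) (μ : Measure (Vec n)) (V : Vec n → ℝ) (v : Vec n → Vec n)
    (χ : Vec n → ℝ) (δ t : ℝ) : ℝ :=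
  ∫ q, χ (step b t q) * truncWeight δ (relDens b μ V t (step b t q))
    * ‖relScore b μ v t (step b t q)‖ ^ 2 ∂(μ.prod (stdGaussian (Vec n)))

/-- The mean square difference of the drift and the gradient of the potential. -/
def driftGap (b : Vec n → Vec n) (μ : Measure (Vec n)) (v : Vec n → Vec n) (t : ℝ) : ℝ :=
  ∫ q, ‖v (step b t q) - b q.1‖ ^ 2 ∂(μ.prod (stdGaussian (Vec n)))

/-- The velocity is `-b(x) + (2t)^(-1/2) Z`, and against a function of `x_t` the noise term acts as
minus the score. The part of the test gradient along `w = relScore` is therefore paired with `-b(x)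
- score = -w + (v - b(x))`, which gives the dissipation and the drift gap. The part along `∇χ` is
bounded by `c`, by `-log δ` and by the mean speed. -/
lemma entRate_le (hb : Continuous b) (hbi : Integrable (fun x => ‖b x‖) μ)
    (hV : IsPotential V v L) (hχ : IsCutoff χ g c) (hδ : 0 < δ) (hδ1 : δ < 1) {t : ℝ} (ht : 0 < t)
    (hD : Integrable (fun q => ‖v (step b t q) - b q.1‖ ^ 2) (μ.prod (stdGaussian (Vec n)))) :
    entRate b μ V v χ g δ t ≤ -(3 / 4) * localFisher b μ V v χ δ t + driftGap b μ v t
      + c * -Real.log δ * (∫ x, ‖b x‖ ∂μ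
          + (√(2 * t))⁻¹ * ∫ z, ‖z‖ ∂(stdGaussian (Vec n))) := by
  set P := μ.prod (stdGaussian (Vec n)) with hP
  set ψ : Vec n → ℝ := fun y => χ y * truncWeight δ (relDens b μ V t y) with hψ
  set w : Vec n → Vec n := relScore b μ v t with hw
  set X := step b t with hX
  have hXc : Continuous X := continuous_step hb t
  have hwc : Continuous w := continuous_slice (continuousOn_relScore hb hV) ht
  have hψc : Continuous ψ :=
    hχ.continuous.mul (continuous_slice
      (f := fun t y => truncWeight δ (relDens b μ V t y))
      (continuousOn_truncWeight_relDens hb hV hδ) ht)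
  have hvc := hV.continuous_grad
  have hψs : HasCompactSupport ψ := hχ.supp.mul_right
  have hψ0 : ∀ y, 0 ≤ ψ y := fun y => mul_nonneg (hχ.nonneg y)
    (truncWeight_nonneg hδ hδ1 (relDens_pos hb ht y).le)
  have hψ1 : ∀ y, ψ y ≤ 1 := fun y => mul_le_one₀ (hχ.le_one y)
    (truncWeight_nonneg hδ hδ1 (relDens_pos hb ht y).le)
    (truncWeight_le_one hδ (relDens_pos hb ht y).le)
  -- The cutoff makes `ψ w` bounded, so every pairing below is integrable without moment bounds on
  -- the score.
  have hac : Continuous fun y => ψ y • w y := hψc.smul hwc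
  obtain ⟨C, hC⟩ := hac.bounded_above_of_compact_support hψs.smul_right
  have hz : Integrable (fun q : Vec n × Vec n => ‖q.2‖) P := integrable_norm_stdGaussian.comp_snd μ
  have hbP : Integrable (fun q : Vec n × Vec n => ‖b q.1‖) P := hbi.comp_fst _
  have i1 : Integrable (fun q => ⟪ψ (X q) • w (X q), q.2⟫) P := by
    refine (hz.const_mul C).mono' (Continuous.aestronglyMeasurable (by fun_prop))
      (ae_of_all _ fun q => ?_)
    exact (norm_inner_le_norm _ _).trans (mul_le_mul_of_nonneg_right (hC _) (norm_nonneg _))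
  have i2 : Integrable (fun q => ⟪ψ (X q) • w (X q), b q.1⟫) P := by
    refine (hbP.const_mul C).mono' (Continuous.aestronglyMeasurable (by fun_prop))
      (ae_of_all _ fun q => ?_)
    exact (norm_inner_le_norm _ _).trans (mul_le_mul_of_nonneg_right (hC _) (norm_nonneg _))
  have i2n : Integrable (fun q => -⟪ψ (X q) • w (X q), b q.1⟫) P := i2.neg
  have hsc : Continuous (mixScore b μ t) := continuous_slice (continuousOn_mixScore hb) ht
  have i3 : Integrable (fun q => ⟪ψ (X q) • w (X q), mixScore b μ t (X q)⟫) P := by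
    have hcc : Continuous fun y => ⟪ψ y • w y, mixScore b μ t y⟫ := by fun_prop
    obtain ⟨C', hC'⟩ := hcc.bounded_above_of_compact_support (hψs.mono fun y hy h0 => hy (by
      simp [h0]))
    exact Integrable.of_bound (hcc.comp hXc).aestronglyMeasurable C' (ae_of_all _ fun q => hC' _)
  have i4 : Integrable (fun q => ψ (X q) * ‖w (X q)‖ ^ 2) P := by
    have hcc : Continuous fun y => ψ y * ‖w y‖ ^ 2 := by fun_prop
    obtain ⟨C', hC'⟩ := hcc.bounded_above_of_compact_support hψs.mul_right
    exact Integrable.of_bound (hcc.comp hXc).aestronglyMeasurable C' (ae_of_all _ fun q => hC' _)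
  have hlc : Continuous fun y => truncLog δ (relDens b μ V t y) :=
    continuous_slice (f := fun t y => truncLog δ (relDens b μ V t y))
      (continuousOn_truncLog_relDens hb hV hδ) ht
  have hlog : 0 ≤ -Real.log δ := by linarith [Real.log_neg hδ hδ1]
  have hgc := hχ.cont
  have hvel : Continuous (stepVel b t) := continuous_stepVel hb t
  have hb5 : ∀ q, ‖truncLog δ (relDens b μ V t (X q)) * ⟪g (X q), stepVel b t q⟫‖
      ≤ c * -Real.log δ * (‖b q.1‖ + (√(2 * t))⁻¹ * ‖q.2‖) := by
    intro q
    rw [norm_mul, mul_comm c, mul_assoc]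
    refine mul_le_mul (abs_truncLog_le hδ hδ1 (relDens_pos hb ht _).le) ?_ (norm_nonneg _) hlog
    refine (norm_inner_le_norm _ _).trans ?_
    exact mul_le_mul (hχ.bound _) (norm_stepVel_le ht le_rfl q) (norm_nonneg _)
      ((norm_nonneg _).trans (hχ.bound 0))
  have i6 : Integrable (fun q : Vec n × Vec n =>
      c * -Real.log δ * (‖b q.1‖ + (√(2 * t))⁻¹ * ‖q.2‖)) P :=
    (integrable_velocity_bound hbi _).const_mul _
  have i5 : Integrable (fun q => truncLog δ (relDens b μ V t (X q)) * ⟪g (X q), stepVel b t q⟫) P :=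
    i6.mono' (Continuous.aestronglyMeasurable
      ((hlc.comp hXc).mul ((hgc.comp hXc).inner hvel))) (ae_of_all _ hb5)
  have e0 : ∀ q, ⟪testGrad b μ V v χ g δ t (X q), stepVel b t q⟫
      = truncLog δ (relDens b μ V t (X q)) * ⟪g (X q), stepVel b t q⟫
        + (-⟪ψ (X q) • w (X q), b q.1⟫ + (√(2 * t))⁻¹ * ⟪ψ (X q) • w (X q), q.2⟫) := by
    intro q
    rw [testGrad, inner_add_left, real_inner_smul_left]
    congr 1
    rw [stepVel, inner_add_right, inner_neg_right, inner_smul_right]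
  have e1 : entRate b μ V v χ g δ t
      = ∫ q, truncLog δ (relDens b μ V t (X q)) * ⟪g (X q), stepVel b t q⟫ ∂P
        + (-∫ q, ⟪ψ (X q) • w (X q), b q.1⟫ ∂P
          + (√(2 * t))⁻¹ * ∫ q, ⟪ψ (X q) • w (X q), q.2⟫ ∂P) := by
    rw [entRate, ← hP, ← hX]
    simp_rw [e0]
    rw [integral_add i5 (by exact i2n.add (i1.const_mul _)), integral_add i2n (i1.const_mul _),
      integral_neg, integral_const_mul]
  -- The noise is exchanged for the score; the factor `√(2t)` cancels that of the velocity.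
  have e2 := integral_inner_noise (μ := μ) hb ht (a := fun y => ψ y • w y) hac i1
  have hsq : (√(2 * t))⁻¹ * √(2 * t) = 1 := inv_mul_cancel₀ (by positivity)
  have e3 : (√(2 * t))⁻¹ * ∫ q, ⟪ψ (X q) • w (X q), q.2⟫ ∂P
      = -∫ q, ⟪ψ (X q) • w (X q), mixScore b μ t (X q)⟫ ∂P := by
    rw [e2, neg_mul, mul_neg, ← mul_assoc, hsq, one_mul]
  have h6 : ∫ q, truncLog δ (relDens b μ V t (X q)) * ⟪g (X q), stepVel b t q⟫ ∂P
      ≤ c * -Real.log δ * (∫ x, ‖b x‖ ∂μ + (√(2 * t))⁻¹ * ∫ z, ‖z‖ ∂(stdGaussian (Vec n))) := by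
    calc _ ≤ ∫ q : Vec n × Vec n, c * -Real.log δ * (‖b q.1‖ + (√(2 * t))⁻¹ * ‖q.2‖) ∂P :=
          integral_mono i5 i6 fun q => (le_abs_self _).trans (hb5 q)
      _ = _ := by
        rw [integral_const_mul, integral_add hbP (hz.const_mul _), integral_const_mul, hP,
          integral_fun_fst (fun x => ‖b x‖), integral_fun_snd (fun z : Vec n => ‖z‖)]
        simp
  have h7 : -∫ q, ⟪ψ (X q) • w (X q), b q.1⟫ ∂P
      - ∫ q, ⟪ψ (X q) • w (X q), mixScore b μ t (X q)⟫ ∂P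
      ≤ -(3 / 4) * localFisher b μ V v χ δ t + driftGap b μ v t := by
    rw [← integral_neg, ← integral_sub i2n i3, localFisher, driftGap, ← integral_const_mul,
      ← integral_add (i4.const_mul _) hD]
    refine integral_mono (i2n.sub i3) ((i4.const_mul _).add hD) fun q => ?_
    have hs : mixScore b μ t (X q) = w (X q) - v (X q) := by simp [hw, relScore]
    have hq0 := hψ0 (X q)
    have hq1 := hψ1 (X q)
    -- Young's inequality from the square of `w / 2 - (v - b)`; it leaves `3/4` of the Fisher
    -- information. The weight `ψ ≤ 1` is then dropped from the gap.
    have hcs := norm_sub_sq_real ((1 / 2 : ℝ) • w (X q)) (v (X q) - b q.1)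
    have hin : ⟪w (X q), v (X q) - b q.1⟫ ≤ 1 / 4 * ‖w (X q)‖ ^ 2 + ‖v (X q) - b q.1‖ ^ 2 := by
      rw [norm_smul, inner_smul_left, mul_pow] at hcs
      norm_num at hcs
      nlinarith [sq_nonneg ‖(1 / 2 : ℝ) • w (X q) - (v (X q) - b q.1)‖]
    have := mul_le_mul_of_nonneg_left hin hq0
    have h8 : ψ (X q) * ‖v (X q) - b q.1‖ ^ 2 ≤ ‖v (X q) - b q.1‖ ^ 2 :=
      mul_le_of_le_one_left (by positivity) hq1
    rw [hs, inner_sub_right, real_inner_smul_left, real_inner_smul_left, real_inner_smul_left,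
      real_inner_self_eq_norm_sq]
    rw [inner_sub_right] at this
    change _ ≤ -(3 / 4) * (ψ (X q) * ‖w (X q)‖ ^ 2) + ‖v (X q) - b q.1‖ ^ 2
    nlinarith
  rw [e1, e3]
  linarith

end

section

variable {n : ℕ} {b : Vec n → Vec n}

/-! ### Continuity at time zero -/

/-- The action of one step on the density `f`. -/
def evolve (b : Vec n → Vec n) (f : Vec n → ℝ) (t : ℝ) (y : Vec n) : ℝ :=
  ∫ x, f x * heatKernel t (y - (x - t • b x))

lemma heatKernel_smul {t : ℝ} (ht : 0 < t) (w : Vec n) :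
    heatKernel t (√t • w) * √t ^ n = heatKernel 1 w := by
  unfold heatKernel
  have h1 : (4 * Real.pi * t) ^ ((n : ℝ) / 2) = (4 * Real.pi * 1) ^ ((n : ℝ) / 2) * √t ^ n := by
    rw [mul_one, Real.mul_rpow (by positivity) ht.le, Real.rpow_div_two_eq_sqrt _ ht.le,
      Real.rpow_natCast]
  have h2 : ‖√t • w‖ ^ 2 = t * ‖w‖ ^ 2 := by
    rw [norm_smul, mul_pow, Real.norm_eq_abs, sq_abs, Real.sq_sqrt ht.le]
  rw [h1, h2]
  have h3 : -(t * ‖w‖ ^ 2) / (4 * t) = -‖w‖ ^ 2 / (4 * 1) := by field_simp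
  rw [h3]
  have : √t ^ n ≠ 0 := by positivity
  field_simp

/-- The substitution `x = y + √t u` turns the concentrating kernel into a fixed Gaussian with the
vanishing shift `√t b`, so dominated convergence applies as `t → 0`. -/
lemma evolve_eq {t : ℝ} (ht : 0 < t) (f : Vec n → ℝ) (y : Vec n) :
    evolve b f t y
      = ∫ u, f (y + √t • u) * heatKernel 1 (-u + √t • b (y + √t • u)) := by
  have h1 := Measure.integral_comp_smul (μ := (volume : Measure (Vec n)))
    (fun x => f (y + x) * heatKernel t (y - ((y + x) - t • b (y + x)))) (√t)
  have h2 : 0 < √t ^ n := by positivity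
  rw [finrank_euclideanSpace, Fintype.card_fin, integral_add_left_eq_self
    (fun x => f x * heatKernel t (y - (x - t • b x))) y, abs_of_pos (by positivity)] at h1
  have h3 : evolve b f t y = √t ^ n * ((√t ^ n)⁻¹ • evolve b f t y) := by
    rw [smul_eq_mul]; field_simp
  rw [h3, evolve, ← h1, ← integral_const_mul]
  refine integral_congr_ae (ae_of_all _ fun u => ?_)
  have h4 : y - ((y + √t • u) - t • b (y + √t • u)) = √t • (-u + √t • b (y + √t • u)) := by
    rw [smul_add, smul_smul, Real.mul_self_sqrt ht.le, smul_neg]; abel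
  simp only []
  rw [h4, ← heatKernel_smul ht]
  ring

/-- From `‖u‖² ≤ 2 ‖-u + e‖² + 2 B²`: a bounded shift costs a constant and half of the Gaussian
exponent. -/
lemma heatKernel_one_le {B : ℝ} (u e : Vec n) (he : ‖e‖ ≤ B) :
    heatKernel 1 (-u + e) ≤ ((4 * Real.pi * 1) ^ ((n : ℝ) / 2))⁻¹ *
      (Real.exp (B ^ 2 / 4) * Real.exp (-(1 / 8) * ‖u‖ ^ 2)) := by
  unfold heatKernel
  rw [← Real.exp_add]
  gcongr
  have h1 : ‖u‖ ≤ ‖-u + e‖ + B := by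
    calc ‖u‖ = ‖e - (-u + e)‖ := by congr 1; abel
      _ ≤ ‖e‖ + ‖-u + e‖ := norm_sub_le _ _
      _ ≤ _ := by linarith
  have h2 : ‖u‖ ^ 2 ≤ (‖-u + e‖ + B) ^ 2 := by gcongr
  nlinarith [sq_nonneg (‖-u + e‖ - B)]

lemma integrable_gaussian_bound (C : ℝ) :
    Integrable (fun u : Vec n => C * Real.exp (-(1 / 8) * ‖u‖ ^ 2)) := by
  have h := GaussianFourier.integrable_cexp_neg_mul_sq_norm_add (V := Vec n) (b := (1 / 8 : ℝ))
    (by rw [Complex.ofReal_re]; norm_num) 0 0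
  refine (h.norm.congr (ae_of_all _ fun u => ?_)).const_mul C
  simp only []
  rw [Complex.norm_exp]
  congr 1
  simp [← Complex.ofReal_pow]

lemma integral_heatKernel_neg : ∫ u : Vec n, heatKernel 1 (-u) = 1 := by
  rw [integral_neg_eq_self (fun u : Vec n => heatKernel 1 u),
    integral_eq_lintegral_of_nonneg_ae (ae_of_all _ fun w => (heatKernel_pos one_pos w).le)
      continuous_heatKernel.aestronglyMeasurable, lintegral_heatKernel one_pos, ENNReal.toReal_one]

/-- A dominating function for the rescaled kernel. -/
lemma exists_evolve_bound (hb : Continuous b) {f : Vec n → ℝ} (hf : Continuous f)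
    (hfs : HasCompactSupport f) :
    ∃ C, ∀ t, t ≤ 1 → ∀ y u,
      ‖f (y + √t • u) * heatKernel 1 (-u + √t • b (y + √t • u))‖
        ≤ C * Real.exp (-(1 / 8) * ‖u‖ ^ 2) := by
  obtain ⟨Cf, hCf⟩ := hf.bounded_above_of_compact_support hfs
  obtain ⟨B, hB⟩ := hfs.isCompact.exists_bound_of_continuousOn hb.continuousOn
  have hCf0 : 0 ≤ Cf := (norm_nonneg _).trans (hCf 0)
  refine ⟨Cf * (((4 * Real.pi * 1) ^ ((n : ℝ) / 2))⁻¹ * Real.exp (B ^ 2 / 4)),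
    fun t ht y u => ?_⟩
  -- The drift may be unbounded, but it is evaluated only on the compact support of `f`; elsewhere
  -- the integrand vanishes.
  by_cases hx : y + √t • u ∈ tsupport f
  · rw [norm_mul, Real.norm_of_nonneg (heatKernel_pos one_pos _).le, mul_assoc, mul_assoc]
    refine mul_le_mul (hCf _) (heatKernel_one_le u _ ?_) (heatKernel_pos one_pos _).le hCf0
    rw [norm_smul, Real.norm_of_nonneg (Real.sqrt_nonneg _)]
    exact (mul_le_of_le_one_left (norm_nonneg _) (Real.sqrt_le_one.2 ht)).trans (hB _ hx)
  · rw [image_eq_zero_of_notMem_tsupport hx, zero_mul, norm_zero]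
    positivity

lemma tendsto_evolve (hb : Continuous b) {f : Vec n → ℝ} (hf : Continuous f)
    (hfs : HasCompactSupport f) (y : Vec n) :
    Tendsto (fun t => evolve b f t y) (𝓝[>] 0) (𝓝 (f y)) := by
  obtain ⟨C, hC⟩ := exists_evolve_bound hb hf hfs
  have hpos : ∀ᶠ t : ℝ in 𝓝[>] 0, 0 < t := self_mem_nhdsWithin
  have hle : ∀ᶠ t : ℝ in 𝓝[>] 0, t ≤ 1 :=
    mem_nhdsWithin_of_mem_nhds (Iic_mem_nhds one_pos)
  have hk : Continuous (heatKernel 1 : Vec n → ℝ) := continuous_heatKernel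
  have h : Tendsto (fun t : ℝ => ∫ u, f (y + √t • u) * heatKernel 1 (-u + √t • b (y + √t • u)))
      (𝓝[>] 0) (𝓝 (∫ u : Vec n, f y * heatKernel 1 (-u))) := by
    refine tendsto_integral_filter_of_dominated_convergence
      (fun u => C * Real.exp (-(1 / 8) * ‖u‖ ^ 2)) (Eventually.of_forall fun t => ?_)
      (hle.mono fun t ht => ae_of_all _ fun u => hC t ht y u) (integrable_gaussian_bound C)
      (ae_of_all _ fun u => ?_)
    · exact Continuous.aestronglyMeasurable (by fun_prop)
    · have : Continuous fun t : ℝ =>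
          f (y + √t • u) * heatKernel 1 (-u + √t • b (y + √t • u)) := by fun_prop
      have h0 := (this.tendsto 0).mono_left (nhdsWithin_le_nhds (s := Ioi 0))
      simpa using h0
  rw [integral_const_mul, integral_heatKernel_neg, mul_one] at h
  refine h.congr' (hpos.mono fun t ht => ?_)
  exact (evolve_eq ht f y).symm

lemma exists_norm_evolve_le (hb : Continuous b) {f : Vec n → ℝ} (hf : Continuous f)
    (hfs : HasCompactSupport f) : ∃ C, ∀ t, 0 < t → t ≤ 1 → ∀ y, ‖evolve b f t y‖ ≤ C := by
  obtain ⟨C, hC⟩ := exists_evolve_bound hb hf hfs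
  refine ⟨∫ u : Vec n, C * Real.exp (-(1 / 8) * ‖u‖ ^ 2), fun t ht ht1 y => ?_⟩
  rw [evolve_eq ht]
  exact norm_integral_le_of_norm_le (integrable_gaussian_bound C) (ae_of_all _ fun u => hC t ht1 y u)

lemma measurable_evolve (hb : Continuous b) {f : Vec n → ℝ} (hf : Measurable f) (t : ℝ) :
    Measurable (evolve b f t) := by
  have h : StronglyMeasurable fun p : Vec n × Vec n => f p.2 * heatKernel t (p.1 - (p.2 - t • b p.2)) := by
    have hk : Continuous fun p : Vec n × Vec n => heatKernel t (p.1 - (p.2 - t • b p.2)) :=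
      continuous_heatKernel.comp (by fun_prop)
    exact ((hf.comp measurable_snd).mul hk.measurable).stronglyMeasurable
  exact h.integral_prod_right'.measurable

/-- One step contracts `L¹`, by Tonelli: for each `x` the kernel has integral one in `y`. -/
lemma lintegral_enorm_evolve_le (hb : Continuous b) {f : Vec n → ℝ} (hf : Measurable f) {t : ℝ}
    (ht : 0 < t) : ∫⁻ y, ‖evolve b f t y‖ₑ ≤ ∫⁻ x, ‖f x‖ₑ := by
  have hk : Measurable fun p : Vec n × Vec n => heatKernel t (p.1 - (p.2 - t • b p.2)) :=
    (continuous_heatKernel.comp (by fun_prop)).measurable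
  calc ∫⁻ y, ‖evolve b f t y‖ₑ
      ≤ ∫⁻ y, ∫⁻ x, ‖f x‖ₑ * ENNReal.ofReal (heatKernel t (y - (x - t • b x))) := by
        refine lintegral_mono fun y => (enorm_integral_le_lintegral_enorm _).trans (le_of_eq ?_)
        refine lintegral_congr fun x => ?_
        rw [enorm_mul, Real.enorm_of_nonneg (heatKernel_pos ht _).le]
    _ = ∫⁻ x, ∫⁻ y, ‖f x‖ₑ * ENNReal.ofReal (heatKernel t (y - (x - t • b x))) :=
        lintegral_lintegral_swap (Measurable.aemeasurable
          (((hf.comp measurable_snd).enorm).mul hk.ennreal_ofReal))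
    _ = ∫⁻ x, ‖f x‖ₑ := by
        refine lintegral_congr fun x => ?_
        rw [lintegral_const_mul' _ _ enorm_ne_top,
          lintegral_sub_right_eq_self (fun w => ENNReal.ofReal (heatKernel t w)) (x - t • b x),
          lintegral_heatKernel ht, mul_one]

variable {V : Vec n → ℝ} {v : Vec n → Vec n} {L : ℝ} {χ : Vec n → ℝ} {g : Vec n → Vec n} {c δ : ℝ}

lemma integrable_mul_heatKernel (hb : Continuous b) {f : Vec n → ℝ} (hf : Integrable f) {t : ℝ}
    (ht : 0 < t) (y : Vec n) : Integrable (fun x => f x * heatKernel t (y - (x - t • b x))) := by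
  refine hf.mul_bdd (c := ((4 * Real.pi * t) ^ ((n : ℝ) / 2))⁻¹)
    (continuous_heatKernel.comp (by fun_prop)).aestronglyMeasurable (ae_of_all _ fun x => ?_)
  rw [Real.norm_of_nonneg (heatKernel_pos ht _).le]
  exact heatKernel_le ht _

/-- Convergence in `L¹`, localized by `χ`, of the evolved densities as the time tends to zero. -/
lemma tendsto_lintegral_evolve_sub (hb : Continuous b) (hχ : IsCutoff χ g c) {r : Vec n → ℝ}
    (hrm : Measurable r) (hr : Integrable r) :
    Tendsto (fun t => ∫⁻ y, ENNReal.ofReal (χ y) * ‖evolve b r t y - r y‖ₑ) (𝓝[>] 0) (𝓝 0) := by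
  rw [ENNReal.tendsto_nhds_zero]
  intro ε hε
  -- Three errors of size `ε'`: the evolved difference `r - f` (by contraction), the convergence for
  -- the continuous compactly supported `f`, and `r - f` itself.
  obtain ⟨ε', hε'0, hε'⟩ : ∃ ε' : ℝ≥0, 0 < ε' ∧ 3 * (ε' : ℝ≥0∞) ≤ ε := by
    rcases eq_or_ne ε ⊤ with rfl | h
    · exact ⟨1, one_pos, le_top⟩
    · lift ε to ℝ≥0 using h
      refine ⟨ε / 3, by have : 0 < ε := by exact_mod_cast hε
                        positivity, ?_⟩
      norm_cast
      rw [mul_div_cancel₀ _ (by norm_num)]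
  obtain ⟨f, hfs, hfr, hfc, hfi⟩ := hr.exists_hasCompactSupport_lintegral_sub_le
    (ε := ε') (by exact_mod_cast hε'0.ne')
  have hχc := hχ.continuous
  obtain ⟨C, hC⟩ := exists_norm_evolve_le hb hfc hfs
  obtain ⟨C', hC'⟩ := hfc.bounded_above_of_compact_support hfs
  have hpos : ∀ᶠ t : ℝ in 𝓝[>] 0, 0 < t := self_mem_nhdsWithin
  have hle : ∀ᶠ t : ℝ in 𝓝[>] 0, t ≤ 1 := mem_nhdsWithin_of_mem_nhds (Iic_mem_nhds one_pos)
  have hlim : Tendsto (fun t => ∫⁻ y, ENNReal.ofReal (χ y) * ‖evolve b f t y - f y‖ₑ)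
      (𝓝[>] 0) (𝓝 0) := by
    have h := tendsto_lintegral_filter_of_dominated_convergence (μ := (volume : Measure (Vec n)))
      (l := 𝓝[>] (0 : ℝ)) (F := fun t y => ENNReal.ofReal (χ y) * ‖evolve b f t y - f y‖ₑ)
      (f := fun _ => 0) (fun y => ENNReal.ofReal (χ y * (C + C')))
      (Eventually.of_forall fun t => by
        have := measurable_evolve hb hfc.measurable t
        have := hfc.measurable
        have := hχc.measurable
        fun_prop) ?_ ?_ (ae_of_all _ fun y => ?_)
    · simpa using h
    · filter_upwards [hpos, hle] with t ht ht1
      refine ae_of_all _ fun y => ?_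
      rw [ENNReal.ofReal_mul (hχ.nonneg y)]
      gcongr
      rw [← ofReal_norm]
      exact ENNReal.ofReal_le_ofReal ((norm_sub_le _ _).trans (add_le_add (hC t ht ht1 y) (hC' y)))
    -- The cutoff makes a constant bound integrable.
    · have hi : Integrable fun y => χ y * (C + C') :=
        (hχc.integrable_of_hasCompactSupport hχ.supp).mul_const _
      exact (hi.lintegral_lt_top).ne
    · have h1 := ((tendsto_evolve hb hfc hfs y).sub_const (f y)).enorm
      simp only [sub_self, enorm_zero] at h1
      simpa using ENNReal.Tendsto.const_mul h1 (Or.inr ENNReal.ofReal_ne_top)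
  have hev := (ENNReal.tendsto_nhds_zero.1 hlim) ε' (by exact_mod_cast hε'0)
  filter_upwards [hpos, hev] with t ht he
  have hsub : ∀ y, evolve b (fun x => r x - f x) t y = evolve b r t y - evolve b f t y := by
    intro y
    simp only [evolve, sub_mul]
    exact integral_sub (integrable_mul_heatKernel hb hr ht y) (integrable_mul_heatKernel hb hfi ht y)
  calc ∫⁻ y, ENNReal.ofReal (χ y) * ‖evolve b r t y - r y‖ₑ
      ≤ ∫⁻ y, (‖evolve b (fun x => r x - f x) t y‖ₑ
          + (ENNReal.ofReal (χ y) * ‖evolve b f t y - f y‖ₑ + ‖r y - f y‖ₑ)) := by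
        refine lintegral_mono fun y => ?_
        have e1 : evolve b r t y - r y = evolve b (fun x => r x - f x) t y
            + ((evolve b f t y - f y) + -(r y - f y)) := by rw [hsub]; ring
        have h1 : ENNReal.ofReal (χ y) ≤ 1 := ENNReal.ofReal_le_one.2 (hχ.le_one y)
        rw [e1]
        calc _ ≤ ENNReal.ofReal (χ y) * (‖evolve b (fun x => r x - f x) t y‖ₑ
              + (‖evolve b f t y - f y‖ₑ + ‖r y - f y‖ₑ)) := by
              gcongr
              refine (enorm_add_le _ _).trans ?_
              gcongr
              refine (enorm_add_le _ _).trans ?_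
              rw [enorm_neg]
          _ ≤ _ := by
              rw [mul_add, mul_add]
              gcongr
              · exact mul_le_of_le_one_left' h1
              · exact mul_le_of_le_one_left' h1
    _ = (∫⁻ y, ‖evolve b (fun x => r x - f x) t y‖ₑ)
          + ((∫⁻ y, ENNReal.ofReal (χ y) * ‖evolve b f t y - f y‖ₑ) + ∫⁻ y, ‖r y - f y‖ₑ) := by
        have h1 := measurable_evolve hb (hrm.sub hfc.measurable) t
        have h2 := measurable_evolve hb hfc.measurable t
        have h3 := hfc.measurable
        have h4 := hχc.measurable
        rw [lintegral_add_left, lintegral_add_left]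
        · fun_prop
        · exact h1.enorm
    _ ≤ ε' + (ε' + ε') := by
        gcongr
        exact (lintegral_enorm_evolve_le hb (hrm.sub hfc.measurable) ht).trans hfr
    _ = 3 * (ε' : ℝ≥0∞) := by ring
    _ ≤ ε := hε'

variable {μ : Measure (Vec n)} [IsProbabilityMeasure μ]

omit [IsProbabilityMeasure μ] in
lemma mixDens_eq_evolve {r : Vec n → ℝ} (hrm : Measurable r) (hr0 : ∀ y, 0 ≤ r y)
    (hμ : μ = volume.withDensity (fun y => ENNReal.ofReal (r y))) (t : ℝ) :
    mixDens b μ t = evolve b r t := by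
  ext y
  rw [mixDens, hμ, integral_withDensity_eq_integral_toReal_smul hrm.ennreal_ofReal (by simp)]
  simp_rw [ENNReal.toReal_ofReal (hr0 _), smul_eq_mul]
  rfl

lemma integrable_of_withDensity {r : Vec n → ℝ} (hrm : Measurable r) (hr0 : ∀ y, 0 ≤ r y)
    (hμ : μ = volume.withDensity (fun y => ENNReal.ofReal (r y))) : Integrable r := by
  refine ⟨hrm.aestronglyMeasurable, ?_⟩
  rw [hasFiniteIntegral_iff_ofReal (ae_of_all _ hr0)]
  have : μ univ = 1 := measure_univ
  rw [hμ, withDensity_apply _ MeasurableSet.univ, Measure.restrict_univ] at this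
  simp [this]

/-- The truncated entropy is Lipschitz with constant `-log δ` and vanishes at `1`, hence grows at
most linearly. After multiplication by `exp (-V)` it is dominated by a multiple of `r + χ exp (-V)`.
-/
lemma integrable_localEnt_of_density (hV : IsPotential V v L) (hχ : IsCutoff χ g c) (hδ : 0 < δ)
    (hδ1 : δ < 1) {r : Vec n → ℝ} (hrm : Measurable r) (hr0 : ∀ y, 0 ≤ r y) (hr : Integrable r) :
    Integrable fun y => χ y * truncEnt δ (r y * Real.exp (V y)) * Real.exp (-V y) := by
  have hVc := hV.continuous
  have hχc := hχ.continuous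
  have hm : Measurable fun y => truncEnt δ (r y * Real.exp (V y)) := by
    unfold truncEnt; fun_prop
  have h1 : Integrable fun y => -Real.log δ * (r y + χ y * Real.exp (-V y)) :=
    (hr.add (Continuous.integrable_of_hasCompactSupport (by fun_prop) hχ.supp.mul_right)).const_mul _
  refine h1.mono' (Measurable.aestronglyMeasurable (by fun_prop)) (ae_of_all _ fun y => ?_)
  have hh : 0 ≤ r y * Real.exp (V y) := mul_nonneg (hr0 y) (Real.exp_pos _).le
  have h2 := abs_truncEnt_sub_le hδ hδ1 hh zero_le_one
  rw [truncEnt_one, sub_zero] at h2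
  have h3 : |r y * Real.exp (V y) - 1| ≤ r y * Real.exp (V y) + 1 := by
    rw [abs_le]; constructor <;> linarith
  have h4 : 0 ≤ -Real.log δ := by linarith [Real.log_neg hδ hδ1]
  have h5 : Real.exp (V y) * Real.exp (-V y) = 1 := by rw [← Real.exp_add]; simp
  rw [norm_mul, norm_mul, Real.norm_of_nonneg (hχ.nonneg y), Real.norm_of_nonneg (Real.exp_pos _).le,
    Real.norm_eq_abs]
  have h6 : |truncEnt δ (r y * Real.exp (V y))| ≤ -Real.log δ * (r y * Real.exp (V y) + 1) :=
    h2.trans (mul_le_mul_of_nonneg_left h3 h4)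
  calc _ ≤ χ y * (-Real.log δ * (r y * Real.exp (V y) + 1)) * Real.exp (-V y) := by
        have := hχ.nonneg y
        gcongr
    _ = -Real.log δ * (χ y * r y * (Real.exp (V y) * Real.exp (-V y)) + χ y * Real.exp (-V y)) := by
        ring
    _ ≤ _ := by
        rw [h5, mul_one]
        have := mul_le_of_le_one_left (hr0 y) (hχ.le_one y)
        gcongr

/-- The localized entropy is continuous at time zero. -/
lemma tendsto_localEnt (hb : Continuous b) (hV : IsPotential V v L) (hχ : IsCutoff χ g c)
    (hδ : 0 < δ) (hδ1 : δ < 1) {r : Vec n → ℝ} (hrm : Measurable r) (hr0 : ∀ y, 0 ≤ r y)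
    (hμ : μ = volume.withDensity (fun y => ENNReal.ofReal (r y))) :
    Tendsto (fun t => localEnt χ V δ (mixDens b μ t)) (𝓝[>] 0) (𝓝 (localEnt χ V δ r)) := by
  have hr := integrable_of_withDensity hrm hr0 hμ
  have hpos : ∀ᶠ t : ℝ in 𝓝[>] 0, 0 < t := self_mem_nhdsWithin
  have h0 := ENNReal.Tendsto.const_mul (a := ENNReal.ofReal (-Real.log δ))
    (tendsto_lintegral_evolve_sub hb hχ hrm hr) (Or.inr ENNReal.ofReal_ne_top)
  rw [mul_zero] at h0
  rw [tendsto_iff_edist_tendsto_0]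
  refine tendsto_of_tendsto_of_tendsto_of_le_of_le' tendsto_const_nhds h0
    (Eventually.of_forall fun _ => zero_le) (hpos.mono fun t ht => ?_)
  rw [edist_eq_enorm_sub, localEnt, localEnt, ← integral_sub
    (integrable_localEnt_integrand hb hV hχ hδ ht)
    (integrable_localEnt_of_density hV hχ hδ hδ1 hrm hr0 hr)]
  refine (enorm_integral_le_lintegral_enorm _).trans ?_
  rw [← lintegral_const_mul' _ _ ENNReal.ofReal_ne_top]
  refine lintegral_mono fun y => ?_
  have h4 : 0 ≤ -Real.log δ := by linarith [Real.log_neg hδ hδ1]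
  have hd := (mixDens_pos (μ := μ) hb ht y).le
  rw [← mixDens_eq_evolve (b := b) hrm hr0 hμ, ← ofReal_norm, ← ofReal_norm,
    ← ENNReal.ofReal_mul (hχ.nonneg y), ← ENNReal.ofReal_mul h4]
  refine ENNReal.ofReal_le_ofReal ?_
  -- The Lipschitz bound turns the difference of entropies into a localized `L¹` distance of
  -- densities, since the weights `exp (±V)` cancel.
  have h2 := abs_truncEnt_sub_le hδ hδ1 (mul_nonneg hd (Real.exp_pos (V y)).le)
    (mul_nonneg (hr0 y) (Real.exp_pos (V y)).le)
  have h5 : Real.exp (V y) * Real.exp (-V y) = 1 := by rw [← Real.exp_add]; simp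
  rw [← sub_mul, ← mul_sub, norm_mul, norm_mul, Real.norm_of_nonneg (hχ.nonneg y),
    Real.norm_of_nonneg (Real.exp_pos _).le, Real.norm_eq_abs, Real.norm_eq_abs]
  rw [← sub_mul, abs_mul, abs_of_pos (Real.exp_pos (V y))] at h2
  calc _ ≤ χ y * (-Real.log δ * (|mixDens b μ t y - r y| * Real.exp (V y))) * Real.exp (-V y) := by
        have := hχ.nonneg y
        gcongr
    _ = -Real.log δ * (χ y * |mixDens b μ t y - r y|) * (Real.exp (V y) * Real.exp (-V y)) := by ring
    _ = _ := by rw [h5, mul_one]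

end

section

/-! ### Integration in time -/

/-- The fundamental theorem of calculus in `ℝ≥0∞`. The rate is split into its positive and negative
parts, so no subtraction occurs and neither `A` nor `U` need be finite or measurable. -/
lemma ofReal_add_lintegral_le {K f : ℝ → ℝ} {A U : ℝ → ℝ≥0∞} {a d : ℝ} (had : a ≤ d)
    (hK : ∀ t ∈ Icc a d, HasDerivAt K (f t) t) (hf : ContinuousOn f (Icc a d)) (ha : 0 ≤ K a)
    (hd : 0 ≤ K d)
    (h : ∀ t ∈ Ioc a d, A t + ENNReal.ofReal (f t) ≤ U t + ENNReal.ofReal (-f t)) :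
    ENNReal.ofReal (K d) + ∫⁻ t in Ioc a d, A t
      ≤ ENNReal.ofReal (K a) + ∫⁻ t in Ioc a d, U t := by
  have hfm : AEMeasurable f (volume.restrict (Ioc a d)) :=
    (hf.mono Ioc_subset_Icc_self).aemeasurable measurableSet_Ioc
  have hfi : IntegrableOn f (Ioc a d) :=
    (hf.integrableOn_compact isCompact_Icc).mono_set Ioc_subset_Icc_self
  have h1 := lintegral_mono_ae ((ae_restrict_mem (μ := volume) measurableSet_Ioc).mono h)
  rw [lintegral_add_right' _ hfm.ennreal_ofReal, lintegral_add_right' U (g := fun t => ENNReal.ofReal (-f t)) hfm.neg.ennreal_ofReal] at h1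
  have hp : ∫⁻ t in Ioc a d, ENNReal.ofReal (f t) ≠ ∞ := hfi.lintegral_lt_top.ne
  have hq : ∫⁻ t in Ioc a d, ENNReal.ofReal (-f t) ≠ ∞ := hfi.neg.lintegral_lt_top.ne
  have h2 : ∫ t in a..d, f t = K d - K a := by
    refine intervalIntegral.integral_eq_sub_of_hasDerivAt (fun t ht => ?_) ?_
    · rw [uIcc_of_le had] at ht; exact hK t ht
    · exact (intervalIntegrable_iff_integrableOn_Ioc_of_le had).2 hfi
  rw [intervalIntegral.integral_of_le had, integral_eq_lintegral_pos_part_sub_lintegral_neg_part hfi]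
    at h2
  have h3 : ENNReal.ofReal (K d) + ∫⁻ t in Ioc a d, ENNReal.ofReal (-f t)
      = ENNReal.ofReal (K a) + ∫⁻ t in Ioc a d, ENNReal.ofReal (f t) := by
    rw [← ENNReal.toReal_eq_toReal_iff' (by simp [hq]) (by simp [hp]),
      ENNReal.toReal_add (by simp) hq, ENNReal.toReal_add (by simp) hp, ENNReal.toReal_ofReal ha,
      ENNReal.toReal_ofReal hd]
    linarith
  -- The finite integral of the positive part is added on both sides and cancelled at the end.
  refine (ENNReal.add_le_add_iff_right hp).1 ?_
  calc _ = ENNReal.ofReal (K d) + ((∫⁻ t in Ioc a d, A t) + ∫⁻ t in Ioc a d, ENNReal.ofReal (f t)) := by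
        rw [add_assoc]
    _ ≤ ENNReal.ofReal (K d) + ((∫⁻ t in Ioc a d, U t) + ∫⁻ t in Ioc a d, ENNReal.ofReal (-f t)) := by
        gcongr
    _ = (ENNReal.ofReal (K d) + ∫⁻ t in Ioc a d, ENNReal.ofReal (-f t)) + ∫⁻ t in Ioc a d, U t := by
        ring
    _ = _ := by rw [h3]; ring

lemma lintegral_Ioc_le_of_forall {A : ℝ → ℝ≥0∞} {T : ℝ} {C : ℝ≥0∞}
    (h : ∀ k : ℕ, ∫⁻ t in Ioc (1 / ((k : ℝ) + 1)) T, A t ≤ C) : ∫⁻ t in Ioc 0 T, A t ≤ C := by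
  have hU : Ioc (0 : ℝ) T = ⋃ k : ℕ, Ioc (1 / ((k : ℝ) + 1)) T := by
    ext t
    simp only [mem_iUnion, mem_Ioc]
    constructor
    · rintro ⟨h0, hT⟩
      obtain ⟨k, hk⟩ := exists_nat_one_div_lt h0
      exact ⟨k, hk, hT⟩
    · rintro ⟨k, hk, hT⟩
      exact ⟨lt_trans (by positivity) hk, hT⟩
  have hm : Monotone fun k : ℕ => Ioc (1 / ((k : ℝ) + 1)) T := by
    intro k l hkl
    refine Ioc_subset_Ioc_left ?_
    have : (k : ℝ) ≤ l := by exact_mod_cast hkl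
    gcongr
  rw [hU, setLIntegral_iUnion_of_directed _ hm.directed_le]
  exact iSup_le h

variable {n : ℕ} {b : Vec n → Vec n} {μ : Measure (Vec n)} [IsProbabilityMeasure μ]
  {V : Vec n → ℝ} {v : Vec n → Vec n} {L : ℝ} {χ : Vec n → ℝ} {g : Vec n → Vec n} {c δ : ℝ}

/-- The mean speed of the noise blows up like `t^(-1/2)`, which is integrable at zero; hence the
cutoff error over a whole step is finite. -/
lemma lintegral_velocity_bound_ne_top (A B T : ℝ) :
    ∫⁻ t in Ioc 0 T, ENNReal.ofReal (A + (√(2 * t))⁻¹ * B) ≠ ∞ := by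
  have h1 : IntegrableOn (fun t : ℝ => t ^ (-(1 / 2) : ℝ)) (Ioc 0 T) := by
    rcases le_total 0 T with h | h
    · exact (intervalIntegrable_iff_integrableOn_Ioc_of_le h).1
        (intervalIntegral.intervalIntegrable_rpow' (by norm_num))
    · simp [Ioc_eq_empty_of_le h]
  have h2 : IntegrableOn (fun t : ℝ => A + (√(2 * t))⁻¹ * B) (Ioc 0 T) := by
    refine Integrable.add (integrableOn_const (by simp)) ?_
    refine (h1.const_mul ((√2)⁻¹ * B)).congr ?_
    filter_upwards [ae_restrict_mem measurableSet_Ioc] with t ht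
    rw [Real.rpow_neg ht.1.le, ← Real.sqrt_eq_rpow, Real.sqrt_mul (by norm_num), mul_inv]
    ring
  exact h2.lintegral_lt_top.ne

/-- The entropy dissipation inequality for the localized and truncated relative entropy. -/
lemma localEnt_dissipation (hb : Continuous b) (hbi : Integrable (fun x => ‖b x‖) μ)
    (hV : IsPotential V v L) (hχ : IsCutoff χ g c) (hδ : 0 < δ) (hδ1 : δ < 1)
    (hD : ∀ t, 0 < t →
      Integrable (fun q => ‖v (step b t q) - b q.1‖ ^ 2) (μ.prod (stdGaussian (Vec n))))
    {r : Vec n → ℝ} (hrm : Measurable r) (hr0 : ∀ y, 0 ≤ r y)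
    (hμ : μ = volume.withDensity (fun y => ENNReal.ofReal (r y))) {T : ℝ} (hT : 0 < T) :
    ENNReal.ofReal (localEnt χ V δ (mixDens b μ T))
        + ∫⁻ t in Ioc 0 T, ENNReal.ofReal (3 / 4 * localFisher b μ V v χ δ t)
      ≤ ENNReal.ofReal (localEnt χ V δ r) + ((∫⁻ t in Ioc 0 T, ENNReal.ofReal (driftGap b μ v t))
        + ENNReal.ofReal (c * -Real.log δ) * ∫⁻ t in Ioc 0 T, ENNReal.ofReal
          (∫ x, ‖b x‖ ∂μ + (√(2 * t))⁻¹ * ∫ z, ‖z‖ ∂(stdGaussian (Vec n)))) := by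
  set R : ℝ → ℝ := fun t => ∫ x, ‖b x‖ ∂μ + (√(2 * t))⁻¹ * ∫ z, ‖z‖ ∂(stdGaussian (Vec n)) with hR
  have hRm : Measurable R := by fun_prop
  set U : ℝ → ℝ≥0∞ := fun t => ENNReal.ofReal (driftGap b μ v t)
    + ENNReal.ofReal (c * -Real.log δ) * ENNReal.ofReal (R t) with hU
  have hcM : 0 ≤ c * -Real.log δ := mul_nonneg ((norm_nonneg _).trans (hχ.bound 0))
    (by linarith [Real.log_neg hδ hδ1])
  have hK0 : ∀ t, 0 < t → 0 ≤ localEnt χ V δ (mixDens b μ t) := fun t ht =>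
    localEnt_nonneg hχ hδ hδ1 fun y => (mixDens_pos hb ht y).le
  have hUint : ∀ a, ∫⁻ t in Ioc a T, U t = (∫⁻ t in Ioc a T, ENNReal.ofReal (driftGap b μ v t))
        + ENNReal.ofReal (c * -Real.log δ) * ∫⁻ t in Ioc a T, ENNReal.ofReal (R t) := by
    intro a
    rw [hU, lintegral_add_right _ (by fun_prop), lintegral_const_mul' _ _ ENNReal.ofReal_ne_top]
  rw [← hUint 0]
  set A : ℝ → ℝ≥0∞ := fun t => ENNReal.ofReal (3 / 4 * localFisher b μ V v χ δ t) with hA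
  have key : ∀ a, 0 < a → a ≤ T → ENNReal.ofReal (localEnt χ V δ (mixDens b μ T))
      + ∫⁻ t in Ioc a T, A t
      ≤ ENNReal.ofReal (localEnt χ V δ (mixDens b μ a)) + ∫⁻ t in Ioc 0 T, U t := by
    intro a ha haT
    refine (ofReal_add_lintegral_le (K := fun t => localEnt χ V δ (mixDens b μ t))
      (f := entRate b μ V v χ g δ) (U := U) haT
      (fun t ht => hasDerivAt_localEnt hb hbi hV hχ hδ hδ1 (ha.trans_le ht.1))
      ((continuousOn_entRate hb hbi hV hχ hδ).mono fun t ht => ha.trans_le ht.1)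
      (hK0 a ha) (hK0 T hT) fun t ht => ?_).trans ?_
    · have ht0 : 0 < t := ha.trans ht.1
      have h1 := entRate_le hb hbi hV hχ hδ hδ1 ht0 (hD t ht0)
      have hF0 : 0 ≤ localFisher b μ V v χ δ t := integral_nonneg fun q =>
        mul_nonneg (mul_nonneg (hχ.nonneg _)
          (truncWeight_nonneg hδ hδ1 (relDens_pos hb ht0 _).le)) (by positivity)
      have hG0 : 0 ≤ driftGap b μ v t := integral_nonneg fun q => by positivity
      have hR0 : 0 ≤ R t := by positivity
      simp only [hA, hU]
      rw [← ENNReal.ofReal_mul hcM, ← ENNReal.ofReal_add hG0 (by positivity)]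
      change entRate b μ V v χ g δ t ≤ _ + _ + c * -Real.log δ * R t at h1
      -- Exactly one of the positive and negative parts of the rate survives, according to its sign.
      rcases le_total 0 (entRate b μ V v χ g δ t) with h | h
      · rw [← ENNReal.ofReal_add (by positivity) h]
        refine (ENNReal.ofReal_le_ofReal ?_).trans le_self_add
        linarith
      · rw [ENNReal.ofReal_of_nonpos h, add_zero, ← ENNReal.ofReal_add (by positivity) (by linarith)]
        exact ENNReal.ofReal_le_ofReal (by linarith)
    · gcongr
  have hlim := tendsto_localEnt (b := b) hb hV hχ hδ hδ1 hrm hr0 hμ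
  have hlim2 := (ENNReal.tendsto_ofReal hlim).add_const (∫⁻ t in Ioc 0 T, U t)
  -- With the lower end `1 / (k + 1)` of the Fisher integral fixed, the starting time `a` of the
  -- dissipation tends to zero. Letting `k` grow afterwards exhausts `(0, T]`.
  have main : ∀ k : ℕ, ENNReal.ofReal (localEnt χ V δ (mixDens b μ T))
      + ∫⁻ t in Ioc (1 / ((k : ℝ) + 1)) T, A t
      ≤ ENNReal.ofReal (localEnt χ V δ r) + ∫⁻ t in Ioc 0 T, U t := by
    intro k
    refine ge_of_tendsto hlim2 ?_
    have h1 : ∀ᶠ a : ℝ in 𝓝[>] 0, 0 < a := self_mem_nhdsWithin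
    have h2 : ∀ᶠ a : ℝ in 𝓝[>] 0, a ≤ min T (1 / ((k : ℝ) + 1)) :=
      mem_nhdsWithin_of_mem_nhds (Iic_mem_nhds (lt_min hT (by positivity)))
    filter_upwards [h1, h2] with a ha ha2
    refine le_trans ?_ (key a ha (ha2.trans (min_le_left _ _)))
    gcongr
    exact ha2.trans (min_le_right _ _)
  rcases eq_or_ne (ENNReal.ofReal (localEnt χ V δ r) + ∫⁻ t in Ioc 0 T, U t) ∞ with h | h
  · rw [h]; exact le_top
  · have h3 : ∫⁻ t in Ioc 0 T, A t ≤ (ENNReal.ofReal (localEnt χ V δ r) + ∫⁻ t in Ioc 0 T, U t)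
        - ENNReal.ofReal (localEnt χ V δ (mixDens b μ T)) :=
      lintegral_Ioc_le_of_forall fun k => ENNReal.le_sub_of_add_le_left ENNReal.ofReal_ne_top (main k)
    have h4 : ENNReal.ofReal (localEnt χ V δ (mixDens b μ T))
        ≤ ENNReal.ofReal (localEnt χ V δ r) + ∫⁻ t in Ioc 0 T, U t := le_self_add.trans (main 0)
    calc _ ≤ ENNReal.ofReal (localEnt χ V δ (mixDens b μ T))
          + ((ENNReal.ofReal (localEnt χ V δ r) + ∫⁻ t in Ioc 0 T, U t)
            - ENNReal.ofReal (localEnt χ V δ (mixDens b μ T))) := by gcongr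
      _ = _ := add_tsub_cancel_of_le h4

end

section

/-! ### Moment bounds -/

variable {n : ℕ} {b : Vec n → Vec n} {μ : Measure (Vec n)} [IsProbabilityMeasure μ]
  {V : Vec n → ℝ} {v : Vec n → Vec n} {L e : ℝ}

lemma integrable_norm_of_sq (hb : Continuous b) (hb2 : Integrable (fun x => ‖b x‖ ^ 2) μ) :
    Integrable (fun x => ‖b x‖) μ := by
  refine ((integrable_const (1 : ℝ)).add hb2).mono' (by fun_prop) (ae_of_all _ fun x => ?_)
  rw [norm_norm]
  simp only [Pi.add_apply]
  nlinarith [sq_nonneg (‖b x‖ - 1)]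

lemma integrable_inner_of_sq {α : Type*} {m : MeasurableSpace α} {P : Measure α}
    {f h : α → Vec n} (hf : AEStronglyMeasurable f P) (hh : AEStronglyMeasurable h P)
    (hf2 : Integrable (fun x => ‖f x‖ ^ 2) P) (hh2 : Integrable (fun x => ‖h x‖ ^ 2) P) :
    Integrable (fun x => ⟪f x, h x⟫) P := by
  refine (hf2.add hh2).mono' (hf.inner hh) (ae_of_all _ fun x => ?_)
  refine (norm_inner_le_norm _ _).trans ?_
  simp only [Pi.add_apply]
  nlinarith [sq_nonneg (‖f x‖ - ‖h x‖), sq_nonneg (‖f x‖), sq_nonneg ‖h x‖]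

omit [IsProbabilityMeasure μ] in
lemma integrable_sq_fst (hb2 : Integrable (fun x => ‖b x‖ ^ 2) μ) :
    Integrable (fun q : Vec n × Vec n => ‖b q.1‖ ^ 2) (μ.prod (stdGaussian (Vec n))) :=
  hb2.comp_fst _

variable (μ) in
lemma integrable_sq_snd :
    Integrable (fun q : Vec n × Vec n => ‖q.2‖ ^ 2) (μ.prod (stdGaussian (Vec n))) :=
  integrable_norm_sq_stdGaussian.comp_snd μ

/-- The noise is centred and independent of the start. No integrability is required, since the
integral of a nonintegrable function is zero by convention. -/
lemma integral_inner_fst_snd {f : Vec n → Vec n} :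
    ∫ q : Vec n × Vec n, ⟪f q.1, q.2⟫ ∂(μ.prod (stdGaussian (Vec n))) = 0 := by
  by_cases hi : Integrable (fun q : Vec n × Vec n => ⟪f q.1, q.2⟫) (μ.prod (stdGaussian (Vec n)))
  · rw [integral_prod _ hi]
    refine integral_eq_zero_of_ae (ae_of_all _ fun x => ?_)
    simp only [Pi.zero_apply]
    rw [integral_inner (f := fun z : Vec n => z) IsGaussian.integrable_id (f x),
      integral_id_stdGaussian, inner_zero_right]
  · exact integral_undef hi

lemma integral_sq_snd :
    ∫ q : Vec n × Vec n, ‖q.2‖ ^ 2 ∂(μ.prod (stdGaussian (Vec n))) = n := by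
  rw [integral_fun_snd (fun z : Vec n => ‖z‖ ^ 2), integral_norm_sq_stdGaussian]
  simp

lemma norm_step_sub_sq {t : ℝ} (ht : 0 ≤ t) (q : Vec n × Vec n) :
    ‖step b t q - q.1‖ ^ 2
      = t ^ 2 * ‖b q.1‖ ^ 2 - 2 * t * √(2 * t) * ⟪b q.1, q.2⟫ + 2 * t * ‖q.2‖ ^ 2 := by
  have h : step b t q - q.1 = √(2 * t) • q.2 - t • b q.1 := by unfold step; abel
  rw [h, norm_sub_sq_real, norm_smul, norm_smul, mul_pow, mul_pow, real_inner_smul_left,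
    real_inner_smul_right, real_inner_comm, Real.norm_eq_abs, Real.norm_eq_abs, sq_abs, sq_abs,
    Real.sq_sqrt (by positivity)]
  ring

lemma integrable_step_sub_sq (hb : Continuous b) (hb2 : Integrable (fun x => ‖b x‖ ^ 2) μ) {t : ℝ}
    (ht : 0 ≤ t) :
    Integrable (fun q => ‖step b t q - q.1‖ ^ 2) (μ.prod (stdGaussian (Vec n))) := by
  simp_rw [norm_step_sub_sq ht]
  exact (((integrable_sq_fst hb2).const_mul _).sub
    ((integrable_inner_of_sq (by fun_prop) (by fun_prop) (integrable_sq_fst hb2)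
      (integrable_sq_snd μ)).const_mul _)).add ((integrable_sq_snd μ).const_mul _)

lemma integral_step_sub_sq (hb : Continuous b) (hb2 : Integrable (fun x => ‖b x‖ ^ 2) μ) {t : ℝ}
    (ht : 0 ≤ t) :
    ∫ q, ‖step b t q - q.1‖ ^ 2 ∂(μ.prod (stdGaussian (Vec n)))
      = t ^ 2 * ∫ q : Vec n × Vec n, ‖b q.1‖ ^ 2 ∂(μ.prod (stdGaussian (Vec n))) + 2 * t * n := by
  simp_rw [norm_step_sub_sq ht]
  have i1 := (integrable_sq_fst hb2).const_mul (t ^ 2)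
  have i2 := (integrable_inner_of_sq (P := μ.prod (stdGaussian (Vec n))) (f := fun q => b q.1)
    (h := fun q => q.2) (by fun_prop) (by fun_prop) (integrable_sq_fst hb2)
      (integrable_sq_snd μ)).const_mul (2 * t * √(2 * t))
  rw [integral_add (by exact i1.sub i2) ((integrable_sq_snd μ).const_mul _), integral_sub i1 i2,
    integral_const_mul, integral_const_mul, integral_const_mul, integral_inner_fst_snd,
    integral_sq_snd]
  ring

/-- Split `v(x_t) - b(x)` into `v(x_t) - v(x)`, bounded by the Lipschitz constant, and `v(x) -
b(x)`, bounded by `e`. -/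
lemma norm_gap_le (hV : IsPotential V v L) (he : ∀ x, ‖b x - v x‖ ≤ e) (t : ℝ)
    (q : Vec n × Vec n) :
    ‖v (step b t q) - b q.1‖ ^ 2 ≤ 2 * e ^ 2 + 2 * L ^ 2 * ‖step b t q - q.1‖ ^ 2 := by
  have h1 : ‖v (step b t q) - b q.1‖ ≤ L * ‖step b t q - q.1‖ + e := by
    have : v (step b t q) - b q.1 = (v (step b t q) - v q.1) - (b q.1 - v q.1) := by abel
    rw [this]
    exact (norm_sub_le _ _).trans (add_le_add (hV.lip _ _) (he _))
  have h2 : ‖v (step b t q) - b q.1‖ ^ 2 ≤ (L * ‖step b t q - q.1‖ + e) ^ 2 := by gcongr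
  nlinarith [sq_nonneg (L * ‖step b t q - q.1‖ - e)]

lemma integrable_gap (hb : Continuous b) (hb2 : Integrable (fun x => ‖b x‖ ^ 2) μ)
    (hV : IsPotential V v L) (he : ∀ x, ‖b x - v x‖ ≤ e) {t : ℝ} (ht : 0 ≤ t) :
    Integrable (fun q => ‖v (step b t q) - b q.1‖ ^ 2) (μ.prod (stdGaussian (Vec n))) := by
  have h1 := hV.continuous_grad
  have h2 := continuous_step hb t
  refine ((integrable_const (2 * e ^ 2)).add ((integrable_step_sub_sq hb hb2 ht).const_mul
    (2 * L ^ 2))).mono' (Continuous.aestronglyMeasurable (by fun_prop)) (ae_of_all _ fun q => ?_)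
  rw [Real.norm_of_nonneg (by positivity)]
  exact norm_gap_le hV he t q

lemma integrable_grad_sq (hb : Continuous b) (hb2 : Integrable (fun x => ‖b x‖ ^ 2) μ)
    (hV : IsPotential V v L) (he : ∀ x, ‖b x - v x‖ ≤ e) {t : ℝ} (ht : 0 ≤ t) :
    Integrable (fun q => ‖v (step b t q)‖ ^ 2) (μ.prod (stdGaussian (Vec n))) := by
  have h1 := hV.continuous_grad
  have h2 := continuous_step hb t
  refine (((integrable_gap hb hb2 hV he ht).const_mul 2).add
    ((integrable_sq_fst hb2).const_mul 2)).mono' (Continuous.aestronglyMeasurable (by fun_prop))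
    (ae_of_all _ fun q => ?_)
  rw [Real.norm_of_nonneg (by positivity)]
  have h3 : ‖v (step b t q)‖ ≤ ‖v (step b t q) - b q.1‖ + ‖b q.1‖ := norm_le_norm_sub_add _ _
  have h4 : ‖v (step b t q)‖ ^ 2 ≤ (‖v (step b t q) - b q.1‖ + ‖b q.1‖) ^ 2 := by gcongr
  simp only [Pi.add_apply]
  nlinarith [sq_nonneg (‖v (step b t q) - b q.1‖ - ‖b q.1‖)]

/-- This carries the second moment of the drift from one iterate to the next. -/
lemma integrable_drift_sq_stepLaw (hb : Continuous b) (hb2 : Integrable (fun x => ‖b x‖ ^ 2) μ)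
    (hV : IsPotential V v L) (he : ∀ x, ‖b x - v x‖ ≤ e) {t : ℝ} (ht : 0 ≤ t) :
    Integrable (fun x => ‖b x‖ ^ 2) (stepLaw b μ t) := by
  have h2 := continuous_step hb t
  rw [stepLaw, integrable_map_measure (by fun_prop) h2.measurable.aemeasurable]
  refine (((integrable_grad_sq hb hb2 hV he ht).const_mul 2).add
    (integrable_const (2 * e ^ 2))).mono' (Continuous.aestronglyMeasurable (by fun_prop))
    (ae_of_all _ fun q => ?_)
  simp only [Function.comp_apply, Pi.add_apply]
  rw [Real.norm_of_nonneg (by positivity)]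
  have h3 : ‖b (step b t q)‖ ≤ ‖v (step b t q)‖ + e :=
    (norm_le_norm_sub_add _ (v (step b t q))).trans (by linarith [he (step b t q)])
  have h4 : ‖b (step b t q)‖ ^ 2 ≤ (‖v (step b t q)‖ + e) ^ 2 := by gcongr
  nlinarith [sq_nonneg (‖v (step b t q)‖ - e)]

/-- The relative Fisher information at time `t`, as a real number. -/
def fisher (b : Vec n → Vec n) (μ : Measure (Vec n)) (v : Vec n → Vec n) (t : ℝ) : ℝ :=
  ∫ q, ‖relScore b μ v t (step b t q)‖ ^ 2 ∂(μ.prod (stdGaussian (Vec n)))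

lemma integrable_mixScore_sq (hb : Continuous b) {t : ℝ} (ht : 0 < t) :
    Integrable (fun q => ‖mixScore b μ t (step b t q)‖ ^ 2) (μ.prod (stdGaussian (Vec n))) := by
  have h1 : Continuous (mixScore b μ t) := continuous_slice (continuousOn_mixScore hb) ht
  have h2 := continuous_step hb t
  refine ⟨Continuous.aestronglyMeasurable (by fun_prop), ?_⟩
  rw [hasFiniteIntegral_iff_ofReal (ae_of_all _ fun q => by positivity)]
  exact (lintegral_norm_mixScore_sq_le hb ht).trans_lt ENNReal.ofReal_lt_top

lemma integrable_relScore_sq (hb : Continuous b) (hb2 : Integrable (fun x => ‖b x‖ ^ 2) μ)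
    (hV : IsPotential V v L) (he : ∀ x, ‖b x - v x‖ ≤ e) {t : ℝ} (ht : 0 < t) :
    Integrable (fun q => ‖relScore b μ v t (step b t q)‖ ^ 2) (μ.prod (stdGaussian (Vec n))) := by
  have h1 : Continuous (relScore b μ v t) := continuous_slice (continuousOn_relScore hb hV) ht
  have h2 := continuous_step hb t
  refine (((integrable_mixScore_sq (μ := μ) hb ht).const_mul 2).add
    ((integrable_grad_sq hb hb2 hV he ht.le).const_mul 2)).mono'
    (Continuous.aestronglyMeasurable (by fun_prop)) (ae_of_all _ fun q => ?_)
  rw [Real.norm_of_nonneg (by positivity)]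
  have h3 : ‖relScore b μ v t (step b t q)‖ ≤ ‖mixScore b μ t (step b t q)‖ + ‖v (step b t q)‖ :=
    norm_add_le _ _
  have h4 : ‖relScore b μ v t (step b t q)‖ ^ 2
      ≤ (‖mixScore b μ t (step b t q)‖ + ‖v (step b t q)‖) ^ 2 := by gcongr
  simp only [Pi.add_apply]
  nlinarith [sq_nonneg (‖mixScore b μ t (step b t q)‖ - ‖v (step b t q)‖)]

/-- With `s` the mixture score, `‖s + v‖² ≥ ‖v‖² + 2⟪v, s⟫`, so it suffices that `E⟪v, s⟫ ≥ -nL`.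
This is integration by parts, `E⟪v, s⟫ = -E ΔV`, carried out without second derivatives of `V`: the
score is exchanged for the noise, and `v(x_t)` is compared with `v` at the point before the noise is
added. -/
lemma integral_grad_sq_le (hb : Continuous b) (hb2 : Integrable (fun x => ‖b x‖ ^ 2) μ)
    (hV : IsPotential V v L) (he : ∀ x, ‖b x - v x‖ ≤ e) {t : ℝ} (ht : 0 < t) :
    ∫ q, ‖v (step b t q)‖ ^ 2 ∂(μ.prod (stdGaussian (Vec n))) ≤ fisher b μ v t + 2 * n * L := by
  have h1 := hV.continuous_grad
  have h2 := continuous_step hb t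
  have hsc : Continuous (mixScore b μ t) := continuous_slice (continuousOn_mixScore hb) ht
  have iv := integrable_grad_sq hb hb2 hV he ht.le
  have ivz : Integrable (fun q => ⟪v (step b t q), q.2⟫) (μ.prod (stdGaussian (Vec n))) :=
    integrable_inner_of_sq (Continuous.aestronglyMeasurable (by fun_prop))
      (Continuous.aestronglyMeasurable (by fun_prop)) iv (integrable_sq_snd μ)
  have ivs : Integrable (fun q => ⟪v (step b t q), mixScore b μ t (step b t q)⟫)
      (μ.prod (stdGaussian (Vec n))) :=
    integrable_inner_of_sq (Continuous.aestronglyMeasurable (by fun_prop))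
      (Continuous.aestronglyMeasurable (by fun_prop)) iv (integrable_mixScore_sq hb ht)
  have hle : ∫ q, (‖v (step b t q)‖ ^ 2 + 2 * ⟪v (step b t q), mixScore b μ t (step b t q)⟫)
      ∂(μ.prod (stdGaussian (Vec n))) ≤ fisher b μ v t := by
    refine integral_mono (iv.add (ivs.const_mul 2)) (integrable_relScore_sq hb hb2 hV he ht)
      fun q => ?_
    simp only [relScore]
    rw [norm_add_sq_real, real_inner_comm]
    nlinarith [sq_nonneg ‖mixScore b μ t (step b t q)‖]
  rw [integral_add iv (ivs.const_mul 2), integral_const_mul] at hle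
  have htower := integral_inner_noise hb ht h1 ivz
  -- The noiseless end point is independent of the noise, so `⟪v (m x), Z⟫` has mean zero and only
  -- the Lipschitz increment contributes.
  set m : Vec n → Vec n := fun x => x - t • b x with hm
  have hmc : Continuous m := by fun_prop
  have hsq : 0 < √(2 * t) := by positivity
  have ip : Integrable (fun q : Vec n × Vec n => L * √(2 * t) * ‖q.2‖ ^ 2)
      (μ.prod (stdGaussian (Vec n))) := (integrable_sq_snd μ).const_mul _
  have hgap : ∀ q : Vec n × Vec n, ‖v (step b t q) - v (m q.1)‖ ≤ L * √(2 * t) * ‖q.2‖ := by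
    intro q
    refine (hV.lip _ _).trans (le_of_eq ?_)
    simp only [step, hm]
    rw [add_sub_cancel_left, norm_smul, Real.norm_of_nonneg hsq.le, mul_assoc]
  have hb3 : ∀ q : Vec n × Vec n, ‖⟪v (step b t q) - v (m q.1), q.2⟫‖
      ≤ L * √(2 * t) * ‖q.2‖ ^ 2 := by
    intro q
    refine (norm_inner_le_norm _ _).trans ?_
    calc _ ≤ L * √(2 * t) * ‖q.2‖ * ‖q.2‖ := mul_le_mul_of_nonneg_right (hgap q) (norm_nonneg _)
      _ = _ := by ring
  have id : Integrable (fun q : Vec n × Vec n => ⟪v (step b t q) - v (m q.1), q.2⟫)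
      (μ.prod (stdGaussian (Vec n))) :=
    ip.mono' (Continuous.aestronglyMeasurable (by fun_prop)) (ae_of_all _ hb3)
  have im : Integrable (fun q : Vec n × Vec n => ⟪v (m q.1), q.2⟫) (μ.prod (stdGaussian (Vec n))) := by
    refine (ivz.sub id).congr (ae_of_all _ fun q => ?_)
    simp only [Pi.sub_apply]
    rw [← inner_sub_left]; simp
  have hz : ∫ q, ⟪v (step b t q), q.2⟫ ∂(μ.prod (stdGaussian (Vec n))) ≤ L * √(2 * t) * n := by
    calc _ = ∫ q : Vec n × Vec n, (⟪v (step b t q) - v (m q.1), q.2⟫ + ⟪v (m q.1), q.2⟫)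
          ∂(μ.prod (stdGaussian (Vec n))) := by
          refine integral_congr_ae (ae_of_all _ fun q => ?_)
          simp only []
          rw [← inner_add_left]; simp
      _ = ∫ q : Vec n × Vec n, ⟪v (step b t q) - v (m q.1), q.2⟫ ∂(μ.prod (stdGaussian (Vec n))) := by
          rw [integral_add id im, integral_inner_fst_snd (f := fun x => v (m x)), add_zero]
      _ ≤ ∫ q : Vec n × Vec n, L * √(2 * t) * ‖q.2‖ ^ 2 ∂(μ.prod (stdGaussian (Vec n))) :=
          integral_mono id ip fun q => (le_abs_self _).trans (hb3 q)
      _ = _ := by rw [integral_const_mul, integral_sq_snd]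
  rw [htower] at hz
  have h5 : -(L * n) ≤ ∫ q, ⟪v (step b t q), mixScore b μ t (step b t q)⟫
      ∂(μ.prod (stdGaussian (Vec n))) := by
    by_contra hc
    push Not at hc
    nlinarith [mul_lt_mul_of_pos_left hc hsq]
  linarith

/-- The drift is close to the gradient of the potential at the current point. -/
lemma driftGap_le (hb : Continuous b) (hb2 : Integrable (fun x => ‖b x‖ ^ 2) μ)
    (hV : IsPotential V v L) (he : ∀ x, ‖b x - v x‖ ≤ e) {t γ : ℝ} (ht : 0 < t) (htγ : t ≤ γ)
    (hγ : (γ * L) ^ 2 ≤ 1 / 32) :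
    driftGap b μ v t ≤ fisher b μ v t / 7 + (7 * n * L ^ 2 * γ + 16 / 7 * e ^ 2) := by
  have hL := hV.nonneg
  have iD := integrable_gap hb hb2 hV he ht.le
  have iv := integrable_grad_sq hb hb2 hV he ht.le
  have iX := integrable_step_sub_sq hb hb2 ht.le
  have h1 : driftGap b μ v t ≤ 2 * e ^ 2 + 2 * L ^ 2 *
      (t ^ 2 * ∫ q : Vec n × Vec n, ‖b q.1‖ ^ 2 ∂(μ.prod (stdGaussian (Vec n))) + 2 * t * n) := by
    rw [← integral_step_sub_sq hb hb2 ht.le, ← integral_const_mul]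
    calc _ ≤ ∫ q, (2 * e ^ 2 + 2 * L ^ 2 * ‖step b t q - q.1‖ ^ 2)
          ∂(μ.prod (stdGaussian (Vec n))) :=
          integral_mono iD ((integrable_const _).add (iX.const_mul _)) fun q => norm_gap_le hV he t q
      _ = _ := by rw [integral_add (integrable_const _) (iX.const_mul _)]; simp
  have h2 : ∫ q : Vec n × Vec n, ‖b q.1‖ ^ 2 ∂(μ.prod (stdGaussian (Vec n)))
      ≤ 2 * driftGap b μ v t + 2 * ∫ q, ‖v (step b t q)‖ ^ 2 ∂(μ.prod (stdGaussian (Vec n))) := by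
    rw [driftGap, ← integral_const_mul, ← integral_const_mul,
      ← integral_add (iD.const_mul 2) (iv.const_mul 2)]
    refine integral_mono (integrable_sq_fst hb2) ((iD.const_mul 2).add (iv.const_mul 2)) fun q => ?_
    have h3 : ‖b q.1‖ ≤ ‖v (step b t q) - b q.1‖ + ‖v (step b t q)‖ := by
      rw [norm_sub_rev]; exact norm_le_norm_sub_add _ _
    have h4 : ‖b q.1‖ ^ 2 ≤ (‖v (step b t q) - b q.1‖ + ‖v (step b t q)‖) ^ 2 := by gcongr
    nlinarith [sq_nonneg (‖v (step b t q) - b q.1‖ - ‖v (step b t q)‖)]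
  have h3 := integral_grad_sq_le hb hb2 hV he ht
  have hF0 : 0 ≤ fisher b μ v t := integral_nonneg fun q => by positivity
  have hD0 : 0 ≤ driftGap b μ v t := integral_nonneg fun q => by positivity
  set D := driftGap b μ v t
  set F := fisher b μ v t
  set E := ∫ q : Vec n × Vec n, ‖b q.1‖ ^ 2 ∂(μ.prod (stdGaussian (Vec n)))
  -- The drift at the start is bounded by the gap and by `v` at the end point, so the estimate of
  -- `D` involves `D` again.
  have hE : E ≤ 2 * D + 2 * F + 4 * (n * L) := by linarith
  have hn : (0 : ℝ) ≤ n := Nat.cast_nonneg n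
  have htL : (L * t) ^ 2 ≤ 1 / 32 := by
    refine le_trans ?_ hγ
    rw [mul_comm γ]
    gcongr
  have hLt0 : 0 ≤ L * t := by positivity
  -- `1 / √32 < 0.18`.
  have hLt : L * t ≤ 9 / 50 := by nlinarith
  have h4 : (L * t) ^ 2 * E ≤ 1 / 32 * (2 * D + 2 * F) + 4 * (n * L) * (L * t) ^ 2 := by
    calc (L * t) ^ 2 * E ≤ (L * t) ^ 2 * (2 * D + 2 * F + 4 * (n * L)) := by gcongr
      _ = (L * t) ^ 2 * (2 * D + 2 * F) + 4 * (n * L) * (L * t) ^ 2 := by ring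
      _ ≤ _ := by gcongr
  have h5 : (n * L) * (L * t) ^ 2 ≤ 9 / 50 * (n * L ^ 2 * t) := by
    calc (n * L) * (L * t) ^ 2 = (L * t) * (n * L ^ 2 * t) := by ring
      _ ≤ _ := by gcongr
  have h6 : n * L ^ 2 * t ≤ n * L ^ 2 * γ := by gcongr
  have h7 : D ≤ 2 * e ^ 2 + (2 * ((L * t) ^ 2 * E) + 4 * (n * L ^ 2 * t)) := by
    refine h1.trans (le_of_eq ?_); ring
  have h8 : 0 ≤ n * L ^ 2 * t := by positivity
  -- The bounds combine to `(7/8) D ≤ F/8 + 2e² + 5.44 nL²t`; multiplying by `8/7` gives the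
  -- constants `1/7`, `16/7` and `6.22 ≤ 7`.
  nlinarith

end

section

/-! ### Exponential moments of the gradient of the potential -/

variable {n : ℕ} {V : Vec n → ℝ} {v : Vec n → Vec n} {L : ℝ}

/-- The `n`-dimensional Hausdorff measure satisfies this bound and is a Haar measure, so Lebesgue
measure is a multiple of it and the multiple cancels. It serves as a change of variables without a
Jacobian, as `v` is only Lipschitz. -/
lemma volume_preimage_le_of_antilipschitz {T : Vec n → Vec n} {K : ℝ≥0} (hT : AntilipschitzWith K T)
    (s : Set (Vec n)) : volume (T ⁻¹' s) ≤ (K : ℝ≥0∞) ^ (n : ℝ) * volume s := by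
  have h := hT.hausdorffMeasure_preimage_le (d := n) (Nat.cast_nonneg n) s
  have : Measure.IsAddHaarMeasure (μH[(n : ℝ)] : Measure (Vec n)) := by
    have h0 := isAddHaarMeasure_hausdorffMeasure (E := Vec n)
    rwa [finrank_euclideanSpace, Fintype.card_fin] at h0
  rw [Measure.isAddLeftInvariant_eq_smul (volume : Measure (Vec n)) μH[(n : ℝ)]]
  simp only [Measure.smul_apply, ENNReal.smul_def, smul_eq_mul]
  rw [mul_left_comm]
  exact mul_le_mul_right h _

lemma lintegral_comp_le_of_antilipschitz {T : Vec n → Vec n} {K : ℝ≥0} (hT : AntilipschitzWith K T)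
    (hTm : Measurable T) {f : Vec n → ℝ≥0∞} (hf : Measurable f) :
    ∫⁻ x, f (T x) ≤ (K : ℝ≥0∞) ^ (n : ℝ) * ∫⁻ x, f x := by
  rw [← lintegral_map hf hTm, ← smul_eq_mul, ← lintegral_smul_measure]
  refine lintegral_mono' (Measure.le_iff.2 fun s hs => ?_) le_rfl
  rw [Measure.map_apply hTm hs, Measure.smul_apply]
  exact volume_preimage_le_of_antilipschitz hT s

/-- The descent lemma for a gradient step: along the segment `v` changes by at most `‖v x‖ / 2`, so
by the mean value theorem `V` falls at rate at least `‖v x‖² / 2`. -/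
lemma IsPotential.descent (hV : IsPotential V v L) {h : ℝ} (hh : 0 < h) (hhL : h * L ≤ 1 / 2)
    (x : Vec n) : V (x - h • v x) ≤ V x - h / 2 * ‖v x‖ ^ 2 := by
  have hd : ∀ s : ℝ, HasDerivAt (fun s : ℝ => V (x - s • v x)) (-⟪v (x - s • v x), v x⟫) s := by
    intro s
    have h1 := (hV.grad (x - s • v x)).hasFDerivAt.comp_hasDerivAt s
      (((hasDerivAt_id s).smul_const (v x)).const_sub x)
    exact h1.congr_deriv (by simp)
  obtain ⟨s, hs, hs2⟩ := exists_hasDerivAt_eq_slope (fun s : ℝ => V (x - s • v x)) _ hh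
    (fun s _ => (hd s).continuousAt.continuousWithinAt) (fun s _ => hd s)
  have h2 : |⟪v (x - s • v x) - v x, v x⟫| ≤ 1 / 2 * ‖v x‖ ^ 2 := by
    refine (abs_real_inner_le_norm _ _).trans ?_
    have h3 := hV.lip (x - s • v x) x
    rw [sub_sub_cancel_left, norm_neg, norm_smul, Real.norm_of_nonneg hs.1.le] at h3
    calc _ ≤ L * (s * ‖v x‖) * ‖v x‖ := by gcongr
      _ = s * L * ‖v x‖ ^ 2 := by ring
      _ ≤ _ := by
        gcongr
        exact (mul_le_mul_of_nonneg_right hs.2.le hV.nonneg).trans hhL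
  rw [inner_sub_left, real_inner_self_eq_norm_sq, abs_le] at h2
  rw [eq_div_iff (by linarith)] at hs2
  simp only [zero_smul, sub_zero] at hs2
  nlinarith [h2.1]

/-- The map is the identity minus a `1/2`-Lipschitz map. -/
lemma IsPotential.antilipschitz (hV : IsPotential V v L) {h : ℝ} (hh : 0 < h)
    (hhL : h * L ≤ 1 / 2) : AntilipschitzWith 2 fun x => x - h • v x := by
  refine AntilipschitzWith.of_le_mul_dist fun x y => ?_
  rw [dist_eq_norm, dist_eq_norm]
  have h1 : ‖x - y‖ ≤ ‖(x - h • v x) - (y - h • v y)‖ + h * (L * ‖x - y‖) := by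
    have e : x - y = ((x - h • v x) - (y - h • v y)) + h • (v x - v y) := by
      rw [smul_sub]; abel
    calc ‖x - y‖ = ‖((x - h • v x) - (y - h • v y)) + h • (v x - v y)‖ := by rw [← e]
      _ ≤ _ := by
        refine (norm_add_le _ _).trans ?_
        rw [norm_smul, Real.norm_of_nonneg hh.le]
        gcongr
        exact hV.lip x y
  have h2 : h * (L * ‖x - y‖) ≤ 1 / 2 * ‖x - y‖ := by
    rw [← mul_assoc]; gcongr
  push_cast
  linarith

/-- The gradient of a smooth potential has Gaussian tails under the Gibbs measure. -/
lemma IsPotential.lintegral_exp_grad_sq_le (hV : IsPotential V v L) {h : ℝ} (hh : 0 < h)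
    (hhL : h * L ≤ 1 / 2) :
    ∫⁻ x, ENNReal.ofReal (Real.exp (-V x)) * ENNReal.ofReal (Real.exp (h / 2 * ‖v x‖ ^ 2))
      ≤ (2 : ℝ≥0) ^ (n : ℝ) * ∫⁻ x, ENNReal.ofReal (Real.exp (-V x)) := by
  have h1 := hV.continuous
  have h2 := hV.continuous_grad
  -- By descent the integrand is at most `exp (-V)` at the point `x - h v(x)`; undoing this gradient
  -- step costs the factor `2 ^ n`.
  refine le_trans (lintegral_mono fun x => ?_)
    (lintegral_comp_le_of_antilipschitz (hV.antilipschitz hh hhL)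
      (Continuous.measurable (by fun_prop)) (f := fun x => ENNReal.ofReal (Real.exp (-V x)))
      (by fun_prop))
  rw [← ENNReal.ofReal_mul (Real.exp_pos _).le, ← Real.exp_add]
  exact ENNReal.ofReal_le_ofReal (Real.exp_le_exp.2 (by linarith [hV.descent hh hhL x]))

/-- Young's inequality for the convex conjugates `a log a - a` and `exp f`: the pointwise form of
entropy duality. -/
lemma mul_le_klFun_add_exp {a f : ℝ} (ha : 0 ≤ a) :
    a * f ≤ InformationTheory.klFun a + Real.exp f := by
  rw [InformationTheory.klFun_apply]
  rcases ha.eq_or_lt with rfl | h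
  · simp; positivity
  · have h1 := Real.add_one_le_exp (f - Real.log a)
    rw [Real.exp_sub, Real.exp_log h, le_div_iff₀ h] at h1
    nlinarith

/-- A measure with finite relative entropy with respect to the Gibbs measure has a finite second
moment of the gradient of the potential. -/
lemma IsPotential.integrable_grad_sq_of_klDiv_ne_top (hV : IsPotential V v L)
    {ρ π : Measure (Vec n)} [IsProbabilityMeasure ρ] [IsProbabilityMeasure π]
    (hπ : π = volume.withDensity (fun x => ENNReal.ofReal (Real.exp (-V x))))
    (hkl : InformationTheory.klDiv ρ π ≠ ∞) : Integrable (fun x => ‖v x‖ ^ 2) ρ := by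
  have hVc := hV.continuous
  have hvc := hV.continuous_grad
  have hL := hV.nonneg
  obtain ⟨h, hh, hhL⟩ : ∃ h : ℝ, 0 < h ∧ h * L ≤ 1 / 2 := by
    -- The `+ 1` covers `L = 0`.
    refine ⟨1 / (2 * (L + 1)), by positivity, ?_⟩
    rw [div_mul_eq_mul_div, div_le_div_iff₀ (by positivity) (by positivity)]
    linarith
  have hac : ρ ≪ π := (InformationTheory.klDiv_ne_top_iff.1 hkl).1
  have hm : Measurable fun x => ENNReal.ofReal (Real.exp (-V x)) := by fun_prop
  have hone : ∫⁻ x, ENNReal.ofReal (Real.exp (-V x)) = 1 := by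
    have : π univ = 1 := measure_univ
    rwa [hπ, withDensity_apply _ MeasurableSet.univ, Measure.restrict_univ] at this
  have hexp : ∫⁻ x, ENNReal.ofReal (Real.exp (h / 2 * ‖v x‖ ^ 2)) ∂π ≠ ∞ := by
    rw [hπ, lintegral_withDensity_eq_lintegral_mul _ hm (by fun_prop)]
    refine ne_top_of_le_ne_top ?_ (hV.lintegral_exp_grad_sq_le hh hhL)
    rw [hone, mul_one]
    exact ENNReal.rpow_ne_top_of_nonneg (Nat.cast_nonneg n) ENNReal.coe_ne_top
  have : ρ.HaveLebesgueDecomposition π := Measure.haveLebesgueDecomposition_of_sigmaFinite ρ π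
  have hdens : ∫⁻ x, ENNReal.ofReal (h / 2 * ‖v x‖ ^ 2) ∂ρ
      = ∫⁻ x, ρ.rnDeriv π x * ENNReal.ofReal (h / 2 * ‖v x‖ ^ 2) ∂π :=
    (lintegral_rnDeriv_mul (μ := ρ) (ν := π) hac
      (f := fun x => ENNReal.ofReal (h / 2 * ‖v x‖ ^ 2)) (by fun_prop)).symm
  have hbound : ∫⁻ x, ENNReal.ofReal (h / 2 * ‖v x‖ ^ 2) ∂ρ
      ≤ InformationTheory.klDiv ρ π + ∫⁻ x, ENNReal.ofReal (Real.exp (h / 2 * ‖v x‖ ^ 2)) ∂π := by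
    rw [InformationTheory.klDiv_eq_lintegral_klFun_of_ac hac, ← lintegral_add_right _ (by fun_prop), hdens]
    refine lintegral_mono_ae ?_
    filter_upwards [Measure.rnDeriv_lt_top ρ π] with x hx
    have e1 : ρ.rnDeriv π x = ENNReal.ofReal (ρ.rnDeriv π x).toReal :=
      (ENNReal.ofReal_toReal hx.ne).symm
    nth_rewrite 1 [e1]
    rw [← ENNReal.ofReal_mul ENNReal.toReal_nonneg, ← ENNReal.ofReal_add
      (InformationTheory.klFun_nonneg ENNReal.toReal_nonneg) (Real.exp_pos _).le]
    exact ENNReal.ofReal_le_ofReal (mul_le_klFun_add_exp ENNReal.toReal_nonneg)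
  have hfin : Integrable (fun x => h / 2 * ‖v x‖ ^ 2) ρ := by
    refine ⟨Continuous.aestronglyMeasurable (by fun_prop), ?_⟩
    rw [hasFiniteIntegral_iff_ofReal (ae_of_all _ fun x => by positivity)]
    exact (hbound.trans_lt (ENNReal.add_lt_top.2 ⟨hkl.lt_top, hexp.lt_top⟩))
  refine (hfin.const_mul (2 / h)).congr (ae_of_all _ fun x => ?_)
  simp only []
  field_simp

/-! ### The relative Fisher information of the mixture -/

variable {b : Vec n → Vec n} {μ : Measure (Vec n)} [IsProbabilityMeasure μ]

lemma eq_withDensity_gibbs (hV : IsPotential V v L) {π : Measure (Vec n)}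
    [IsProbabilityMeasure π] (hπ : π = volume.withDensity (fun x => ENNReal.ofReal (Real.exp (-V x))))
    {ρ : Measure (Vec n)} {r : Vec n → ℝ} (hrm : Measurable r)
    (hρ : ρ = volume.withDensity (fun y => ENNReal.ofReal (r y))) :
    ρ = π.withDensity (fun y => ENNReal.ofReal (r y * Real.exp (V y))) := by
  have hVc := hV.continuous
  rw [hπ, hρ, ← withDensity_mul _ (by fun_prop) (by fun_prop)]
  congr 1
  ext y
  rw [Pi.mul_apply, ← ENNReal.ofReal_mul (Real.exp_pos _).le]
  congr 1
  rw [mul_left_comm, ← Real.exp_add]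
  simp

lemma rnDeriv_gibbs (hV : IsPotential V v L) {π : Measure (Vec n)}
    [IsProbabilityMeasure π] (hπ : π = volume.withDensity (fun x => ENNReal.ofReal (Real.exp (-V x))))
    {ρ : Measure (Vec n)} {r : Vec n → ℝ} (hrm : Measurable r) (hr0 : ∀ y, 0 ≤ r y)
    (hρ : ρ = volume.withDensity (fun y => ENNReal.ofReal (r y))) :
    (fun y => (ρ.rnDeriv π y).toReal) =ᵐ[volume] fun y => r y * Real.exp (V y) := by
  have hVc := hV.continuous
  have h1 : ρ.rnDeriv π =ᵐ[π] fun y => ENNReal.ofReal (r y * Real.exp (V y)) := by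
    rw [eq_withDensity_gibbs hV hπ hrm hρ]
    exact Measure.rnDeriv_withDensity π (by fun_prop)
  -- The Gibbs density is positive, so a statement almost everywhere for `π` holds almost everywhere
  -- for Lebesgue measure.
  have h2 : volume ≪ π := by
    rw [hπ]
    exact withDensity_absolutelyContinuous' (by fun_prop)
      (ae_of_all _ fun x => by simp [Real.exp_pos])
  filter_upwards [h2.ae_le h1] with y hy
  rw [hy, ENNReal.toReal_ofReal (mul_nonneg (hr0 y) (Real.exp_pos _).le)]

lemma isWeakGradient_of_hasGradientAt {f : Vec n → ℝ} {G : Vec n → Vec n}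
    (hf : ∀ y, HasGradientAt f (G y) y) (hG : Continuous G) : IsWeakGradient f G := by
  have hfc : Continuous f := continuous_iff_continuousAt.2 fun y => (hf y).hasFDerivAt.continuousAt
  refine ⟨hfc.locallyIntegrable, hG.locallyIntegrable, fun φ hφ hφs => ?_⟩
  have hφd : Differentiable ℝ φ := hφ.differentiable (by simp)
  have hgc : Continuous (gradient φ) := by
    have := hφ.continuous_fderiv (by simp)
    exact (InnerProductSpace.toDual ℝ (Vec n)).symm.continuous.comp this
  have hgs : HasCompactSupport (gradient φ) :=
    (hφs.fderiv (𝕜 := ℝ)).comp_left (g := (InnerProductSpace.toDual ℝ (Vec n)).symm) (by simp)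
  have i1 : Integrable fun x => f x • gradient φ x :=
    (hfc.smul hgc).integrable_of_hasCompactSupport hgs.smul_left
  have i2 : Integrable fun x => φ x • G x :=
    (hφ.continuous.smul hG).integrable_of_hasCompactSupport hφs.smul_right
  refine ext_inner_left ℝ fun w => ?_
  rw [inner_neg_right, ← integral_inner i1, ← integral_inner i2]
  have e1 : ∀ x, ⟪w, f x • gradient φ x⟫ = f x * fderiv ℝ φ x w := by
    intro x
    rw [inner_smul_right, real_inner_comm, gradient, InnerProductSpace.toDual_symm_apply]
  have e2 : ∀ x, ⟪w, φ x • G x⟫ = fderiv ℝ f x w * φ x := by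
    intro x
    rw [inner_smul_right, real_inner_comm, (hf x).hasFDerivAt.fderiv,
      InnerProductSpace.toDual_apply_apply, mul_comm]
  simp_rw [e1, e2]
  refine integral_mul_fderiv_eq_neg_fderiv_mul_of_integrable ?_ ?_ ?_
    (fun x _ => (hf x).hasFDerivAt.differentiableAt) (fun x _ => hφd x)
  · exact (i2.const_inner w).congr (ae_of_all _ e2)
  · exact (i1.const_inner w).congr (ae_of_all _ e1)
  · exact (hfc.mul hφ.continuous).integrable_of_hasCompactSupport hφs.mul_left

lemma IsWeakGradient.congr_ae {f f' : Vec n → ℝ} {G G' : Vec n → Vec n} (h : IsWeakGradient f G)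
    (hf : f =ᵐ[volume] f') (hG : G =ᵐ[volume] G') : IsWeakGradient f' G' := by
  refine ⟨h.1.congr hf, h.2.1.congr hG, fun φ hφ hφs => ?_⟩
  have e1 : ∫ x, f x • gradient φ x = ∫ x, f' x • gradient φ x :=
    integral_congr_ae (hf.mono fun x hx => by simp only [hx])
  have e2 : ∫ x, φ x • G x = ∫ x, φ x • G' x :=
    integral_congr_ae (hG.mono fun x hx => by simp only [hx])
  rw [← e1, ← e2, h.2.2 φ hφ hφs]

/-- The Fisher information is an infimum over versions of the score, so one version suffices: the
classical gradient of the smooth density. -/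
lemma relFisherInfo_stepLaw_le (hb : Continuous b) (hV : IsPotential V v L) {π : Measure (Vec n)}
    [IsProbabilityMeasure π] (hπ : π = volume.withDensity (fun x => ENNReal.ofReal (Real.exp (-V x))))
    {t : ℝ} (ht : 0 < t) :
    relFisherInfo (stepLaw b μ t) π
      ≤ ∫⁻ q, ‖relScore b μ v t (step b t q)‖ₑ ^ 2 ∂(μ.prod (stdGaussian (Vec n))) := by
  have hd : Continuous (mixDens b μ t) := continuous_slice (continuousOn_mixDens hb) ht
  have hsc : Continuous (relScore b μ v t) := continuous_slice (continuousOn_relScore hb hV) ht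
  have hlaw := stepLaw_eq_withDensity (μ := μ) hb ht
  have hr := rnDeriv_gibbs hV hπ hd.measurable (fun y => (mixDens_pos hb ht y).le) hlaw
  have hs : IsRelativeScore (stepLaw b μ t) π (relScore b μ v t) := by
    refine ⟨?_, ?_⟩
    · rw [eq_withDensity_gibbs hV hπ hd.measurable hlaw]
      exact withDensity_absolutelyContinuous _ _
    · refine (isWeakGradient_of_hasGradientAt (hasGradientAt_relDens (μ := μ) hb hV ht)
        ((continuous_relDens hb hV ht).smul hsc)).congr_ae hr.symm ?_
      filter_upwards [hr] with y hy
      rw [hy, relDens]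
  refine (iInf₂_le (relScore b μ v t) hs).trans (le_of_eq ?_)
  rw [stepLaw, lintegral_map (by fun_prop) (continuous_step hb t).measurable]

end

section

/-! ### Removal of the cutoff -/

variable {n : ℕ} {b : Vec n → Vec n} {μ : Measure (Vec n)} [IsProbabilityMeasure μ]
  {V : Vec n → ℝ} {v : Vec n → Vec n} {L e : ℝ} {χ : Vec n → ℝ} {g : Vec n → Vec n} {c δ : ℝ}

/-- Dilations of a single bump function: stretching by `j + 1` divides the gradient by `j + 1`. -/
lemma exists_cutoff_sequence (n : ℕ) : ∃ (χ : ℕ → Vec n → ℝ) (g : ℕ → Vec n → Vec n) (C : ℝ),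
    (∀ j : ℕ, IsCutoff (χ j) (g j) (C / (j + 1))) ∧ ∀ y, ∀ᶠ j in atTop, χ j y = 1 := by
  let f : ContDiffBump (0 : Vec n) := ⟨1, 2, one_pos, one_lt_two⟩
  have hf : ContDiff ℝ 1 f := f.contDiff
  have hgc : Continuous (gradient f) :=
    (InnerProductSpace.toDual ℝ (Vec n)).symm.continuous.comp (hf.continuous_fderiv one_ne_zero)
  have hgs : HasCompactSupport (gradient f) :=
    (f.hasCompactSupport.fderiv (𝕜 := ℝ)).comp_left
      (g := (InnerProductSpace.toDual ℝ (Vec n)).symm) (by simp)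
  obtain ⟨C, hC⟩ := hgc.bounded_above_of_compact_support hgs
  refine ⟨fun j y => f (((j : ℝ) + 1)⁻¹ • y),
    fun j y => ((j : ℝ) + 1)⁻¹ • gradient f (((j : ℝ) + 1)⁻¹ • y), C, fun j => ?_, fun y => ?_⟩
  · have hj : (0 : ℝ) < ((j : ℝ) + 1)⁻¹ := by positivity
    refine ⟨fun y => ?_, by fun_prop, ?_, fun y => f.nonneg, fun y => f.le_one, fun y => ?_⟩
    · have h1 : HasFDerivAt f (fderiv ℝ f (((j : ℝ) + 1)⁻¹ • y)) (((j : ℝ) + 1)⁻¹ • y) :=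
        (hf.differentiable one_ne_zero _).hasFDerivAt
      have h2 := h1.comp y ((hasFDerivAt_id y).const_smul (((j : ℝ) + 1)⁻¹))
      rw [hasGradientAt_iff_hasFDerivAt]
      refine h2.congr_fderiv ?_
      ext w
      simp [gradient]
    · exact f.hasCompactSupport.comp_smul hj.ne'
    · rw [norm_smul, Real.norm_of_nonneg hj.le, div_eq_inv_mul]
      exact mul_le_mul_of_nonneg_left (hC _) hj.le
  · obtain ⟨m, hm⟩ := exists_nat_ge ‖y‖
    filter_upwards [eventually_ge_atTop m] with j hj
    refine f.one_of_mem_closedBall ?_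
    rw [mem_closedBall_zero_iff, norm_smul, Real.norm_of_nonneg (by positivity),
      inv_mul_le_iff₀ (by positivity), mul_one]
    have : (m : ℝ) ≤ j := by exact_mod_cast hj
    linarith

/-- With `δ = 1 / (j + 2)` the bound on the truncated logarithm grows like `log j`, more slowly than
the cutoff gradient decays. -/
lemma tendsto_cutoff_error (C : ℝ) :
    Tendsto (fun j : ℕ => C / ((j : ℝ) + 1) * -Real.log (1 / ((j : ℝ) + 2))) atTop (𝓝 0) := by
  have h1 : Tendsto (fun x : ℝ => Real.log x / (1 * x + (-1))) atTop (𝓝 0) := by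
    simpa using Real.tendsto_pow_log_div_mul_add_atTop 1 (-1) 1 one_ne_zero
  have h2 : Tendsto (fun j : ℕ => (j : ℝ) + 2) atTop atTop :=
    tendsto_atTop_add_const_right _ _ tendsto_natCast_atTop_atTop
  have h3 := (h1.comp h2).const_mul C
  rw [mul_zero] at h3
  refine h3.congr fun j => ?_
  have : (j : ℝ) + 1 ≠ 0 := by positivity
  simp only [Function.comp_apply, one_div, Real.log_inv, neg_neg]
  rw [show 1 * ((j : ℝ) + 2) + -1 = j + 1 by ring]
  ring

lemma aestronglyMeasurable_integral_step (hb : Continuous b) {F : ℝ → Vec n → ℝ}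
    (hF : ContinuousOn (fun q : ℝ × Vec n => F q.1 q.2) (Ioi 0 ×ˢ univ)) (T : ℝ) :
    AEStronglyMeasurable
      (fun t => ∫ q, F t (step b t q) ∂(μ.prod (stdGaussian (Vec n)))) (volume.restrict (Ioc 0 T)) := by
  have hc : ContinuousOn (fun p : ℝ × (Vec n × Vec n) => F p.1 (step b p.1 p.2))
      (Ioc 0 T ×ˢ univ) := by
    have h1 : Continuous fun p : ℝ × (Vec n × Vec n) => (p.1, step b p.1 p.2) := by
      unfold step; fun_prop
    exact hF.comp (f := fun p : ℝ × (Vec n × Vec n) => (p.1, step b p.1 p.2)) h1.continuousOn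
      fun p hp => ⟨hp.1.1, mem_univ _⟩
  have h2 := hc.aestronglyMeasurable (μ := volume.prod (μ.prod (stdGaussian (Vec n))))
    (measurableSet_Ioc.prod MeasurableSet.univ)
  rw [← Measure.prod_restrict, Measure.restrict_univ] at h2
  exact h2.integral_prod_right'

lemma aemeasurable_localFisher (hb : Continuous b) (hV : IsPotential V v L) (hχ : IsCutoff χ g c)
    (hδ : 0 < δ) (T : ℝ) :
    AEMeasurable (localFisher b μ V v χ δ) (volume.restrict (Ioc 0 T)) := by
  have h1 := hχ.continuous
  refine (aestronglyMeasurable_integral_step (μ := μ) hb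
    (F := fun t y => χ y * truncWeight δ (relDens b μ V t y) * ‖relScore b μ v t y‖ ^ 2)
    ?_ T).aemeasurable
  exact (ContinuousOn.mul (by fun_prop) (continuousOn_truncWeight_relDens hb hV hδ)).mul
    ((continuousOn_relScore hb hV).norm.pow 2)

/-- Both weights lie in `[0, 1]` and tend to `1`, the truncation weight because the relative density
is positive; the full square of the score dominates. -/
lemma tendsto_localFisher (hb : Continuous b) (hb2 : Integrable (fun x => ‖b x‖ ^ 2) μ)
    (hV : IsPotential V v L) (he : ∀ x, ‖b x - v x‖ ≤ e) {t : ℝ} (ht : 0 < t)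
    {χ : ℕ → Vec n → ℝ} {g : ℕ → Vec n → Vec n} {c δ : ℕ → ℝ}
    (hχ : ∀ j, IsCutoff (χ j) (g j) (c j)) (hχ1 : ∀ y, ∀ᶠ j in atTop, χ j y = 1)
    (hδ : ∀ j, 0 < δ j) (hδ1 : ∀ j, δ j < 1) (hδ0 : Tendsto δ atTop (𝓝 0)) :
    Tendsto (fun j => localFisher b μ V v (χ j) (δ j) t) atTop (𝓝 (fisher b μ v t)) := by
  have hstep := continuous_step hb t
  have hsc : Continuous (relScore b μ v t) := continuous_slice (continuousOn_relScore hb hV) ht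
  refine tendsto_integral_of_dominated_convergence
    (fun q => ‖relScore b μ v t (step b t q)‖ ^ 2) (fun j => ?_)
    (integrable_relScore_sq hb hb2 hV he ht) (fun j => ae_of_all _ fun q => ?_)
    (ae_of_all _ fun q => ?_)
  · have h1 := (hχ j).continuous
    have h2 : Continuous fun y => truncWeight (δ j) (relDens b μ V t y) :=
      continuous_slice (f := fun t y => truncWeight (δ j) (relDens b μ V t y))
        (continuousOn_truncWeight_relDens hb hV (hδ j)) ht
    exact (((h1.comp hstep).mul (h2.comp hstep)).mul ((hsc.comp hstep).norm.pow 2)).aestronglyMeasurable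
  · have h0 := truncWeight_nonneg (hδ j) (hδ1 j) (relDens_pos (μ := μ) (V := V) hb ht (step b t q)).le
    have h1 := truncWeight_le_one (hδ j) (relDens_pos (μ := μ) (V := V) hb ht (step b t q)).le
    have h2 := (hχ j).nonneg (step b t q)
    have h3 := (hχ j).le_one (step b t q)
    rw [Real.norm_of_nonneg (by positivity)]
    exact mul_le_of_le_one_left (by positivity) (mul_le_one₀ h3 h0 h1)
  · have h1 := (tendsto_truncWeight (relDens_pos (μ := μ) (V := V) hb ht (step b t q))).comp hδ0
    have h2 : Tendsto (fun j => χ j (step b t q)) atTop (𝓝 1) :=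
      tendsto_const_nhds.congr' ((hχ1 _).mono fun j hj => hj.symm)
    have h3 := (h2.mul h1).mul_const (‖relScore b μ v t (step b t q)‖ ^ 2)
    simpa using h3

/-- A crude bound, for finiteness only: it makes the total Fisher information finite, so that a
fraction of it can later be absorbed. -/
lemma lintegral_driftGap_ne_top (hb : Continuous b) (hb2 : Integrable (fun x => ‖b x‖ ^ 2) μ)
    (hV : IsPotential V v L) (he : ∀ x, ‖b x - v x‖ ≤ e) (T : ℝ) :
    ∫⁻ t in Ioc 0 T, ENNReal.ofReal (driftGap b μ v t) ≠ ∞ := by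
  set E := ∫ q : Vec n × Vec n, ‖b q.1‖ ^ 2 ∂(μ.prod (stdGaussian (Vec n))) with hE
  have hE0 : 0 ≤ E := integral_nonneg fun q => by positivity
  have h1 : ∀ t ∈ Ioc 0 T, ENNReal.ofReal (driftGap b μ v t)
      ≤ ENNReal.ofReal (2 * e ^ 2 + 2 * L ^ 2 * (T ^ 2 * E + 2 * T * n)) := by
    intro t ht
    refine ENNReal.ofReal_le_ofReal ?_
    have ht0 := ht.1
    have htT := ht.2
    have iX := integrable_step_sub_sq (μ := μ) hb hb2 ht.1.le
    calc _ ≤ ∫ q, (2 * e ^ 2 + 2 * L ^ 2 * ‖step b t q - q.1‖ ^ 2) ∂(μ.prod (stdGaussian (Vec n))) :=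
          integral_mono (integrable_gap hb hb2 hV he ht.1.le)
            ((integrable_const _).add (iX.const_mul _)) fun q => norm_gap_le hV he t q
      _ = 2 * e ^ 2 + 2 * L ^ 2 * (t ^ 2 * E + 2 * t * n) := by
          rw [integral_add (integrable_const _) (iX.const_mul _), integral_const_mul (2 * L ^ 2),
            integral_step_sub_sq hb hb2 ht.1.le, ← hE]
          simp
      _ ≤ _ := by gcongr
  refine ne_top_of_le_ne_top ?_ (setLIntegral_mono measurable_const h1)
  rw [setLIntegral_const]
  exact ENNReal.mul_ne_top ENNReal.ofReal_ne_top (by simp)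

/-! ### Telescoping over the iterations -/

omit [IsProbabilityMeasure μ] in
lemma ofReal_localEnt_le_klDiv (hV : IsPotential V v L) (hχ : IsCutoff χ g c) (hδ : 0 < δ)
    (hδ1 : δ < 1) {ρ π : Measure (Vec n)} [IsProbabilityMeasure ρ] [IsProbabilityMeasure π]
    (hπ : π = volume.withDensity (fun x => ENNReal.ofReal (Real.exp (-V x))))
    {r : Vec n → ℝ} (hrm : Measurable r) (hr0 : ∀ y, 0 ≤ r y)
    (hρ : ρ = volume.withDensity (fun y => ENNReal.ofReal (r y))) :
    ENNReal.ofReal (localEnt χ V δ r) ≤ InformationTheory.klDiv ρ π := by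
  have hVc := hV.continuous
  have hac : ρ ≪ π := by
    rw [eq_withDensity_gibbs hV hπ hrm hρ]
    exact withDensity_absolutelyContinuous _ _
  have hm : Measurable fun x => ENNReal.ofReal (Real.exp (-V x)) := by fun_prop
  have hk : Measurable fun x => ENNReal.ofReal (InformationTheory.klFun (ρ.rnDeriv π x).toReal) := by
    fun_prop
  have hri : Integrable r := integrable_of_withDensity (μ := ρ) hrm hr0 hρ
  have h1 := rnDeriv_gibbs hV hπ hrm hr0 hρ
  rw [InformationTheory.klDiv_eq_lintegral_klFun_of_ac hac]
  conv_rhs => rw [hπ]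
  rw [lintegral_withDensity_eq_lintegral_mul _ hm (by rw [← hπ]; exact hk), ← hπ, localEnt,
    ofReal_integral_eq_lintegral_ofReal (integrable_localEnt_of_density hV hχ hδ hδ1 hrm hr0 hri)
    (ae_of_all _ fun y => mul_nonneg (mul_nonneg (hχ.nonneg y) (truncEnt_nonneg hδ hδ1
      (mul_nonneg (hr0 y) (Real.exp_pos _).le))) (Real.exp_pos _).le)]
  refine lintegral_mono_ae ?_
  filter_upwards [h1] with y hy
  rw [Pi.mul_apply, hy, ← ENNReal.ofReal_mul (Real.exp_pos _).le, mul_comm (Real.exp _)]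
  refine ENNReal.ofReal_le_ofReal (mul_le_mul_of_nonneg_right ?_ (Real.exp_pos _).le)
  have h0 := mul_nonneg (hr0 y) (Real.exp_pos (V y)).le
  exact (mul_le_of_le_one_left (truncEnt_nonneg hδ hδ1 h0) (hχ.le_one y)).trans
    (truncEnt_le_klFun hδ hδ1 h0)

/-- The laws of the iterates. -/
def iterLaw (b : Vec n → Vec n) (ρ : Measure (Vec n)) (γ : ℝ) : ℕ → Measure (Vec n)
  | 0 => ρ
  | k + 1 => stepLaw b (iterLaw b ρ γ k) γ

/-- The densities of the laws of the iterates. -/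
def iterDens (b : Vec n → Vec n) (ρ : Measure (Vec n)) (γ : ℝ) : ℕ → Vec n → ℝ
  | 0 => fun y => (ρ.rnDeriv volume y).toReal
  | k + 1 => mixDens b (iterLaw b ρ γ k) γ

lemma isProbabilityMeasure_iterLaw (hb : Continuous b) (ρ : Measure (Vec n))
    [IsProbabilityMeasure ρ] (γ : ℝ) (k : ℕ) : IsProbabilityMeasure (iterLaw b ρ γ k) := by
  induction k with
  | zero => simpa [iterLaw]
  | succ k ih => exact isProbabilityMeasure_stepLaw hb γ

lemma measurable_iterDens (hb : Continuous b) (ρ : Measure (Vec n)) [IsProbabilityMeasure ρ]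
    {γ : ℝ} (hγ : 0 < γ) (k : ℕ) : Measurable (iterDens b ρ γ k) := by
  cases k with
  | zero => exact (Measure.measurable_rnDeriv ρ volume).ennreal_toReal
  | succ k =>
    have := isProbabilityMeasure_iterLaw hb ρ γ k
    exact (continuous_slice (continuousOn_mixDens hb) hγ).measurable

lemma iterDens_nonneg (hb : Continuous b) (ρ : Measure (Vec n)) [IsProbabilityMeasure ρ]
    {γ : ℝ} (hγ : 0 < γ) (k : ℕ) (y : Vec n) : 0 ≤ iterDens b ρ γ k y := by
  cases k with
  | zero => exact ENNReal.toReal_nonneg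
  | succ k =>
    have := isProbabilityMeasure_iterLaw hb ρ γ k
    exact (mixDens_pos hb hγ y).le

lemma iterLaw_eq_withDensity (hb : Continuous b) {ρ : Measure (Vec n)} [IsProbabilityMeasure ρ]
    (hρ : ρ ≪ volume) {γ : ℝ} (hγ : 0 < γ) (k : ℕ) :
    iterLaw b ρ γ k = volume.withDensity (fun y => ENNReal.ofReal (iterDens b ρ γ k y)) := by
  cases k with
  | zero =>
    rw [iterLaw, ← Measure.withDensity_rnDeriv_eq ρ volume hρ]
    refine withDensity_congr_ae ?_
    filter_upwards [Measure.rnDeriv_lt_top ρ volume] with y hy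
    rw [iterDens, Measure.withDensity_rnDeriv_eq ρ volume hρ, ENNReal.ofReal_toReal hy.ne]
  | succ k =>
    have := isProbabilityMeasure_iterLaw hb ρ γ k
    exact stepLaw_eq_withDensity hb hγ

lemma integrable_sq_iterLaw (hb : Continuous b) {ρ : Measure (Vec n)} [IsProbabilityMeasure ρ]
    (hb2 : Integrable (fun x => ‖b x‖ ^ 2) ρ) (hV : IsPotential V v L)
    (he : ∀ x, ‖b x - v x‖ ≤ e) {γ : ℝ} (hγ : 0 < γ) (k : ℕ) :
    Integrable (fun x => ‖b x‖ ^ 2) (iterLaw b ρ γ k) := by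
  induction k with
  | zero => exact hb2
  | succ k ih =>
    have := isProbabilityMeasure_iterLaw hb ρ γ k
    exact integrable_drift_sq_stepLaw hb ih hV he hγ.le

lemma add_sum_le_of_forall {a A U : ℕ → ℝ≥0∞} (h : ∀ k, a (k + 1) + A k ≤ a k + U k) (N : ℕ) :
    a N + ∑ k ∈ Finset.range N, A k ≤ a 0 + ∑ k ∈ Finset.range N, U k := by
  induction N with
  | zero => simp
  | succ N ih =>
    rw [Finset.sum_range_succ, Finset.sum_range_succ]
    calc _ = (a (N + 1) + A N) + ∑ k ∈ Finset.range N, A k := by ring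
      _ ≤ (a N + U N) + ∑ k ∈ Finset.range N, A k := add_le_add (h N) le_rfl
      _ = (a N + ∑ k ∈ Finset.range N, A k) + U N := by ring
      _ ≤ (a 0 + ∑ k ∈ Finset.range N, U k) + U N := by gcongr
      _ = _ := by ring

/-- The same cutoff and truncation are used in all the steps, so the localized entropy at the end of
one step is the one at the start of the next and the sum telescopes. The initial entropy is at most
the divergence and the final one is dropped. Then `j → ∞`: Fatou's lemma on the left, a vanishing
cutoff error on the right. -/
lemma sum_lintegral_fisher_le (hb : Continuous b) {ρ π : Measure (Vec n)} [IsProbabilityMeasure ρ]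
    [IsProbabilityMeasure π] (hρ : ρ ≪ volume)
    (hb2 : Integrable (fun x => ‖b x‖ ^ 2) ρ) (hV : IsPotential V v L)
    (hπ : π = volume.withDensity (fun x => ENNReal.ofReal (Real.exp (-V x))))
    (he : ∀ x, ‖b x - v x‖ ≤ e) {γ : ℝ} (hγ : 0 < γ) (N : ℕ) :
    ∑ k ∈ Finset.range N, ∫⁻ t in Ioc 0 γ, ENNReal.ofReal (3 / 4 * fisher b (iterLaw b ρ γ k) v t)
      ≤ InformationTheory.klDiv ρ π + ∑ k ∈ Finset.range N,
        ∫⁻ t in Ioc 0 γ, ENNReal.ofReal (driftGap b (iterLaw b ρ γ k) v t) := by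
  have hprob := isProbabilityMeasure_iterLaw hb ρ γ
  have hsq := integrable_sq_iterLaw hb hb2 hV he hγ
  obtain ⟨χ, g, C, hχ, hχ1⟩ := exists_cutoff_sequence n
  set δ : ℕ → ℝ := fun j => 1 / ((j : ℝ) + 2) with hδdef
  have hδ : ∀ j, 0 < δ j := fun j => by positivity
  have hδ1 : ∀ j, δ j < 1 := fun j => by
    rw [hδdef]
    simp only []
    rw [div_lt_one (by positivity)]
    have : (0 : ℝ) ≤ j := Nat.cast_nonneg j
    linarith
  have hδ0 : Tendsto δ atTop (𝓝 0) := by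
    simp only [hδdef, one_div]
    exact (tendsto_atTop_add_const_right _ _ tendsto_natCast_atTop_atTop).inv_tendsto_atTop
  set G : ℕ → ℝ≥0∞ := fun k => ∫⁻ t in Ioc 0 γ, ENNReal.ofReal (driftGap b (iterLaw b ρ γ k) v t)
    with hG
  set M : ℕ → ℝ≥0∞ := fun k => ∫⁻ t in Ioc 0 γ, ENNReal.ofReal
    (∫ x, ‖b x‖ ∂(iterLaw b ρ γ k) + (√(2 * t))⁻¹ * ∫ z, ‖z‖ ∂(stdGaussian (Vec n))) with hM
  have hMtop : ∑ k ∈ Finset.range N, M k ≠ ∞ :=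
    ENNReal.sum_ne_top.2 fun k _ => lintegral_velocity_bound_ne_top _ _ _
  set η : ℕ → ℝ≥0∞ := fun j => ENNReal.ofReal (C / ((j : ℝ) + 1) * -Real.log (δ j)) with hη
  have hη0 : Tendsto η atTop (𝓝 0) := by
    have := ENNReal.tendsto_ofReal (tendsto_cutoff_error C)
    rwa [ENNReal.ofReal_zero] at this
  set A : ℕ → ℝ → ℝ≥0∞ := fun j t => ∑ k ∈ Finset.range N,
    ENNReal.ofReal (3 / 4 * localFisher b (iterLaw b ρ γ k) V v (χ j) (δ j) t) with hA
  have hAm : ∀ j k, AEMeasurable (fun t => ENNReal.ofReal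
      (3 / 4 * localFisher b (iterLaw b ρ γ k) V v (χ j) (δ j) t)) (volume.restrict (Ioc 0 γ)) :=
    fun j k => ((aemeasurable_localFisher hb hV (hχ j) (hδ j) γ).const_mul _).ennreal_ofReal
  have hbound : ∀ j, ∫⁻ t in Ioc 0 γ, A j t
      ≤ InformationTheory.klDiv ρ π
        + (∑ k ∈ Finset.range N, G k + η j * ∑ k ∈ Finset.range N, M k) := by
    intro j
    have h1 := add_sum_le_of_forall (a := fun k => ENNReal.ofReal
      (localEnt (χ j) V (δ j) (iterDens b ρ γ k)))
      (A := fun k => ∫⁻ t in Ioc 0 γ, ENNReal.ofReal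
        (3 / 4 * localFisher b (iterLaw b ρ γ k) V v (χ j) (δ j) t))
      (U := fun k => G k + η j * M k)
      (fun k => localEnt_dissipation hb (integrable_norm_of_sq hb (hsq k)) hV (hχ j) (hδ j) (hδ1 j)
        (fun t ht => integrable_gap hb (hsq k) hV he ht.le) (measurable_iterDens hb ρ hγ k)
        (iterDens_nonneg hb ρ hγ k) (iterLaw_eq_withDensity hb hρ hγ k) hγ) N
    have h2 := ofReal_localEnt_le_klDiv hV (hχ j) (hδ j) (hδ1 j) hπ
      (measurable_iterDens hb ρ hγ 0) (iterDens_nonneg hb ρ hγ 0)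
      (iterLaw_eq_withDensity hb hρ hγ 0)
    rw [Finset.sum_add_distrib, ← Finset.mul_sum] at h1
    simp only [hA]
    rw [lintegral_finsetSum' _ fun k _ => hAm j k]
    exact (le_add_self.trans h1).trans (add_le_add h2 le_rfl)
  have hlim : ∀ t ∈ Ioc 0 γ, liminf (fun j => A j t) atTop = ∑ k ∈ Finset.range N,
      ENNReal.ofReal (3 / 4 * fisher b (iterLaw b ρ γ k) v t) := fun t ht =>
    Tendsto.liminf_eq (tendsto_finsetSum _ fun k _ => ENNReal.tendsto_ofReal
      ((tendsto_localFisher hb (hsq k) hV he ht.1 hχ hχ1 hδ hδ1 hδ0).const_mul _))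
  calc ∑ k ∈ Finset.range N, ∫⁻ t in Ioc 0 γ,
        ENNReal.ofReal (3 / 4 * fisher b (iterLaw b ρ γ k) v t)
      = ∫⁻ t in Ioc 0 γ, liminf (fun j => A j t) atTop := by
        rw [setLIntegral_congr_fun measurableSet_Ioc hlim, lintegral_finsetSum']
        intro k _
        refine (((aestronglyMeasurable_integral_step hb (F := fun t y =>
          ‖relScore b (iterLaw b ρ γ k) v t y‖ ^ 2) ?_ γ).aemeasurable).const_mul _).ennreal_ofReal
        exact (continuousOn_relScore hb hV).norm.pow 2
    _ ≤ liminf (fun j => ∫⁻ t in Ioc 0 γ, A j t) atTop := by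
        refine lintegral_liminf_le' fun j => ?_
        exact Finset.aemeasurable_fun_sum _ fun k _ => hAm j k
    _ ≤ liminf (fun j => InformationTheory.klDiv ρ π
        + (∑ k ∈ Finset.range N, G k + η j * ∑ k ∈ Finset.range N, M k)) atTop :=
        liminf_le_liminf (Eventually.of_forall hbound)
    _ = _ := by
        refine Tendsto.liminf_eq ?_
        have h1 := ENNReal.Tendsto.mul_const hη0 (Or.inr hMtop)
        rw [zero_mul] at h1
        simpa using (h1.const_add (∑ k ∈ Finset.range N, G k)).const_add
          (InformationTheory.klDiv ρ π)

lemma integrable_drift_sq_of_klDiv_ne_top (hb : Continuous b) {ρ π : Measure (Vec n)}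
    [IsProbabilityMeasure ρ] [IsProbabilityMeasure π] (hV : IsPotential V v L)
    (hπ : π = volume.withDensity (fun x => ENNReal.ofReal (Real.exp (-V x))))
    (hkl : InformationTheory.klDiv ρ π ≠ ∞) (he : ∀ x, ‖b x - v x‖ ≤ e) :
    Integrable (fun x => ‖b x‖ ^ 2) ρ := by
  have hvc := hV.continuous_grad
  refine (((hV.integrable_grad_sq_of_klDiv_ne_top hπ hkl).const_mul 2).add
    (integrable_const (2 * e ^ 2))).mono' (Continuous.aestronglyMeasurable (by fun_prop))
    (ae_of_all _ fun x => ?_)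
  rw [Real.norm_of_nonneg (by positivity)]
  have h3 : ‖b x‖ ≤ ‖v x‖ + e := (norm_le_norm_sub_add _ (v x)).trans (by linarith [he x])
  have h4 : ‖b x‖ ^ 2 ≤ (‖v x‖ + e) ^ 2 := by gcongr
  simp only [Pi.add_apply]
  nlinarith [sq_nonneg (‖v x‖ - e)]

/-- Entropy dissipation along the interpolated iterates. -/
lemma sum_lintegral_fisher_le_of_drift (hb : Continuous b) {ρ π : Measure (Vec n)}
    [IsProbabilityMeasure ρ] [IsProbabilityMeasure π] (hV : IsPotential V v L)
    (hπ : π = volume.withDensity (fun x => ENNReal.ofReal (Real.exp (-V x))))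
    (hkl : InformationTheory.klDiv ρ π ≠ ∞)
    (he : ∀ x, ‖b x - v x‖ ≤ e) {γ : ℝ} (hγ : 0 < γ) (hγL : (γ * L) ^ 2 ≤ 1 / 32) (N : ℕ) :
    ∑ k ∈ Finset.range N, ∫⁻ t in Ioc 0 γ, ENNReal.ofReal (fisher b (iterLaw b ρ γ k) v t)
      ≤ ENNReal.ofReal (28 / 17) * (InformationTheory.klDiv ρ π
        + ENNReal.ofReal (N * γ * (7 * n * L ^ 2 * γ + 16 / 7 * e ^ 2))) := by
  have hprob := isProbabilityMeasure_iterLaw hb ρ γ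
  have hρ : ρ ≪ volume := (InformationTheory.klDiv_ne_top_iff.1 hkl).1.trans
    (hπ ▸ withDensity_absolutelyContinuous _ _)
  have hb2 := integrable_drift_sq_of_klDiv_ne_top hb hV hπ hkl he
  have hsq := integrable_sq_iterLaw hb hb2 hV he hγ
  have h1 := sum_lintegral_fisher_le hb hρ hb2 hV hπ he hγ N
  set F := ∑ k ∈ Finset.range N, ∫⁻ t in Ioc 0 γ, ENNReal.ofReal (fisher b (iterLaw b ρ γ k) v t)
    with hF
  set K := 7 * n * L ^ 2 * γ + 16 / 7 * e ^ 2 with hK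
  have hK0 : 0 ≤ K := by positivity
  have h2 : ∑ k ∈ Finset.range N, ∫⁻ t in Ioc 0 γ,
      ENNReal.ofReal (3 / 4 * fisher b (iterLaw b ρ γ k) v t) = ENNReal.ofReal (3 / 4) * F := by
    rw [hF, Finset.mul_sum]
    refine Finset.sum_congr rfl fun k _ => ?_
    rw [← lintegral_const_mul' _ _ ENNReal.ofReal_ne_top]
    simp_rw [← ENNReal.ofReal_mul (show (0 : ℝ) ≤ 3 / 4 by norm_num)]
  have h3 : ∑ k ∈ Finset.range N, ∫⁻ t in Ioc 0 γ, ENNReal.ofReal (driftGap b (iterLaw b ρ γ k) v t)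
      ≤ ENNReal.ofReal (1 / 7) * F + ENNReal.ofReal (N * γ * K) := by
    have h4 : ∀ k, ∫⁻ t in Ioc 0 γ, ENNReal.ofReal (driftGap b (iterLaw b ρ γ k) v t)
        ≤ ENNReal.ofReal (1 / 7) * (∫⁻ t in Ioc 0 γ, ENNReal.ofReal (fisher b (iterLaw b ρ γ k) v t))
          + ENNReal.ofReal (γ * K) := by
      intro k
      have h5 : ∫⁻ t in Ioc 0 γ, ENNReal.ofReal K = ENNReal.ofReal (γ * K) := by
        rw [setLIntegral_const, Real.volume_Ioc, sub_zero, mul_comm, ENNReal.ofReal_mul hγ.le]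
      rw [← lintegral_const_mul' _ _ ENNReal.ofReal_ne_top, ← h5,
        ← lintegral_add_right _ measurable_const]
      refine setLIntegral_mono' measurableSet_Ioc fun t ht => ?_
      have hF0 : 0 ≤ fisher b (iterLaw b ρ γ k) v t := integral_nonneg fun q => by positivity
      rw [← ENNReal.ofReal_mul (by norm_num), ← ENNReal.ofReal_add (by positivity) hK0]
      refine ENNReal.ofReal_le_ofReal ((driftGap_le hb (hsq k) hV he ht.1 ht.2 hγL).trans (le_of_eq ?_))
      rw [hK]; ring
    refine (Finset.sum_le_sum fun k _ => h4 k).trans (le_of_eq ?_)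
    rw [Finset.sum_add_distrib, ← Finset.mul_sum, Finset.sum_const, Finset.card_range, nsmul_eq_mul,
      mul_assoc (N : ℝ), ENNReal.ofReal_mul (Nat.cast_nonneg N), ENNReal.ofReal_natCast]
  rw [h2] at h1
  -- Subtracting `F / 7` from both sides is legitimate only once `F` is known to be finite.
  have hFtop : F ≠ ∞ := by
    have h6 : ENNReal.ofReal (3 / 4) * F ≠ ∞ := ne_top_of_le_ne_top (ENNReal.add_ne_top.2 ⟨hkl,
      ENNReal.sum_ne_top.2 fun k _ => lintegral_driftGap_ne_top hb (hsq k) hV he γ⟩) h1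
    intro h7
    exact h6 (by rw [h7, ENNReal.mul_top (by simp)])
  have h8 := h1.trans (add_le_add_right h3 _)
  lift F to ℝ≥0 using hFtop with f
  generalize InformationTheory.klDiv ρ π = D at *
  lift D to ℝ≥0 using hkl with d
  have hX : 0 ≤ N * γ * K := by positivity
  generalize N * γ * K = X at *
  rw [← ENNReal.ofReal_coe_nnreal (p := f), ← ENNReal.ofReal_coe_nnreal (p := d)] at *
  rw [← ENNReal.ofReal_mul (by norm_num), ← ENNReal.ofReal_mul (by norm_num),
    ← ENNReal.ofReal_add (by positivity) hX, ← ENNReal.ofReal_add (by positivity) (by positivity),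
    ENNReal.ofReal_le_ofReal_iff (by positivity)] at h8
  rw [← ENNReal.ofReal_add (by positivity) hX, ← ENNReal.ofReal_mul (by norm_num)]
  -- `3/4 - 1/7 = 17/28`.
  exact ENNReal.ofReal_le_ofReal (by linarith)

end

section

/-! ### Laws of the iterates -/

section Independence

variable {Ω : Type*} [MeasurableSpace Ω] {P : Measure Ω} [IsProbabilityMeasure P]

/-- If the pairs `(F i, G i)` are independent and each of them has independent components, then the
families `F` and `G` are independent. -/
lemma indepFun_pi_of_iIndepFun_prod {ι : Type*} [Fintype ι] {α β : Type*} [MeasurableSpace α]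
    [MeasurableSpace β] {F : ι → Ω → α} {G : ι → Ω → β} (hF : ∀ i, Measurable (F i))
    (hG : ∀ i, Measurable (G i)) (h : iIndepFun (fun i ω => (F i ω, G i ω)) P)
    (hFG : ∀ i, IndepFun (F i) (G i) P) :
    IndepFun (fun ω i => F i ω) (fun ω i => G i ω) P := by
  have hFi : iIndepFun F P := h.comp (fun _ => Prod.fst) fun _ => measurable_fst
  have hGi : iIndepFun G P := h.comp (fun _ => Prod.snd) fun _ => measurable_snd
  have hpF : ∀ i, IsProbabilityMeasure (P.map (F i)) :=
    fun i => Measure.isProbabilityMeasure_map (hF i).aemeasurable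
  have hpG : ∀ i, IsProbabilityMeasure (P.map (G i)) :=
    fun i => Measure.isProbabilityMeasure_map (hG i).aemeasurable
  rw [indepFun_iff_map_prod_eq_prod_map_map (measurable_pi_lambda _ hF).aemeasurable
    (measurable_pi_lambda _ hG).aemeasurable,
    (iIndepFun_iff_map_fun_eq_pi_map fun i => (hF i).aemeasurable).1 hFi,
    (iIndepFun_iff_map_fun_eq_pi_map fun i => (hG i).aemeasurable).1 hGi,
    ← (measurePreserving_arrowProdEquivProdArrow α β ι (fun i => P.map (F i))
      (fun i => P.map (G i))).map_eq]
  have h1 : Measure.pi (fun i => (P.map (F i)).prod (P.map (G i)))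
      = P.map (fun ω i => (F i ω, G i ω)) := by
    rw [(iIndepFun_iff_map_fun_eq_pi_map fun i => ((hF i).prodMk (hG i)).aemeasurable).1 h]
    congr 1
    ext1 i
    exact ((indepFun_iff_map_prod_eq_prod_map_map (hF i).aemeasurable (hG i).aemeasurable).1
      (hFG i)).symm
  rw [h1, Measure.map_map (MeasurableEquiv.measurable _)
    (measurable_pi_lambda _ fun i => (hF i).prodMk (hG i))]
  rfl

/-- If `X` is independent of `(Y, Z)` and `Y` is independent of `Z`, then `(X, Y)` is independent
of `Z`. -/
lemma indepFun_prodMk_of_indepFun {α β β' : Type*} [MeasurableSpace α]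
    [MeasurableSpace β] [MeasurableSpace β'] {X : Ω → α} {Y : Ω → β} {Z : Ω → β'}
    (hX : Measurable X) (hY : Measurable Y) (hZ : Measurable Z)
    (h : IndepFun X (fun ω => (Y ω, Z ω)) P) (hYZ : IndepFun Y Z P) :
    IndepFun (fun ω => (X ω, Y ω)) Z P := by
  have hpX : IsProbabilityMeasure (P.map X) := Measure.isProbabilityMeasure_map hX.aemeasurable
  have hpY : IsProbabilityMeasure (P.map Y) := Measure.isProbabilityMeasure_map hY.aemeasurable
  have hpZ : IsProbabilityMeasure (P.map Z) := Measure.isProbabilityMeasure_map hZ.aemeasurable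
  have hXY : IndepFun X Y P := h.comp measurable_id measurable_fst
  rw [indepFun_iff_map_prod_eq_prod_map_map (hX.prodMk hY).aemeasurable hZ.aemeasurable,
    (indepFun_iff_map_prod_eq_prod_map_map hX.aemeasurable hY.aemeasurable).1 hXY]
  have h1 := (indepFun_iff_map_prod_eq_prod_map_map hX.aemeasurable
    (hY.prodMk hZ).aemeasurable).1 h
  -- The law of `(X, (Y, Z))` is a triple product; reassociating it gives the claim.
  rw [(indepFun_iff_map_prod_eq_prod_map_map hY.aemeasurable hZ.aemeasurable).1 hYZ,
    ← Measure.prodAssoc_prod] at h1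
  have h2 := congrArg (Measure.map MeasurableEquiv.prodAssoc.symm) h1
  rw [Measure.map_map (by fun_prop) (by fun_prop), Measure.map_map (by fun_prop) (by fun_prop),
    MeasurableEquiv.symm_comp_self, Measure.map_id] at h2
  exact h2

end Independence

variable {n : ℕ} {Ω : Type*} [MeasurableSpace Ω] {P : Measure Ω} [IsProbabilityMeasure P]
  {B : ℝ≥0 → Ω → Vec n} {x₀ : Ω → Vec n}

/-- The starting point and the path of the driving motion until time `t`. -/
def history (x₀ : Ω → Vec n) (B : ℝ≥0 → Ω → Vec n) (t : ℝ≥0) (ω : Ω) :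
    Vec n × (Fin n → Iic t → ℝ) :=
  (x₀ ω, fun i s => B s ω i)

/-- In each coordinate the shifted path is independent of the past. Independence of the coordinates
makes this joint, and independence of `x₀` from the whole path adds the starting point to the past.
-/
lemma IsBrownianMotion.indepFun_increment (hB : IsBrownianMotion B P) (hx₀ : Measurable x₀)
    (hx₀B : IndepFun x₀ (fun ω t => B t ω) P) (t s : ℝ≥0) :
    IndepFun (history x₀ B t) (fun ω => B (t + s) ω - B t ω) P := by
  have hBm : ∀ t i, Measurable fun ω => B t ω i := fun t i => by
    have := hB.measurable t
    fun_prop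
  set F : Fin n → Ω → (ℝ≥0 → ℝ) := fun i ω s => B (t + s) ω i - B t ω i with hF
  set G : Fin n → Ω → (Iic t → ℝ) := fun i ω s => B s ω i with hG
  have hFm : ∀ i, Measurable (F i) := fun i => measurable_pi_lambda _ fun s => (hBm _ i).sub (hBm _ i)
  have hGm : ∀ i, Measurable (G i) := fun i => measurable_pi_lambda _ fun s => hBm _ i
  have hFG : IndepFun (fun ω i => F i ω) (fun ω i => G i ω) P := by
    refine indepFun_pi_of_iIndepFun_prod hFm hGm ?_ fun i =>
      (hB.isBrownianReal i).toIsPreBrownianReal.indepFun_shift t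
    exact hB.iIndepFun.comp (fun i (w : ℝ≥0 → ℝ) =>
      ((fun s => w (t + s) - w t : ℝ≥0 → ℝ), (fun s => w s : Iic t → ℝ))) fun i => by fun_prop
  have h1 : IndepFun x₀ (fun ω => ((fun i => G i ω), (fun i => F i ω))) P := by
    refine hx₀B.comp measurable_id (ψ := fun w : ℝ≥0 → Vec n =>
      ((fun i s => w s i : Fin n → Iic t → ℝ),
        (fun i s => w (t + s) i - w t i : Fin n → ℝ≥0 → ℝ))) ?_
    fun_prop
  have h2 := indepFun_prodMk_of_indepFun hx₀ (measurable_pi_lambda _ hGm)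
    (measurable_pi_lambda _ hFm) h1 hFG.symm
  have h3 := h2.comp measurable_id (ψ := fun w : Fin n → ℝ≥0 → ℝ =>
    (WithLp.toLp 2 fun i => w i s : Vec n)) (by fun_prop)
  exact h3

lemma IsBrownianMotion.map_increment (hB : IsBrownianMotion B P) (t s : ℝ≥0) :
    P.map (fun ω => B (t + s) ω - B t ω)
      = (stdGaussian (Vec n)).map (fun z => √(s : ℝ) • z) := by
  have hBm : ∀ t i, Measurable fun ω => B t ω i := fun t i => by
    have := hB.measurable t
    fun_prop
  have hi : ProbabilityTheory.iIndepFun (fun (i : Fin n) ω => B (t + s) ω i - B t ω i) P :=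
    hB.iIndepFun.comp (fun i (w : ℝ≥0 → ℝ) => w (t + s) - w t) fun i => by fun_prop
  have h1 := (iIndepFun_iff_map_fun_eq_pi_map fun i => ((hBm (t + s) i).sub (hBm t i)).aemeasurable).1 hi
  have h2 : ∀ i, P.map (fun ω => B (t + s) ω i - B t ω i)
      = (gaussianReal 0 1).map (fun x => √(s : ℝ) * x) := by
    intro i
    have h3 := ((hB.isBrownianReal i).toIsPreBrownianReal.hasLaw_sub (t + s) t).map_eq
    have h4 : (fun ω => B (t + s) ω i) - (fun ω => B t ω i) = fun ω => B (t + s) ω i - B t ω i := rfl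
    rw [h4] at h3
    rw [h3, gaussianReal_map_const_mul, mul_zero]
    congr 1
    ext
    simp
  replace h1 := h1.trans (congrArg Measure.pi (funext h2))
  have h5 : (fun ω => B (t + s) ω - B t ω)
      = fun ω => (WithLp.toLp 2 fun i => B (t + s) ω i - B t ω i : Vec n) := rfl
  rw [h5, ← map_pi_eq_stdGaussian, Measure.map_map (by fun_prop) (by fun_prop)]
  have h6 : (fun z : Vec n => √(s : ℝ) • z) ∘ WithLp.toLp 2
      = WithLp.toLp 2 ∘ fun (x : Fin n → ℝ) i => √(s : ℝ) * x i := rfl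
  rw [h6, ← Measure.map_map (by fun_prop) (by fun_prop), Measure.pi_map_pi fun i => by fun_prop,
    ← h1, Measure.map_map (by fun_prop)
      (measurable_pi_lambda _ fun i => (hBm (t + s) i).sub (hBm t i))]
  rfl

/-- A variable determined by the history is independent of the next increment, which is distributed
as `√s Z`; together with the factor `√2` this is the noise `√(2s) Z` of a step. -/
lemma map_step_increment {b : Vec n → Vec n} (hb : Continuous b) (hB : IsBrownianMotion B P)
    (hx₀ : Measurable x₀) (hx₀B : IndepFun x₀ (fun ω t => B t ω) P) (t s : ℝ≥0) {X : Ω → Vec n}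
    (hX : Measurable[MeasurableSpace.comap (history x₀ B t) inferInstance] X) :
    P.map (fun ω => X ω - (s : ℝ) • b (X ω) + √2 • (B (t + s) ω - B t ω))
      = stepLaw b (P.map X) s := by
  have hH : Measurable (history x₀ B t) := by
    have := hB.measurable
    unfold history
    fun_prop
  have hXm : Measurable X := hX.mono hH.comap_le le_rfl
  have hD : Measurable fun ω => B (t + s) ω - B t ω := (hB.measurable _).sub (hB.measurable _)
  have hind : IndepFun X (fun ω => B (t + s) ω - B t ω) P := by
    have h1 := hB.indepFun_increment hx₀ hx₀B t s
    rw [IndepFun_iff_Indep] at h1 ⊢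
    exact indep_of_indep_of_le_left h1 hX.comap_le
  have hpX : IsProbabilityMeasure (P.map X) := Measure.isProbabilityMeasure_map hXm.aemeasurable
  have h2 := (indepFun_iff_map_prod_eq_prod_map_map hXm.aemeasurable hD.aemeasurable).1 hind
  rw [hB.map_increment, ← Measure.map_id (μ := P.map X), Measure.map_prod_map _ _ measurable_id
    (by fun_prop)] at h2
  have h3 := congrArg (Measure.map fun p : Vec n × Vec n => p.1 - (s : ℝ) • b p.1 + √2 • p.2) h2
  rw [Measure.map_map (by fun_prop) (hXm.prodMk hD), Measure.map_map (by fun_prop) (by fun_prop)] at h3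
  rw [stepLaw]
  refine h3.trans ?_
  congr 1
  ext1 q
  simp [step, smul_smul]

omit [MeasurableSpace Ω] in
lemma comap_history_mono {t t' : ℝ≥0} (h : t ≤ t') :
    MeasurableSpace.comap (history x₀ B t) inferInstance
      ≤ MeasurableSpace.comap (history x₀ B t') inferInstance := by
  have h1 : history x₀ B t = (fun w : Vec n × (Fin n → Iic t' → ℝ) =>
      ((w.1, fun i s => w.2 i ⟨s, s.2.trans h⟩) : Vec n × (Fin n → Iic t → ℝ)))
        ∘ history x₀ B t' := rfl
  rw [h1, ← MeasurableSpace.comap_comp]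
  refine MeasurableSpace.comap_mono (Measurable.comap_le ?_)
  fun_prop

omit [MeasurableSpace Ω] in
lemma measurable_history_eval {s t : ℝ≥0} (h : s ≤ t) :
    Measurable[MeasurableSpace.comap (history x₀ B t) inferInstance] (B s) := by
  have h1 : B s = (fun w : Vec n × (Fin n → Iic t → ℝ) =>
      (WithLp.toLp 2 fun i => w.2 i ⟨s, h⟩ : Vec n)) ∘ history x₀ B t := rfl
  rw [h1]
  refine Measurable.comp ?_ (comap_measurable _)
  fun_prop

variable {γ : ℝ} {f : Vec n → ℝ} {S : Vec n → Vec n}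

omit [MeasurableSpace Ω] in
lemma pmcPnP_succ (hγ : 0 < γ) (k : ℕ) (ω : Ω) :
    pmcPnP γ f S x₀ B (k + 1) ω = pmcPnP γ f S x₀ B k ω
      - γ • pnpDrift γ f S (pmcPnP γ f S x₀ B k ω)
      + √2 • (B ((k + 1) * γ).toNNReal ω - B (k * γ).toNNReal ω) := by
  rw [pmcPnP, noise, smul_smul, Real.sqrt_mul (by norm_num), mul_inv_cancel_right₀ (by positivity)]

omit [MeasurableSpace Ω] in
lemma measurable_pmcPnP (hb : Continuous (pnpDrift γ f S)) (hγ : 0 < γ) (k : ℕ) :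
    Measurable[MeasurableSpace.comap (history x₀ B (k * γ).toNNReal) inferInstance]
      (pmcPnP γ f S x₀ B k) := by
  induction k with
  | zero =>
    have h1 : pmcPnP γ f S x₀ B 0 = Prod.fst ∘ history x₀ B ((0 : ℕ) * γ).toNNReal := rfl
    rw [h1]
    exact measurable_fst.comp (comap_measurable _)
  | succ k ih =>
    have hle : (k * γ).toNNReal ≤ ((k + 1 : ℕ) * γ).toNNReal := by
      refine Real.toNNReal_le_toNNReal ?_
      push_cast
      nlinarith
    have h1 := ih.mono (comap_history_mono hle) le_rfl
    have h2 := measurable_history_eval (x₀ := x₀) (B := B) hle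
    have h3 := measurable_history_eval (x₀ := x₀) (B := B) (le_refl ((k + 1 : ℕ) * γ).toNNReal)
    have h4 : pmcPnP γ f S x₀ B (k + 1) = fun ω => pmcPnP γ f S x₀ B k ω
      - γ • pnpDrift γ f S (pmcPnP γ f S x₀ B k ω)
      + √2 • (B ((k + 1 : ℕ) * γ).toNNReal ω - B (k * γ).toNNReal ω) := by
      ext1 ω
      rw [pmcPnP_succ hγ]
      push_cast
      rfl
    rw [h4]
    exact (h1.sub ((hb.measurable.comp h1).const_smul γ)).add ((h3.sub h2).const_smul √2)

lemma map_pmcPnP_step (hb : Continuous (pnpDrift γ f S)) (hγ : 0 < γ) (hB : IsBrownianMotion B P)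
    (hx₀ : Measurable x₀) (hx₀B : IndepFun x₀ (fun ω t => B t ω) P) (k : ℕ) {s : ℝ} (hs : 0 ≤ s) :
    P.map (fun ω => pmcPnP γ f S x₀ B k ω - s • pnpDrift γ f S (pmcPnP γ f S x₀ B k ω)
        + √2 • (B (k * γ + s).toNNReal ω - B (k * γ).toNNReal ω))
      = stepLaw (pnpDrift γ f S) (P.map (pmcPnP γ f S x₀ B k)) s := by
  have h1 := map_step_increment hb hB hx₀ hx₀B (k * γ).toNNReal s.toNNReal
    (measurable_pmcPnP hb hγ k)
  rwa [← Real.toNNReal_add (by positivity) hs, Real.coe_toNNReal s hs] at h1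

lemma map_pmcPnP (hb : Continuous (pnpDrift γ f S)) (hγ : 0 < γ) (hB : IsBrownianMotion B P)
    (hx₀ : Measurable x₀) (hx₀B : IndepFun x₀ (fun ω t => B t ω) P) (k : ℕ) :
    P.map (pmcPnP γ f S x₀ B k) = iterLaw (pnpDrift γ f S) (P.map x₀) γ k := by
  induction k with
  | zero => rfl
  | succ k ih =>
    rw [iterLaw, ← ih, ← map_pmcPnP_step hb hγ hB hx₀ hx₀B k hγ.le]
    congr 1
    ext1 ω
    rw [pmcPnP_succ hγ]
    ring_nf

/-- Strictness of `s < γ` keeps the floor equal to `k`. The right end point is not needed, as it is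
null in the time integral. -/
lemma interpolationLaw_eq (hb : Continuous (pnpDrift γ f S)) (hγ : 0 < γ)
    (hB : IsBrownianMotion B P) (hx₀ : Measurable x₀)
    (hx₀B : IndepFun x₀ (fun ω t => B t ω) P) (k : ℕ) {s : ℝ} (hs : 0 ≤ s) (hsγ : s < γ) :
    interpolationLaw P γ f S x₀ B (k * γ + s)
      = stepLaw (pnpDrift γ f S) (iterLaw (pnpDrift γ f S) (P.map x₀) γ k) s := by
  have hk : ⌊(k * γ + s) / γ⌋₊ = k := by
    rw [Nat.floor_eq_iff (by positivity), le_div_iff₀ hγ, div_lt_iff₀ hγ]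
    constructor <;> linarith
  rw [← map_pmcPnP hb hγ hB hx₀ hx₀B, ← map_pmcPnP_step hb hγ hB hx₀ hx₀B k hs, interpolationLaw]
  congr 1
  ext1 ω
  rw [interpolation, hk, add_sub_cancel_left]

omit [IsProbabilityMeasure P] in
lemma interpolationLaw_zero : interpolationLaw P γ f S x₀ B 0 = P.map x₀ := by
  rw [interpolationLaw]
  congr 1
  ext1 ω
  simp [interpolation, pmcPnP]

end

section

/-! ### The posterior as a Gibbs measure -/

variable {n : ℕ} {ℓ p : Vec n → ℝ}

/-- The potential `V` for which the posterior has the density `exp (-V)`. -/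
def potential (ℓ p : Vec n → ℝ) (x : Vec n) : ℝ :=
  dataFidelity ℓ x - Real.log (p x) + Real.log (∫ z, ℓ z * p z)

/-- The gradient of the potential. -/
def potentialGrad (ℓ p : Vec n → ℝ) (x : Vec n) : Vec n :=
  gradient (dataFidelity ℓ) x - score p x

lemma integral_likelihood_pos (hℓ : ∀ x, 0 < ℓ x) (hp : ∀ x, 0 < p x)
    (hℓp : Integrable (fun x => ℓ x * p x)) : 0 < ∫ x, ℓ x * p x := by
  have h0 : ∀ x, 0 < ℓ x * p x := fun x => mul_pos (hℓ x) (hp x)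
  rw [integral_pos_iff_support_of_nonneg (fun x => (h0 x).le) hℓp]
  have : Function.support (fun x => ℓ x * p x) = univ := by
    ext x
    simpa using (h0 x).ne'
  rw [this]
  exact Measure.measure_univ_pos.2 (NeZero.ne _)

lemma exp_neg_potential (hℓ : ∀ x, 0 < ℓ x) (hp : ∀ x, 0 < p x)
    (hℓp : Integrable (fun x => ℓ x * p x)) (x : Vec n) :
    Real.exp (-potential ℓ p x) = ℓ x * p x / ∫ z, ℓ z * p z := by
  have hZ := integral_likelihood_pos hℓ hp hℓp
  have h1 : -potential ℓ p x = Real.log (ℓ x * p x / ∫ z, ℓ z * p z) := by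
    rw [Real.log_div (mul_pos (hℓ x) (hp x)).ne' hZ.ne', Real.log_mul (hℓ x).ne' (hp x).ne',
      potential, dataFidelity]
    ring
  rw [h1, Real.exp_log (div_pos (mul_pos (hℓ x) (hp x)) hZ)]

lemma posterior_eq (hℓ : ∀ x, 0 < ℓ x) (hp : ∀ x, 0 < p x)
    (hℓp : Integrable (fun x => ℓ x * p x)) :
    posterior ℓ p = volume.withDensity (fun x => ENNReal.ofReal (Real.exp (-potential ℓ p x))) := by
  simp_rw [exp_neg_potential hℓ hp hℓp]
  rfl

lemma isProbabilityMeasure_posterior (hℓ : ∀ x, 0 < ℓ x) (hp : ∀ x, 0 < p x)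
    (hℓp : Integrable (fun x => ℓ x * p x)) : IsProbabilityMeasure (posterior ℓ p) := by
  have hZ := integral_likelihood_pos hℓ hp hℓp
  refine ⟨?_⟩
  rw [posterior, withDensity_apply _ MeasurableSet.univ, Measure.restrict_univ,
    ← ofReal_integral_eq_lintegral_ofReal (hℓp.div_const _)
      (ae_of_all _ fun x => (div_pos (mul_pos (hℓ x) (hp x)) hZ).le), integral_div, div_self hZ.ne',
    ENNReal.ofReal_one]

lemma gradient_dataFidelity (x : Vec n) : gradient (dataFidelity ℓ) x = -score ℓ x := by
  have h1 : dataFidelity ℓ = -fun x => Real.log (ℓ x) := rfl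
  rw [score, gradient, gradient, h1, fderiv_neg, map_neg]

lemma isPotential_potential {Lg Lp L : ℝ}
    (hℓ_diff : Differentiable ℝ (fun x => Real.log (ℓ x)))
    (hℓ_lip : ∀ x₁ x₂, ‖score ℓ x₁ - score ℓ x₂‖ ≤ Lg * ‖x₁ - x₂‖)
    (hp_diff : Differentiable ℝ (fun x => Real.log (p x)))
    (hp_lip : ∀ x₁ x₂, ‖score p x₁ - score p x₂‖ ≤ Lp * ‖x₁ - x₂‖) (hL : Lg + Lp ≤ L)
    (hL0 : 0 ≤ L) : IsPotential (potential ℓ p) (potentialGrad ℓ p) L := by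
  refine ⟨fun x => ?_, fun x y => ?_, hL0⟩
  · have h1 := (hℓ_diff x).hasGradientAt.hasFDerivAt
    have h2 := (hp_diff x).hasGradientAt.hasFDerivAt
    have h3 := ((h1.neg.sub h2).add_const (Real.log (∫ z, ℓ z * p z)))
    rw [hasGradientAt_iff_hasFDerivAt]
    refine h3.congr_fderiv ?_
    rw [potentialGrad, gradient_dataFidelity, map_sub, map_neg]
    rfl
  · have h1 : potentialGrad ℓ p x - potentialGrad ℓ p y
        = -((score ℓ x - score ℓ y) + (score p x - score p y)) := by
      simp only [potentialGrad, gradient_dataFidelity]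
      abel
    rw [h1, norm_neg]
    calc _ ≤ Lg * ‖x - y‖ + Lp * ‖x - y‖ :=
          (norm_add_le _ _).trans (add_le_add (hℓ_lip x y) (hp_lip x y))
      _ = (Lg + Lp) * ‖x - y‖ := by ring
      _ ≤ _ := by gcongr

lemma continuous_of_norm_sub_le {f : Vec n → Vec n} {K : ℝ} (hK : 0 ≤ K)
    (h : ∀ x y, ‖f x - f y‖ ≤ K * ‖x - y‖) : Continuous f :=
  (LipschitzWith.of_dist_le_mul (K := ⟨K, hK⟩) fun x y => by
    rw [dist_eq_norm, dist_eq_norm]; exact h x y).continuous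

lemma continuous_pnpDrift {γ Lg Lσ : ℝ} {S : Vec n → Vec n} (hLg : 0 ≤ Lg) (hLσ : 0 ≤ Lσ)
    (hℓ_lip : ∀ x₁ x₂, ‖score ℓ x₁ - score ℓ x₂‖ ≤ Lg * ‖x₁ - x₂‖)
    (hS_lip : ∀ x₁ x₂, ‖S x₁ - S x₂‖ ≤ Lσ * ‖x₁ - x₂‖) :
    Continuous (pnpDrift γ (dataFidelity ℓ) S) := by
  have h1 : Continuous (score ℓ) := continuous_of_norm_sub_le hLg hℓ_lip
  have h2 : Continuous S := continuous_of_norm_sub_le hLσ hS_lip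
  have h3 : pnpDrift γ (dataFidelity ℓ) S = fun x => -score ℓ x - S (x - γ • -score ℓ x) := by
    ext1 x
    rw [pnpDrift, gradient_dataFidelity]
  rw [h3]
  fun_prop

/-- Three errors add up: the network is evaluated after a gradient step of length at most `γ Rg`, it
approximates the smoothed score, and the smoothed score differs from that of the prior. -/
lemma norm_pnpDrift_sub_le {γ Lσ Rg ε δ : ℝ} {S s : Vec n → Vec n} (hγ : 0 ≤ γ) (hLσ : 0 ≤ Lσ)
    (hS_lip : ∀ x₁ x₂, ‖S x₁ - S x₂‖ ≤ Lσ * ‖x₁ - x₂‖) (hS_err : ∀ x, ‖S x - s x‖ ≤ ε)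
    (hs : ∀ x, ‖s x - score p x‖ ≤ δ) (hg : ∀ x, ‖gradient (dataFidelity ℓ) x‖ ≤ Rg) (x : Vec n) :
    ‖pnpDrift γ (dataFidelity ℓ) S x - potentialGrad ℓ p x‖ ≤ Lσ * γ * Rg + ε + δ := by
  set w := gradient (dataFidelity ℓ) x with hw
  have h1 : pnpDrift γ (dataFidelity ℓ) S x - potentialGrad ℓ p x
      = -((S (x - γ • w) - S x) + (S x - s x) + (s x - score p x)) := by
    rw [pnpDrift, potentialGrad, ← hw]
    abel
  have h2 : ‖S (x - γ • w) - S x‖ ≤ Lσ * γ * Rg := by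
    refine (hS_lip _ _).trans ?_
    rw [sub_sub_cancel_left, norm_neg, norm_smul, Real.norm_of_nonneg hγ, mul_assoc]
    gcongr
    exact hg x
  rw [h1, norm_neg]
  exact (norm_add₃_le).trans (add_le_add (add_le_add h2 (hS_err x)) (hs x))

/-! ### Integration over the iterations -/

/-- Only a union bound is used, so `f` need not be measurable. This matters because the Fisher
information is defined as an infimum. -/
lemma lintegral_Icc_mul_le_sum (f : ℝ → ℝ≥0∞) (γ : ℝ) (N : ℕ) :
    ∫⁻ t in Icc 0 (N * γ), f t ≤ ∑ k ∈ Finset.range N, ∫⁻ s in Ioo 0 γ, f (k * γ + s) := by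
  rw [Measure.restrict_congr_set Ioc_ae_eq_Icc.symm]
  induction N with
  | zero => simp
  | succ N ih =>
    have h1 : Ioc 0 (((N + 1 : ℕ) : ℝ) * γ) ⊆ Ioc 0 (N * γ) ∪ Ioc (N * γ + 0) (N * γ + γ) := by
      intro t ht
      rcases le_or_gt t (N * γ) with h | h
      · exact Or.inl ⟨ht.1, h⟩
      · refine Or.inr ⟨by simpa using h, ht.2.trans (le_of_eq ?_)⟩
        push_cast
        ring
    have h2 : ∫⁻ t in Ioc (N * γ + 0) (N * γ + γ), f t = ∫⁻ s in Ioo 0 γ, f (N * γ + s) := by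
      rw [← (measurePreserving_add_left volume (N * γ)).setLIntegral_comp_preimage_emb
        (measurableEmbedding_addLeft _), preimage_const_add_Ioc, add_sub_cancel_left,
        add_sub_cancel_left, Measure.restrict_congr_set Ioo_ae_eq_Ioc]
    rw [Finset.sum_range_succ, ← h2]
    exact (lintegral_mono_set h1).trans ((lintegral_union_le _ _ _).trans (add_le_add ih le_rfl))

lemma lintegral_relFisherInfo_le {b : Vec n → Vec n} {V : Vec n → ℝ} {v : Vec n → Vec n} {L e : ℝ}
    (hb : Continuous b) {ρ π : Measure (Vec n)} [IsProbabilityMeasure ρ] [IsProbabilityMeasure π]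
    (hV : IsPotential V v L)
    (hπ : π = volume.withDensity (fun x => ENNReal.ofReal (Real.exp (-V x))))
    (hkl : InformationTheory.klDiv ρ π ≠ ∞) (he : ∀ x, ‖b x - v x‖ ≤ e) {γ : ℝ} (hγ : 0 < γ)
    (hγL : (γ * L) ^ 2 ≤ 1 / 32) (N : ℕ) {ν : ℝ → Measure (Vec n)}
    (hν : ∀ (k : ℕ) (s : ℝ), 0 < s → s < γ → ν (k * γ + s) = stepLaw b (iterLaw b ρ γ k) s) :
    ∫⁻ t in Icc 0 (N * γ), relFisherInfo (ν t) π
      ≤ ENNReal.ofReal (28 / 17) * (InformationTheory.klDiv ρ π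
        + ENNReal.ofReal (N * γ * (7 * n * L ^ 2 * γ + 16 / 7 * e ^ 2))) := by
  refine (lintegral_Icc_mul_le_sum _ γ N).trans (le_trans (Finset.sum_le_sum fun k _ => ?_)
    (sum_lintegral_fisher_le_of_drift hb hV hπ hkl he hγ hγL N))
  have hprob := isProbabilityMeasure_iterLaw hb ρ γ
  have hsq := integrable_sq_iterLaw hb (integrable_drift_sq_of_klDiv_ne_top hb hV hπ hkl he) hV he hγ
  rw [Measure.restrict_congr_set Ioo_ae_eq_Ioc.symm]
  refine setLIntegral_mono' measurableSet_Ioo fun s hs => ?_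
  rw [hν k s hs.1 hs.2]
  refine (relFisherInfo_stepLaw_le hb hV hπ hs.1).trans (le_of_eq ?_)
  rw [fisher, ofReal_integral_eq_lintegral_ofReal (integrable_relScore_sq hb (hsq k) hV he hs.1)
    (ae_of_all _ fun q => by positivity)]
  simp_rw [← ofReal_norm, ENNReal.ofReal_pow (norm_nonneg _)]

/-- The square of three terms costs a factor `3`, and `γ Lσ ≤ γ L ≤ 1/√32 < 1/5` lowers one power of
`γ Lσ`. The resulting constants, about `11.6`, `2.3` and `11.3`, lie below `24`, `7` and `36`. -/
lemma drift_error_le {n : ℕ} {γ L Lσ Rg ε a : ℝ} (hγ : 0 < γ) (hLσ : 0 < Lσ) (hLσL : Lσ ≤ L)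
    (hγL : (γ * L) ^ 2 ≤ 1 / 32) :
    28 / 17 * (7 * n * L ^ 2 * γ + 16 / 7 * (Lσ * γ * Rg + ε + a) ^ 2)
      ≤ (24 * n * L ^ 2 + 7 * Lσ * Rg ^ 2) * γ + 36 * a ^ 2 + 36 * ε ^ 2 := by
  have h1 : (Lσ * γ * Rg + ε + a) ^ 2 ≤ 3 * ((Lσ * γ * Rg) ^ 2 + ε ^ 2 + a ^ 2) := by
    nlinarith [sq_nonneg (Lσ * γ * Rg - ε), sq_nonneg (Lσ * γ * Rg - a), sq_nonneg (ε - a)]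
  have h2 : γ * Lσ ≤ 1 / 5 := by
    have h3 : γ * Lσ ≤ γ * L := by gcongr
    have h4 : 0 < γ * Lσ := by positivity
    nlinarith
  have h5 : (Lσ * γ * Rg) ^ 2 ≤ 1 / 5 * (Lσ * Rg ^ 2 * γ) := by
    calc (Lσ * γ * Rg) ^ 2 = (γ * Lσ) * (Lσ * Rg ^ 2 * γ) := by ring
      _ ≤ _ := by gcongr
  have h6 : 0 ≤ Lσ * Rg ^ 2 * γ := by positivity
  have h7 : 0 ≤ n * L ^ 2 * γ := by positivity
  nlinarith [sq_nonneg ε, sq_nonneg a]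

lemma div_le_of_le_mul_add {F D : ℝ≥0∞} {T K W : ℝ} (hT : 0 < T) (hK : 28 / 17 * K ≤ W)
    (h : F ≤ ENNReal.ofReal (28 / 17) * (D + ENNReal.ofReal (T * K))) :
    F / ENNReal.ofReal T ≤ 4 * D / ENNReal.ofReal T + ENNReal.ofReal W := by
  have hT0 : ENNReal.ofReal T ≠ 0 := by simpa using hT
  have h1 : F ≤ 4 * D + ENNReal.ofReal T * ENNReal.ofReal W := by
    refine h.trans ?_
    rw [mul_add, ← ENNReal.ofReal_mul (by norm_num), ← ENNReal.ofReal_mul hT.le]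
    refine add_le_add (mul_le_mul_left ?_ _) (ENNReal.ofReal_le_ofReal ?_)
    · exact (ENNReal.ofReal_le_ofReal (show (28 / 17 : ℝ) ≤ 4 by norm_num)).trans (by simp)
    · nlinarith
  calc _ ≤ (4 * D + ENNReal.ofReal T * ENNReal.ofReal W) / ENNReal.ofReal T := by gcongr
    _ = _ := by
      rw [ENNReal.add_div, mul_comm (ENNReal.ofReal T), ENNReal.mul_div_cancel_right hT0 ENNReal.ofReal_ne_top]

end

end PMC

end

/-! ### The averaged Fisher information bound -/

theorem theorem2 {n : ℕ}
    -- the likelihood `ℓ = ℓ(y | ·)` of the observation, the prior density, the score network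
    (ℓ p : PMC.Vec n → ℝ) (S : PMC.Vec n → ℝ → PMC.Vec n)
    (hℓ_pos : ∀ x, 0 < ℓ x) (hp_pos : ∀ x, 0 < p x) (hp_one : ∫ x, p x = 1)
    (hℓp : Integrable (fun x => ℓ x * p x))
    -- the smoothing strength, the step size, the number of iterations
    (σ γ : ℝ) (hσ : 0 < σ) (hγ : 0 < γ) (N : ℕ) (hN : 0 < N)
    -- the constants
    (Lg Lp Lσ εσ C Rg : ℝ) (hLg : 0 < Lg) (hLp : 0 < Lp) (hLσ : 0 < Lσ) (hRg : 0 < Rg)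
    -- the log-likelihood and the log-prior have Lipschitz gradients
    (hℓ_diff : Differentiable ℝ (fun x => Real.log (ℓ x)))
    (hℓ_lip : ∀ x₁ x₂, ‖PMC.score ℓ x₁ - PMC.score ℓ x₂‖ ≤ Lg * ‖x₁ - x₂‖)
    (hp_diff : Differentiable ℝ (fun x => Real.log (p x)))
    (hp_lip : ∀ x₁ x₂, ‖PMC.score p x₁ - PMC.score p x₂‖ ≤ Lp * ‖x₁ - x₂‖)
    -- the score network is Lipschitz and approximates the smoothed score up to `εσ`
    (hS_lip : ∀ x₁ x₂, ‖S x₁ σ - S x₂ σ‖ ≤ Lσ * ‖x₁ - x₂‖)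
    (hS_err : ∀ x, ‖S x σ - PMC.score (PMC.smoothedPrior p σ) x‖ ≤ εσ)
    -- the mismatch of the smoothed score
    (hC : ∀ x, ‖PMC.score (PMC.smoothedPrior p σ) x - PMC.score p x‖ ≤ σ * C)
    -- the gradient of the data-fidelity term is bounded
    (hg_bdd : ∀ x, ‖gradient (PMC.dataFidelity ℓ) x‖ ≤ Rg)
    -- the initial point and the driving Brownian motion
    {Ω : Type*} [MeasurableSpace Ω] (P : Measure Ω) [IsProbabilityMeasure P]
    (x₀ : Ω → PMC.Vec n) (hx₀ : Measurable x₀)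
    (B : ℝ≥0 → Ω → PMC.Vec n) (hB : PMC.IsBrownianMotion B P)
    (hx₀B : IndepFun x₀ (fun ω t => B t ω) P)
    -- the laws of the interpolation
    (ν : ℝ → Measure (PMC.Vec n))
    (hν : ν = PMC.interpolationLaw P γ (PMC.dataFidelity ℓ) (fun x => S x σ) x₀ B)
    -- the step size condition
    (L : ℝ) (hL : L = Lg + max (Lσ + γ * Lg * Lσ) Lp) (hγL : γ * L ≤ 1 / √32) :
    (∫⁻ t in Set.Icc (0 : ℝ) (N * γ), PMC.relFisherInfo (ν t) (PMC.posterior ℓ p))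
        / ENNReal.ofReal (N * γ)
      ≤ 4 * InformationTheory.klDiv (ν 0) (PMC.posterior ℓ p) / ENNReal.ofReal (N * γ)
        + ENNReal.ofReal ((24 * n * L ^ 2 + 7 * Lσ * Rg ^ 2) * γ
            + 36 * C ^ 2 * σ ^ 2 + 36 * εσ ^ 2) := by
  subst hν
  have hsq : (γ * L) ^ 2 ≤ 1 / 32 := by
    have h1 : 0 ≤ γ * L := by
      have : 0 ≤ max (Lσ + γ * Lg * Lσ) Lp := hLp.le.trans (le_max_right _ _)
      rw [hL]
      positivity
    calc (γ * L) ^ 2 ≤ (1 / √32) ^ 2 := by gcongr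
      _ = _ := by rw [div_pow, Real.sq_sqrt (by norm_num), one_pow]
  -- The maximum in `L` is used through two consequences: `Lσ ≤ L`, which controls the error of the
  -- inner gradient step, and `Lg + Lp ≤ L`, which makes the gradient of the potential
  -- `L`-Lipschitz.
  have hLσL : Lσ ≤ L := by
    have h1 : Lσ + γ * Lg * Lσ ≤ max (Lσ + γ * Lg * Lσ) Lp := le_max_left _ _
    have h2 : 0 ≤ γ * Lg * Lσ := by positivity
    linarith
  have hLL : Lg + Lp ≤ L := by
    rw [hL]
    gcongr
    exact le_max_right _ _
  have hT : (0 : ℝ) < N * γ := by positivity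
  have hπ := PMC.posterior_eq hℓ_pos hp_pos hℓp
  have hV := PMC.isPotential_potential hℓ_diff hℓ_lip hp_diff hp_lip hLL (hLσ.le.trans hLσL)
  have hb : Continuous (PMC.pnpDrift γ (PMC.dataFidelity ℓ) fun x => S x σ) :=
    PMC.continuous_pnpDrift hLg.le hLσ.le hℓ_lip hS_lip
  have he := PMC.norm_pnpDrift_sub_le hγ.le hLσ.le hS_lip hS_err hC hg_bdd
  have := PMC.isProbabilityMeasure_posterior hℓ_pos hp_pos hℓp
  have hρ : IsProbabilityMeasure (P.map x₀) := Measure.isProbabilityMeasure_map hx₀.aemeasurable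
  rw [PMC.interpolationLaw_zero]
  -- For infinite initial entropy the right-hand side is infinite, since the divisor is finite.
  by_cases hkl : InformationTheory.klDiv (P.map x₀) (PMC.posterior ℓ p) = ∞
  · rw [hkl, ENNReal.mul_top (by norm_num), ENNReal.top_div_of_ne_top ENNReal.ofReal_ne_top, top_add]
    exact le_top
  refine PMC.div_le_of_le_mul_add hT ?_ (PMC.lintegral_relFisherInfo_le hb hV hπ hkl he hγ hsq N
    fun k s hs hsγ => PMC.interpolationLaw_eq hb hγ hB hx₀ hx₀B k hs.le hsγ)
  -- The smoothing bias enters as `a = σ * C`.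
  refine (PMC.drift_error_le hγ hLσ hLσL hsq).trans (le_of_eq ?_)
  ring
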